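/- **Setting.** Work over $\mathbb C$, with Sweedler notation and summation over repeated indices. Let $\mathcal H$ be a coquasitriangular Hopf algebra with universal $r$-form $r$, that is, $r(a_{(1)}\otimes b_{(1)})\,a_{(2)}b_{(2)}=b_{(1)}a_{(1)}\,r(a_{(2)}\otimes b_{(2)})$, $r(ab\otimes c)=r(a\otimes c_{(1)})r(b\otimes c_{(2)})$, $r(1\otimes c)=\varepsilon(c)$, $r(a\otimes bc)=r(a_{(1)}\otimes c)r(a_{(2)}\otimes b)$, $r(a\otimes 1)=\varepsilon(a)$ (for instance $\mathcal O(SL_q(N))$, $\mathcal O(SO_q(N))$, $\mathcal O(Sp_q(N))$). Let $u=(u^i_j)$ and $v=(v^i_j)$, $1\le i,j\le N$, be matrices over $\mathcal H$ with $\Delta(u^i_j)=u^i_k\otimes u^k_j$, $\varepsilon(u^i_j)=\delta_{ij}$, and likewise for $v$ (for instance $v=u$ or $v^i_j=S(u^j_i)$). Let $J\in\mathbb C^{N\times N}$ be an invertible solution of the reflection equation $$r(u^j_a\otimes u^i_b)J^{ac}r(v^k_c\otimes u^b_d)J^{dl}=J^{ia}r(v^c_a\otimes u^j_b)J^{bd}r(v^l_c\otimes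 v^k_d).$$ Put $K^{ij}(a)=r(S(a_{(1)})\otimes u^i_k)J^{kl}r(v^j_l\otimes a_{(2)})$, $$\mathcal X=\{a\in\mathcal H: a_{(1)}K^{ij}(a_{(2)})=K^{ij}(1)\,a\ \text{for all } i,j\},$$ $w^{ij}=u^i_kJ^{kl}v^j_l$ and $W=\mathrm{Lin}\{w^{ij}\}$. Let $h$ be a linear functional on $\mathcal H$ with $h(1)=1$ and $a_{(1)}h(a_{(2)})=h(a)1$ for $a\in W$ (for instance the Haar functional), and let $P=(\mathrm{id}-1\,h)(W)$. For a basis $e^1,\dots,e^M$ of $P$ with $\Delta(e^i)=\pi^i_j\otimes e^j$ put $\chi^i(a)=r(e^i\otimes a)-\varepsilon(e^i)\varepsilon(a)$, $\chi=(\chi^{ij})$ with $\chi^{ij}=\chi^i(e^j)$, and, if $\chi$ is invertible, $\partial_i(a)=a_{(1)}\chi^k(a_{(2)})(\chi^{-1})_{jk}S(\pi^j_i)$. Put $\phi^{mn}(a)=r(u^m_l\otimes a_{(1)})r(a_{(2)}\otimes u^l_n)-\delta_{mn}\varepsilon(a)$, $\phi=(\phi^{mn,ij})$ with $\phi^{mn,ij}=\phi^{mn}(u^i_j)$,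 and, if $\phi$ is invertible, $\partial_{ij}(a)=a_{(1)}\,(\phi^{-1})_{kj,mn}\phi^{mn}(a_{(2)})\,S(u^k_i)$. A first order differential calculus on an algebra $A$ is an $A$-bimodule $\Gamma$ with a linear map $\mathrm d:A\to\Gamma$ such that $\mathrm d(ab)=\mathrm da\,b+a\,\mathrm db$ and $\Gamma=\mathrm{Lin}\{a\,\mathrm db\}$. The *constructed calculus* on $\mathcal X$ (for $\chi$ invertible) is the one that is covariant (the map $a\,\mathrm db\mapsto a_{(1)}b_{(1)}\otimes a_{(2)}\mathrm db_{(2)}$ is well defined), in which $\mathrm da=a_i\,\mathrm de^i$ with unique $a_i\in\mathcal X$ for all $a\in\mathcal X$, and in which these coefficients are $a_i=\partial_i(a)$. The *standard bicovariant calculus* on $\mathcal H$ (for $\phi$ invertible) is the one that is bicovariant (the map $a\,\mathrm db\mapsto a_{(1)}b_{(1)}\otimes a_{(2)}\mathrm db_{(2)}\otimes a_{(3)}b_{(3)}$ is well defined), in which $\mathrm da=a_{ij}\,\mathrm du^i_j$ with unique $a_{ij}\in\mathcal H$ for all $a\in\mathcal H$, and in which these coefficients are $a_{ij}=\partial_{ij}(a)$.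 Calculi are considered up to isomorphism. **Claim.** 1. $P\subseteq\mathcal X$, and for every basis of $P$ as above: $\chi$ is invertible if and only if the matrix with coefficients $c^{mn,ij}=\phi^{mn}(u^i_kJ^{kl}v^j_l)$ has rank $M$. If $\chi$ and $\phi$ are invertible, then every constructed calculus on $\mathcal X$ is isomorphic to the subcalculus $\mathrm{Lin}\{a\,\mathrm db: a,b\in\mathcal X\}$ of the standard bicovariant calculus on $\mathcal H$, by an injective linear map compatible with both $\mathcal X$-actions and with $\mathrm d$; and the chain rule $\partial_{ij}(a)=\partial_k(a)\,\partial_{ij}(e^k)$ holds for all $a\in\mathcal X$ and all $i,j$. 2. ($SU(N)/SO(N)$.) Let $N\ge2$, $q\in\mathbb C\setminus\{0\}$, and let $s$ be an $N$-th root of $q$ (write $s=q^{1/N}$). Take $\mathcal H=\mathcal O(SL_q(N))$, generated by $u^i_j$ with the relations $Ru_1u_2=u_2u_1R$ and $\det_q(u)=1$, where $R=q\sum_iE_{ii}\otimes E_{ii}+\sum_{i\ne j}E_{ii}\otimes E_{jj}+(q-q^{-1})\sum_{i>j}E_{ij}\otimes E_{ji}$, with the universal $r$-form determined by $r(u^i_k\otimes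 u^j_l)=s^{-1}R^{ij}_{kl}$; take $v=u$ and $J=\mathrm{diag}(a_1,\dots,a_N)$ with all $a_i\neq0$. Then $J$ is an invertible solution of the reflection equation, $M=N(N+1)/2$, and $\chi$ is invertible if and only if $$(q^{4/N}-1)\,q^2\sum_{i=1}^Nq^{-2i}\neq q^4-1\neq0,\qquad q^{4/N}:=s^4 .$$ 3. ($SU(N)/Sp(N)$.) Let $N\ge4$ be even, $\mathcal H$, $s$, $r$ and $v=u$ as in 2, and $J=\sum_{k=1}^{N/2}a_k(E_{2k-1,2k}-q\,E_{2k,2k-1})$ with all $a_k\ne0$. Then $J$ is an invertible solution of the reflection equation, $M=N(N-1)/2$, and $\chi$ is invertible if and only if $$(q^{4/N}-1)\,q^4\sum_{i=1}^{N/2}q^{-4i}\neq q^2-1\neq0,\qquad q^{4/N}:=s^4 .$$ -/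

import Mathlib

open scoped TensorProduct

universe u w

noncomputable section

namespace QSpace

open Coalgebra HopfAlgebra MulOpposite

section General

variable {H : Type u} [Ring H] [HopfAlgebra ℂ H]

/-- The convolution product of functionals, `(f ∗ g)(a) = f(a₍₁₎) g(a₍₂₎)`. -/
def conv (f g : H →ₗ[ℂ] ℂ) : H →ₗ[ℂ] ℂ :=
  LinearMap.mul' ℂ ℂ ∘ₗ TensorProduct.map f g ∘ₗ comul

/-- The operator `a ↦ a₍₁₎ f(a₍₂₎)`. -/
def hit (f : H →ₗ[ℂ] ℂ) : H →ₗ[ℂ] H :=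
  (TensorProduct.rid ℂ H).toLinearMap ∘ₗ f.lTensor H ∘ₗ comul

/-- Universal `r`-forms on a Hopf algebra; `r a b` stands for `r(a ⊗ b)`. -/
structure IsUniversalRForm (r : H →ₗ[ℂ] H →ₗ[ℂ] ℂ) : Prop where
  /-- `r(a₍₁₎ ⊗ b₍₁₎) a₍₂₎ b₍₂₎ = b₍₁₎ a₍₁₎ r(a₍₂₎ ⊗ b₍₂₎)` -/
  comm : ∀ a b : H,
    TensorProduct.lid ℂ H (TensorProduct.map₂ r (LinearMap.mul ℂ H) (comul a) (comul b)) =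
      TensorProduct.rid ℂ H (TensorProduct.map₂ (LinearMap.mul ℂ H).flip r (comul a) (comul b))
  /-- `r(a b ⊗ c) = r(a ⊗ c₍₁₎) r(b ⊗ c₍₂₎)` -/
  mul_left : ∀ a b c : H, r (a * b) c = conv (r a) (r b) c
  one_left : ∀ c : H, r 1 c = counit c
  /-- `r(a ⊗ b c) = r(a₍₁₎ ⊗ c) r(a₍₂₎ ⊗ b)` -/
  mul_right : ∀ a b c : H, r a (b * c) = conv (r.flip c) (r.flip b) a
  one_right : ∀ a : H, r a 1 = counit a

/-- A matrix corepresentation: `Δ(u^i_j) = u^i_k ⊗ u^k_j` and `ε(u^i_j) = δ_{ij}`. -/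
structure IsCorep {N : ℕ} (U : Matrix (Fin N) (Fin N) H) : Prop where
  comul_apply : ∀ i j, comul (U i j) = ∑ k, U i k ⊗ₜ[ℂ] U k j
  counit_apply : ∀ i j, counit (R := ℂ) (U i j) = if i = j then 1 else 0

/-- The reflection equation for `J`. -/
def ReflectionEquation {N : ℕ} (r : H →ₗ[ℂ] H →ₗ[ℂ] ℂ) (U V : Matrix (Fin N) (Fin N) H)
    (J : Matrix (Fin N) (Fin N) ℂ) : Prop :=
  ∀ i j k l : Fin N,
    ∑ a, ∑ b, ∑ c, ∑ d, r (U j a) (U i b) * J a c * r (V k c) (U b d) * J d l =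
      ∑ a, ∑ b, ∑ c, ∑ d, J i a * r (V c a) (U j b) * J b d * r (V l c) (V k d)

/-- `K^{ij}(a) = r(S(a₍₁₎) ⊗ u^i_k) J^{kl} r(v^j_l ⊗ a₍₂₎)`. -/
def KFun {N : ℕ} (r : H →ₗ[ℂ] H →ₗ[ℂ] ℂ) (U V : Matrix (Fin N) (Fin N) H)
    (J : Matrix (Fin N) (Fin N) ℂ) (i j : Fin N) : H →ₗ[ℂ] ℂ :=
  ∑ k, ∑ l, J k l • conv (r.flip (U i k) ∘ₗ antipode ℂ) (r (V j l))

theorem hit_repr (f : H →ₗ[ℂ] ℂ) (a : H) :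
    hit f a = ∑ i ∈ (ℛ ℂ a).index, f ((ℛ ℂ a).right i) • (ℛ ℂ a).left i := by
  simp only [hit, LinearMap.comp_apply]
  conv_lhs => rw [← (ℛ ℂ a).eq]
  simp

theorem conv_repr (f g : H →ₗ[ℂ] ℂ) (a : H) :
    conv f g a = ∑ i ∈ (ℛ ℂ a).index, f ((ℛ ℂ a).left i) * g ((ℛ ℂ a).right i) := by
  simp only [conv, LinearMap.comp_apply]
  conv_lhs => rw [← (ℛ ℂ a).eq]
  simp

theorem conv_repr_mul (f g : H →ₗ[ℂ] ℂ) (a b : H) :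
    conv f g (a * b) = ∑ i ∈ (ℛ ℂ a).index, ∑ j ∈ (ℛ ℂ b).index,
      f ((ℛ ℂ a).left i * (ℛ ℂ b).left j) * g ((ℛ ℂ a).right i * (ℛ ℂ b).right j) := by
  simp only [conv, LinearMap.comp_apply, Bialgebra.comul_mul]
  conv_lhs => rw [← (ℛ ℂ a).eq, ← (ℛ ℂ b).eq]
  simp [Finset.sum_mul_sum]

theorem hit_one (f : H →ₗ[ℂ] ℂ) : hit f 1 = f 1 • 1 := by
  simp [hit, Algebra.TensorProduct.one_def]

theorem hit_sum_smul {ι : Type} [Fintype ι] (c : ι → ℂ) (f : ι → H →ₗ[ℂ] ℂ) (a : H) :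
    hit (∑ p, c p • f p) a = ∑ p, c p • hit (f p) a := by
  simp only [hit_repr, LinearMap.sum_apply, LinearMap.smul_apply, Finset.sum_smul,
    Finset.smul_sum, smul_smul, smul_eq_mul]
  exact Finset.sum_comm

theorem conv_corep_right {N : ℕ} {U : Matrix (Fin N) (Fin N) H} (hU : IsCorep U)
    (f g : H →ₗ[ℂ] ℂ) (i j : Fin N) :
    conv f g (U i j) = ∑ k, f (U i k) * g (U k j) := by
  simp [conv, hU.comul_apply]

theorem conv_mul_aux {ι κ : Type} [Fintype ι] [Fintype κ] (f g : H →ₗ[ℂ] ℂ)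
    (f₁ f₂ : ι → H →ₗ[ℂ] ℂ) (g₁ g₂ : κ → H →ₗ[ℂ] ℂ)
    (hf : ∀ x y, f (x * y) = ∑ m, f₁ m x * f₂ m y)
    (hg : ∀ x y, g (x * y) = ∑ n, g₁ n x * g₂ n y) (a b : H) :
    conv f g (a * b) = ∑ m, ∑ n, conv (f₁ m) (g₁ n) a * conv (f₂ m) (g₂ n) b := by
  rw [conv_repr_mul]
  simp only [conv_repr, hf, hg, Finset.sum_mul_sum]
  calc _ = ∑ i ∈ (ℛ ℂ a).index, ∑ m, ∑ j ∈ (ℛ ℂ b).index, ∑ n,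
        f₁ m ((ℛ ℂ a).left i) * f₂ m ((ℛ ℂ b).left j) *
          (g₁ n ((ℛ ℂ a).right i) * g₂ n ((ℛ ℂ b).right j)) :=
        Finset.sum_congr rfl fun i _ => Finset.sum_comm
    _ = ∑ m, ∑ i ∈ (ℛ ℂ a).index, ∑ j ∈ (ℛ ℂ b).index, ∑ n,
        f₁ m ((ℛ ℂ a).left i) * f₂ m ((ℛ ℂ b).left j) *
          (g₁ n ((ℛ ℂ a).right i) * g₂ n ((ℛ ℂ b).right j)) := Finset.sum_comm
    _ = _ := by
      refine Finset.sum_congr rfl fun m _ => ?_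
      rw [Finset.sum_congr rfl fun i _ => Finset.sum_comm, Finset.sum_comm]
      refine Finset.sum_congr rfl fun n _ => Finset.sum_congr rfl fun i _ =>
        Finset.sum_congr rfl fun j _ => ?_
      ring

theorem hit_mul_aux {ι : Type} [Fintype ι] (f : H →ₗ[ℂ] ℂ) (g h : ι → H →ₗ[ℂ] ℂ)
    (hf : ∀ x y, f (x * y) = ∑ m, g m x * h m y) (a b : H) :
    hit f (a * b) = ∑ m, hit (g m) a * hit (h m) b := by
  simp only [hit, LinearMap.comp_apply, Bialgebra.comul_mul]
  conv_lhs => rw [← (ℛ ℂ a).eq, ← (ℛ ℂ b).eq]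
  conv_rhs => rw [← (ℛ ℂ a).eq, ← (ℛ ℂ b).eq]
  simp only [Finset.sum_mul_sum, Algebra.TensorProduct.tmul_mul_tmul, map_sum,
    LinearMap.lTensor_tmul, LinearEquiv.coe_coe, TensorProduct.rid_tmul, hf, Finset.sum_smul]
  rw [Finset.sum_congr rfl fun i _ => Finset.sum_comm, Finset.sum_comm]
  refine Finset.sum_congr rfl fun m _ => Finset.sum_congr rfl fun i _ =>
    Finset.sum_congr rfl fun j _ => ?_
  rw [smul_mul_smul_comm]

/-- `K^{ij}(a b) = K^{mn}(a) r(S(b₍₁₎) ⊗ u^i_m) r(v^j_n ⊗ b₍₂₎)`. -/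
theorem KFun_mul {N : ℕ} {r : H →ₗ[ℂ] H →ₗ[ℂ] ℂ} (hr : IsUniversalRForm r)
    {U V : Matrix (Fin N) (Fin N) H} (hU : IsCorep U) (hV : IsCorep V)
    (J : Matrix (Fin N) (Fin N) ℂ) (i j : Fin N) (a b : H) :
    KFun r U V J i j (a * b) = ∑ p : Fin N × Fin N, KFun r U V J p.1 p.2 a *
      conv (r.flip (U i p.1) ∘ₗ antipode ℂ) (r (V j p.2)) b := by
  have h1 : ∀ (k : Fin N) (x y : H), (r.flip (U i k) ∘ₗ antipode ℂ) (x * y) =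
      ∑ m, (r.flip (U m k) ∘ₗ antipode ℂ) x * (r.flip (U i m) ∘ₗ antipode ℂ) y :=
    fun k x y => by
      simp only [LinearMap.comp_apply, LinearMap.flip_apply]
      rw [antipode_mul_antidistrib, hr.mul_left, conv_corep_right hU]
      exact Finset.sum_congr rfl fun m _ => mul_comm _ _
  have h2 : ∀ (l : Fin N) (x y : H), r (V j l) (x * y) =
      ∑ n, r (V n l) x * r (V j n) y := fun l x y => by
    rw [hr.mul_right, conv_corep_right hV]
    exact Finset.sum_congr rfl fun m _ => mul_comm _ _
  simp only [KFun, LinearMap.sum_apply, LinearMap.smul_apply, smul_eq_mul,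
    Fintype.sum_prod_type, Finset.sum_mul]
  rw [Finset.sum_congr rfl fun k _ => Finset.sum_congr rfl fun l _ => congrArg _
    (conv_mul_aux _ _ _ _ _ _ (h1 k) (h2 l) a b)]
  simp only [Finset.mul_sum, ← mul_assoc]
  calc _ = ∑ k, ∑ m, ∑ l, ∑ n, J k l *
        conv (r.flip (U m k) ∘ₗ antipode ℂ) (r (V n l)) a *
        conv (r.flip (U i m) ∘ₗ antipode ℂ) (r (V j n)) b :=
        Finset.sum_congr rfl fun k _ => Finset.sum_comm
    _ = ∑ m, ∑ k, ∑ l, ∑ n, J k l *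
        conv (r.flip (U m k) ∘ₗ antipode ℂ) (r (V n l)) a *
        conv (r.flip (U i m) ∘ₗ antipode ℂ) (r (V j n)) b := Finset.sum_comm
    _ = _ := by
      refine Finset.sum_congr rfl fun m _ => ?_
      rw [Finset.sum_congr rfl fun k _ => Finset.sum_comm, Finset.sum_comm]

/-- The function algebra of the quantum space defined by `J`:
all `a` with `a₍₁₎ ξ(a₍₂₎) = ξ(1) a` for `ξ` in the linear span of the `K^{ij}`. -/
def quantumSpace {N : ℕ} {r : H →ₗ[ℂ] H →ₗ[ℂ] ℂ} (hr : IsUniversalRForm r)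
    {U V : Matrix (Fin N) (Fin N) H} (hU : IsCorep U) (hV : IsCorep V)
    (J : Matrix (Fin N) (Fin N) ℂ) : Subalgebra ℂ H where
  carrier := {a | ∀ i j, hit (KFun r U V J i j) a = KFun r U V J i j 1 • a}
  add_mem' ha hb i j := by rw [map_add, ha i j, hb i j, smul_add]
  algebraMap_mem' c i j := by rw [Algebra.algebraMap_eq_smul_one, map_smul, hit_one, smul_comm]
  mul_mem' {a b} ha hb i j := by
    rw [hit_mul_aux _ _ _ (KFun_mul hr hU hV J i j)]
    have h : ∀ p : Fin N × Fin N, hit (KFun r U V J p.1 p.2) a = KFun r U V J p.1 p.2 1 • a :=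
      fun p => ha p.1 p.2
    simp only [h, smul_mul_assoc, ← mul_smul_comm, ← Finset.mul_sum]
    rw [← hb i j]
    have h2 : KFun r U V J i j = ∑ p : Fin N × Fin N, KFun r U V J p.1 p.2 1 •
        conv (r.flip (U i p.1) ∘ₗ antipode ℂ) (r (V j p.2)) := by
      ext x
      rw [← one_mul x, KFun_mul hr hU hV, one_mul]
      simp
    conv_rhs => rw [h2, hit_sum_smul]
end General

section QuantumMatrices

/-- The number of inversions. -/
def inv {N : ℕ} (I : Fin N → Fin N) : ℕ :=
  (Finset.univ.filter fun p : Fin N × Fin N => p.1 < p.2 ∧ I p.2 < I p.1).card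

/-- Entries `R^{ij}_{kl}` of the `R`-matrix of type `A`, that is of
`q Σ e_{ii} ⊗ e_{ii} + Σ_{i ≠ j} e_{ii} ⊗ e_{jj} + (q - q⁻¹) Σ_{i > j} e_{ij} ⊗ e_{ji}`. -/
def RMat {N : ℕ} (q : ℂ) (i j k l : Fin N) : ℂ :=
  (if i = k ∧ j = l then (if i = j then q else 1) else 0) +
    (if i = l ∧ j = k ∧ j < i then q - q⁻¹ else 0)

variable {A : Type u} [Ring A] [Algebra ℂ A]

/-- The ordered product `T^{i_1}_{j_1} ⋯ T^{i_n}_{j_n}`. -/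
def word {N n : ℕ} (T : Matrix (Fin N) (Fin N) A) (I J : Fin n → Fin N) : A :=
  (List.ofFn fun t => T (I t) (J t)).prod

/-- The quantum determinant `Σ_σ (-q)^{ℓ(σ)} T^1_{σ(1)} ⋯ T^N_{σ(N)}`. -/
def qdet {N : ℕ} (q : ℂ) (T : Matrix (Fin N) (Fin N) A) : A :=
  ∑ σ : Equiv.Perm (Fin N), (-q) ^ inv σ • word T id σ

/-- The relations `R T₁ T₂ = T₂ T₁ R`. -/
def FRT {N : ℕ} (q : ℂ) (T : Matrix (Fin N) (Fin N) A) : Prop :=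
  ∀ i j k l, ∑ m, ∑ n, RMat q i j m n • (T m k * T n l) =
    ∑ m, ∑ n, RMat q m n k l • (T j n * T i m)

/-- The relations of the canonical generators of `O(SL_q(N))`. -/
structure IsQuantumSL {N : ℕ} (q : ℂ) (T : Matrix (Fin N) (Fin N) A) : Prop where
  frt : FRT q T
  row : qdet q T = 1
  col : qdet q T.transpose = 1

/-- q-antisymmetry in the adjacent positions `a`, `b`. -/
def QAnti {N n : ℕ} {B : Type*} [AddCommGroup B] [Module ℂ B] (q : ℂ) (a b : Fin n) (F : (Fin n → Fin N) → B) : Prop :=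
  ∀ J, (J a = J b → F J = 0) ∧ (J a < J b → F (J ∘ Equiv.swap a b) = -q • F J)

/-- The q-antisymmetric tensor. -/
def eps {N : ℕ} (q : ℂ) (J : Fin N → Fin N) : ℂ :=
  if Function.Injective J then (-q) ^ inv J else 0

theorem inv_swap {N : ℕ} (I : Fin N → Fin N) {a b : Fin N} (hab : a.val + 1 = b.val)
    (h : I a < I b) : inv (I ∘ Equiv.swap a b) = inv I + 1 := by
  have hne : a ≠ b := fun h => by subst h; omega
  have key : (Finset.univ.filter fun p : Fin N × Fin N => p.1 < p.2 ∧
      (I ∘ Equiv.swap a b) p.2 < (I ∘ Equiv.swap a b) p.1) =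
      insert (a, b) ((Finset.univ.filter fun p : Fin N × Fin N => p.1 < p.2 ∧ I p.2 < I p.1).map
        ((Equiv.swap a b).prodCongr (Equiv.swap a b)).toEmbedding) := by
    ext ⟨s, t⟩
    simp only [Finset.mem_filter, Finset.mem_univ, true_and, Finset.mem_insert, Finset.mem_map,
      Prod.mk.injEq, Prod.exists, Function.comp_apply, Equiv.coe_toEmbedding,
      Equiv.prodCongr_apply, Prod.map_apply]
    constructor
    · rintro ⟨hst, hI⟩
      by_cases hc : s = a ∧ t = b
      · exact Or.inl hc
      · refine Or.inr ⟨Equiv.swap a b s, Equiv.swap a b t, ⟨?_, hI⟩, by simp, by simp⟩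
        clear hI h
        simp only [Equiv.swap_apply_def]
        simp only [Fin.lt_def, Fin.ext_iff] at *
        split_ifs <;> omega
    · rintro (⟨rfl, rfl⟩ | ⟨s', t', ⟨hst, hI⟩, rfl, rfl⟩)
      · exact ⟨by rw [Fin.lt_def]; omega, by simpa using h⟩
      · refine ⟨?_, by simpa using hI⟩
        have hc : ¬ (s' = a ∧ t' = b) := by
          rintro ⟨rfl, rfl⟩; exact absurd hI (not_lt.2 h.le)
        clear hI h
        simp only [Equiv.swap_apply_def]
        simp only [Fin.lt_def, Fin.ext_iff] at *
        split_ifs <;> omega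
  rw [inv, key, Finset.card_insert_of_notMem, Finset.card_map, inv]
  simp only [Finset.mem_map, Finset.mem_filter, Finset.mem_univ, true_and, not_exists, not_and,
    Equiv.coe_toEmbedding, Equiv.prodCongr_apply, Prod.forall, Prod.map_apply, Prod.mk.injEq]
  rintro s t ⟨hst, -⟩ h1 h2
  have hs : s = b := by simpa using congrArg (Equiv.swap a b) h1
  have ht : t = a := by simpa using congrArg (Equiv.swap a b) h2
  subst hs ht
  rw [Fin.lt_def] at hst
  omega

theorem eps_anti {N : ℕ} (q : ℂ) {a b : Fin N} (hab : a.val + 1 = b.val) :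
    QAnti q a b (eps (N := N) q) := by
  have hne : a ≠ b := fun h => by subst h; omega
  intro J
  refine ⟨fun h => ?_, fun h => ?_⟩
  · rw [eps, if_neg fun hJ => hne (hJ h)]
  · rw [eps, eps, inv_swap J hab h]
    by_cases hJ : Function.Injective J
    · rw [if_pos hJ, if_pos (hJ.comp (Equiv.swap a b).injective), pow_succ, smul_eq_mul, mul_comm]
    · rw [if_neg hJ, if_neg, smul_zero]
      intro h'
      apply hJ
      have := h'.comp (Equiv.swap a b).injective
      simpa [Function.comp_assoc] using this

theorem anti_unique {N : ℕ} {B : Type*} [AddCommGroup B] [Module ℂ B] (q : ℂ) (F : (Fin N → Fin N) → B)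
    (hF : ∀ a b : Fin N, a.val + 1 = b.val → QAnti q a b F) (I : Fin N → Fin N) :
    F I = eps q I • F id := by
  induction h : inv I using Nat.strong_induction_on generalizing I with
  | _ n ih =>
    subst h
    by_cases h1 : ∃ a b : Fin N, a.val + 1 = b.val ∧ I a = I b
    · obtain ⟨a, b, hab, hI⟩ := h1
      rw [(hF a b hab I).1 hI, (eps_anti q hab I).1 hI, zero_smul]
    by_cases h2 : ∃ a b : Fin N, a.val + 1 = b.val ∧ I b < I a
    · obtain ⟨a, b, hab, hI⟩ := h2
      have hs : (I ∘ Equiv.swap a b) a < (I ∘ Equiv.swap a b) b := by simpa using hI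
      have hid : (I ∘ Equiv.swap a b) ∘ Equiv.swap a b = I := by
        ext x; simp
      have e1 := (hF a b hab _).2 hs
      have e2 := (eps_anti q hab _).2 hs
      have e3 := inv_swap _ hab hs
      rw [hid] at e1 e2 e3
      rw [e1, e2, ih _ (by omega) (I ∘ Equiv.swap a b) rfl, smul_smul, smul_eq_mul]
    · have hm : StrictMono I := by
        rcases N with _ | N
        · intro x; exact x.elim0
        · refine Fin.strictMono_iff_lt_succ.2 fun i => ?_
          rcases lt_trichotomy (I i.castSucc) (I i.succ) with h | h | h
          · exact h
          · exact absurd ⟨_, _, by simp, h⟩ h1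
          · exact absurd ⟨_, _, by simp, h⟩ h2
      have hid : I = id := by
        ext x
        exact congrArg Fin.val (le_antisymm hm.apply_le hm.le_apply)
      subst hid
      have h0 : inv (id : Fin N → Fin N) = 0 := by
        rw [inv, Finset.card_eq_zero, Finset.filter_eq_empty_iff]
        rintro ⟨s, t⟩ - ⟨h, h'⟩
        exact absurd h (not_lt.2 h'.le)
      rw [eps, if_pos Function.injective_id, h0, pow_zero, one_smul]

theorem word_cons {N n : ℕ} (T : Matrix (Fin N) (Fin N) A) (i j : Fin N) (I J : Fin n → Fin N) :
    word T (Fin.cons i I) (Fin.cons j J) = T i j * word T I J := by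
  simp [word, List.ofFn_succ]

theorem word_snoc {N n : ℕ} (T : Matrix (Fin N) (Fin N) A) (i j : Fin N) (I J : Fin n → Fin N) :
    word T (Fin.snoc (α := fun _ => Fin N) I i) (Fin.snoc (α := fun _ => Fin N) J j) = word T I J * T i j := by
  rw [word, List.ofFn_succ']; simp [word]

theorem sum_cons {N n : ℕ} {B : Type*} [AddCommMonoid B] (F : (Fin (n + 1) → Fin N) → B) :
    ∑ J, F J = ∑ j, ∑ J, F (Fin.cons j J) := by
  rw [← Fintype.sum_prod_type']
  exact (Fintype.sum_equiv (Fin.consEquiv fun _ => Fin N) _ _ fun _ => rfl).symm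

theorem sum_snoc {N n : ℕ} {B : Type*} [AddCommMonoid B] (F : (Fin (n + 1) → Fin N) → B) :
    ∑ J, F J = ∑ j, ∑ J, F (Fin.snoc (α := fun _ => Fin N) J j) := by
  rw [← Fintype.sum_prod_type']
  exact (Fintype.sum_equiv (Fin.snocEquiv fun _ => Fin N) _ _ fun _ => rfl).symm

theorem sum_RMat_left {N : ℕ} {B : Type*} [AddCommGroup B] [Module ℂ B] (q : ℂ) (i j : Fin N)
    (G : Fin N → Fin N → B) : ∑ m, ∑ n, RMat q i j m n • G m n =
      (if i = j then q else 1) • G i j + (if j < i then q - q⁻¹ else 0) • G j i := by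
  simp only [RMat, add_smul, Finset.sum_add_distrib, ite_and, ite_smul, zero_smul]
  congr 1
  · simp
  · rw [Finset.sum_comm]; simp

theorem sum_RMat_right {N : ℕ} {B : Type*} [AddCommGroup B] [Module ℂ B] (q : ℂ) (k l : Fin N)
    (G : Fin N → Fin N → B) : ∑ m, ∑ n, RMat q m n k l • G m n =
      (if k = l then q else 1) • G k l + (if k < l then q - q⁻¹ else 0) • G l k := by
  simp only [RMat, add_smul, Finset.sum_add_distrib, ite_and, ite_smul, zero_smul]
  congr 1
  · simp
  · simp

theorem sum_pairs {N : ℕ} {B : Type*} [AddCommGroup B] (X : Fin N → Fin N → B) :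
    ∑ k, ∑ l, X k l = ∑ k, ∑ l, if k < l then X k l + X l k else if k = l then X k k else 0 := by
  have h : ∀ k l, X k l = (if k < l then X k l else 0) + (if k = l then X k k else 0) +
      (if l < k then X k l else 0) := fun k l => by
    rcases lt_trichotomy k l with h | h | h
    · simp [h, h.ne, h.not_gt]
    · subst h; simp
    · simp [h, h.ne', h.not_gt]
  rw [Finset.sum_congr rfl fun k _ => Finset.sum_congr rfl fun l _ => h k l]
  simp only [Finset.sum_add_distrib]
  rw [Finset.sum_comm (f := fun k l => if l < k then X k l else 0)]
  simp only [← Finset.sum_add_distrib]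
  refine Finset.sum_congr rfl fun k _ => Finset.sum_congr rfl fun l _ => ?_
  rcases lt_trichotomy k l with h | h | h
  · simp [h, h.ne]
  · subst h; simp
  · simp [h.ne', h.not_gt]

section
variable {N : ℕ} {q : ℂ} {T : Matrix (Fin N) (Fin N) A}

theorem FRT.same_row (hT : FRT q T) (hq : q ≠ 0) (i : Fin N) {k l : Fin N} (h : k < l) :
    T i k * T i l = q • (T i l * T i k) := by
  have h1 := hT i i k l
  rw [sum_RMat_left, sum_RMat_right (G := fun m n => T i n * T i m)] at h1
  simp only [if_true, lt_irrefl, if_false, zero_smul, add_zero, h.ne, h, one_smul, sub_smul] at h1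
  have h2 : q⁻¹ • (T i k * T i l) = T i l * T i k := by
    rw [← sub_eq_zero] at h1 ⊢
    rw [← h1]; abel
  rw [← h2, smul_smul, mul_inv_cancel₀ hq, one_smul]

theorem FRT.comm (hT : FRT q T) {i j k l : Fin N} (hij : i < j) (h : k < l) :
    T i l * T j k = T j k * T i l := by
  have h1 := hT i j l k
  rw [sum_RMat_left, sum_RMat_right (G := fun m n => T j n * T i m)] at h1
  simpa [hij.ne, hij.not_gt, h.ne', h.not_gt] using h1

theorem FRT.cross (hT : FRT q T) {i j k l : Fin N} (hij : i < j) (h : k < l) :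
    T i k * T j l = T j l * T i k + (q - q⁻¹) • (T j k * T i l) := by
  have h1 := hT i j k l
  rw [sum_RMat_left, sum_RMat_right (G := fun m n => T j n * T i m)] at h1
  simpa [hij.ne, hij.not_gt, h.ne, h] using h1

theorem FRT.pair_same (hT : FRT q T) (hq : q ≠ 0) (g : Fin N → Fin N → A) (h0 : ∀ k, g k k = 0)
    (h1 : ∀ k l, k < l → g l k = -q • g k l) (i : Fin N) :
    ∑ k, ∑ l, T i k * T i l * g k l = 0 := by
  rw [sum_pairs]
  refine Finset.sum_eq_zero fun k _ => Finset.sum_eq_zero fun l _ => ?_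
  split_ifs with h h
  · rw [h1 k l h, hT.same_row hq i h]
    simp
  · rw [h0, mul_zero]
  · rfl

theorem FRT.pair_lt (hT : FRT q T) (hq : q ≠ 0) (g : Fin N → Fin N → A) (h0 : ∀ k, g k k = 0)
    (h1 : ∀ k l, k < l → g l k = -q • g k l) {i j : Fin N} (hij : i < j) :
    ∑ k, ∑ l, T j k * T i l * g k l = -q • ∑ k, ∑ l, T i k * T j l * g k l := by
  rw [sum_pairs, sum_pairs fun k l => T i k * T j l * g k l]
  simp only [Finset.smul_sum]
  refine Finset.sum_congr rfl fun k _ => Finset.sum_congr rfl fun l _ => ?_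
  split_ifs with h h
  · rw [h1 k l h, hT.cross hij h, hT.comm hij h]
    simp only [add_mul, smul_mul_assoc, mul_smul_comm, smul_add, smul_smul]
    have e : -q * (q - q⁻¹) = 1 - q * q := by field_simp; ring
    rw [e, sub_smul, one_smul]
    have e2 : -q * -q = q * q := by ring
    rw [e2]
    abel
  · simp [h0]
  · simp

theorem FRT.anti (hT : FRT q T) (hq : q ≠ 0) : ∀ {n : ℕ} (a b : Fin n) (_ : a.val + 1 = b.val)
    (F : (Fin n → Fin N) → ℂ) (_ : QAnti q a b F),
    QAnti q a b fun I => ∑ J, F J • word T I J := by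
  intro n
  induction n with
  | zero => intro a; exact a.elim0
  | succ n ih =>
    intro a b hab F hF
    obtain ⟨b, rfl⟩ : ∃ b', b = Fin.succ b' := Fin.exists_succ_eq.2 (by
      intro h; rw [h] at hab; simp at hab) |>.imp fun _ h => h.symm
    induction a using Fin.cases with
    | succ a =>
      intro I
      obtain ⟨i, I, rfl⟩ : ∃ i I', I = Fin.cons i I' := ⟨I 0, Fin.tail I, (Fin.cons_self_tail I).symm⟩
      have hcons : ∀ (i : Fin N) (I : Fin n → Fin N),
          (Fin.cons i I : Fin (n + 1) → Fin N) ∘ Equiv.swap a.succ b.succ =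
            Fin.cons i (I ∘ Equiv.swap a b) := by
        intro i I
        ext x
        induction x using Fin.cases with
        | zero => 
          rw [Function.comp_apply, Equiv.swap_apply_of_ne_of_ne (Fin.succ_ne_zero _).symm
            (Fin.succ_ne_zero _).symm]
          simp
        | succ x =>
          have := (Fin.succ_injective n).swap_apply a b x
          rw [Function.comp_apply, this]
          simp
      have hF' : ∀ j, QAnti q a b fun J => F (Fin.cons j J) := fun j J => by
        have := hF (Fin.cons j J)
        rwa [hcons, Fin.cons_succ, Fin.cons_succ] at this
      have ih' := fun j => ih a b (by simpa using hab) _ (hF' j) I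
      simp only [sum_cons, word_cons, hcons, Fin.cons_succ, ← mul_smul_comm, ← Finset.mul_sum]
      constructor
      · intro h
        simp only [fun j => (ih' j).1 h, mul_zero, Finset.sum_const_zero]
      · intro h
        simp only [fun j => (ih' j).2 h]
        rw [Finset.smul_sum]
        exact Finset.sum_congr rfl fun j _ => mul_smul_comm _ _ _
    | zero =>
      obtain ⟨n, rfl⟩ : ∃ m, n = m + 1 := ⟨n - 1, by have := b.isLt; omega⟩
      have hb : b = 0 := by ext; simpa using hab
      subst hb
      have hsw : ∀ (k l : Fin N) (J : Fin n → Fin N),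
          (Fin.cons k (Fin.cons l J : Fin (n + 1) → Fin N) : Fin (n + 2) → Fin N) ∘
            Equiv.swap 0 (Fin.succ 0) = Fin.cons l (Fin.cons k J : Fin (n + 1) → Fin N) := by
        intro k l J
        ext x
        refine Fin.cases ?_ (fun x => Fin.cases ?_ (fun x => ?_) x) x
        · simp
        · rw [Function.comp_apply, Equiv.swap_apply_right]; simp
        · rw [Function.comp_apply, Equiv.swap_apply_of_ne_of_ne (Fin.succ_ne_zero _)
            (fun h => Fin.succ_ne_zero _ (Fin.succ_injective _ h))]
          simp
      intro I
      obtain ⟨i, I, rfl⟩ : ∃ i I', I = Fin.cons i I' := ⟨I 0, Fin.tail I, (Fin.cons_self_tail I).symm⟩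
      obtain ⟨j, I, rfl⟩ : ∃ i I', I = Fin.cons i I' := ⟨I 0, Fin.tail I, (Fin.cons_self_tail I).symm⟩
      let g : Fin N → Fin N → A := fun k l =>
        ∑ J : Fin n → Fin N, F (Fin.cons k (Fin.cons l J : Fin (n + 1) → Fin N)) • word T I J
      have g0 : ∀ k, g k k = 0 := fun k => Finset.sum_eq_zero fun J _ => by
        rw [(hF _).1 (by simp), zero_smul]
      have g1 : ∀ k l, k < l → g l k = -q • g k l := fun k l h => by
        simp only [g, Finset.smul_sum, smul_smul]
        refine Finset.sum_congr rfl fun J _ => ?_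
        have := (hF (Fin.cons k (Fin.cons l J : Fin (n + 1) → Fin N))).2 (by simpa using h)
        rw [hsw] at this
        rw [this, smul_eq_mul]
      have hD : ∀ i j, ∑ J, F J • word T (Fin.cons i (Fin.cons j I : Fin (n + 1) → Fin N)) J =
          ∑ k, ∑ l, T i k * T j l * g k l := fun i j => by
        rw [sum_cons]
        refine Finset.sum_congr rfl fun k _ => ?_
        rw [sum_cons]
        refine Finset.sum_congr rfl fun l _ => ?_
        simp only [g, Finset.mul_sum, word_cons, mul_smul_comm, mul_assoc]
      constructor
      · intro h
        have h' : i = j := by simpa using h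
        subst h'
        simp only [hD]
        exact hT.pair_same hq g g0 g1 i
      · intro h
        have h' : i < j := by simpa using h
        rw [hsw]
        simp only [hD]
        exact hT.pair_lt hq g g0 g1 h'

theorem sum_eps {B : Type*} [AddCommGroup B] [Module ℂ B] (q : ℂ) (G : (Fin N → Fin N) → B) :
    ∑ J, eps q J • G J = ∑ σ : Equiv.Perm (Fin N), (-q) ^ inv σ • G σ := by
  simp only [eps, ite_smul, zero_smul]
  rw [← Finset.sum_filter]
  symm
  refine Finset.sum_bij (fun (σ : Equiv.Perm (Fin N)) _ => (σ : Fin N → Fin N)) ?_ ?_ ?_ ?_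
  · intro σ _; simpa using σ.injective
  · intro σ _ τ _ h; exact DFunLike.coe_injective h
  · intro J hJ
    refine ⟨Equiv.ofBijective J (Finite.injective_iff_bijective.1 (by simpa using hJ)), by simp, rfl⟩
  · intro σ _; rfl

/-- The q-antisymmetric tensor is an eigenvector of `T ⊗ ⋯ ⊗ T`. -/
theorem FRT.word_eps (hT : FRT q T) (hq : q ≠ 0) (I : Fin N → Fin N) :
    ∑ J, eps q J • word T I J = eps q I • qdet q T := by
  rw [qdet, ← sum_eps q (word T id)]
  exact anti_unique (B := A) q (fun I => ∑ J, eps q J • word T I J)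
    (fun a b hab => hT.anti hq a b hab _ (eps_anti q hab)) I

theorem FRT.transpose (hT : FRT q T) : FRT q T.transpose := by
  intro i j k l
  have h := hT l k j i
  rw [sum_RMat_left, sum_RMat_right (G := fun m n => T k n * T l m)] at h
  rw [sum_RMat_left (G := fun m n => T.transpose m k * T.transpose n l), sum_RMat_right (G := fun m n => T.transpose j n * T.transpose i m)]
  simp only [Matrix.transpose_apply]
  convert h.symm using 4 <;> simp [eq_comm]

end

end QuantumMatrices

section QM2
variable {A : Type u} [Ring A] [Algebra ℂ A] {N : ℕ} {q : ℂ}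

theorem IsQuantumSL.transpose {T : Matrix (Fin N) (Fin N) A} (h : IsQuantumSL q T) :
    IsQuantumSL q T.transpose :=
  ⟨h.frt.transpose, h.col, h.row⟩

theorem IsQuantumSL.word_eps {T : Matrix (Fin N) (Fin N) A} (h : IsQuantumSL q T) (hq : q ≠ 0)
    (I : Fin N → Fin N) : ∑ J, eps q J • word T I J = eps q I • (1 : A) := by
  rw [h.frt.word_eps hq, h.row]

theorem word_transpose {n : ℕ} (T : Matrix (Fin N) (Fin N) A) (I J : Fin n → Fin N) :
    word T.transpose I J = word T J I := rfl

theorem eps_id : eps q (id : Fin N → Fin N) = 1 := by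
  have h0 : inv (id : Fin N → Fin N) = 0 := by
    rw [inv, Finset.card_eq_zero, Finset.filter_eq_empty_iff]
    rintro ⟨s, t⟩ - ⟨h, h'⟩
    exact absurd h (not_lt.2 h'.le)
  rw [eps, if_pos Function.injective_id, h0, pow_zero]

theorem qdet_eq_sum (T : Matrix (Fin N) (Fin N) A) :
    qdet q T = ∑ J, eps q J • word T id J := (sum_eps q (word T id)).symm

/-! Products of matrices with commuting entries. -/

theorem word_commute {n : ℕ} {x : A} {T : Matrix (Fin N) (Fin N) A} (h : ∀ i j, Commute x (T i j))
    (I J : Fin n → Fin N) : Commute x (word T I J) := by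
  apply Commute.list_prod_right
  intro y hy
  obtain ⟨t, rfl⟩ := List.mem_ofFn.1 hy
  exact h _ _

theorem word_mul {T T' : Matrix (Fin N) (Fin N) A} (h : ∀ i j k l, Commute (T i j) (T' k l)) :
    ∀ {n : ℕ} (I J : Fin n → Fin N), word (T * T') I J = ∑ K, word T I K * word T' K J := by
  intro n
  induction n with
  | zero => intro I J; simp [word]
  | succ n ih =>
    intro I J
    obtain ⟨i, I, rfl⟩ : ∃ i I', I = Fin.cons i I' := ⟨I 0, Fin.tail I, (Fin.cons_self_tail I).symm⟩
    obtain ⟨j, J, rfl⟩ : ∃ i I', J = Fin.cons i I' := ⟨J 0, Fin.tail J, (Fin.cons_self_tail J).symm⟩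
    rw [word_cons, sum_cons, ih, Matrix.mul_apply, Finset.sum_mul_sum]
    refine Finset.sum_congr rfl fun k _ => Finset.sum_congr rfl fun K _ => ?_
    rw [word_cons, word_cons, mul_assoc, mul_assoc, ← mul_assoc (T' k j),
      ← mul_assoc (word T I K)]
    congr 2
    exact ((word_commute (fun a b => (h a b k j).symm) I K)).eq

/-- The matrix with entries `T^i_k T^j_l`. -/
def pairL (T : Matrix (Fin N) (Fin N) A) : Matrix (Fin N × Fin N) (Fin N × Fin N) A :=
  Matrix.of fun x y => T x.1 y.1 * T x.2 y.2

/-- The matrix with entries `T^j_l T^i_k`. -/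
def pairR (T : Matrix (Fin N) (Fin N) A) : Matrix (Fin N × Fin N) (Fin N × Fin N) A :=
  Matrix.of fun x y => T x.2 y.2 * T x.1 y.1

/-- The `R`-matrix with entries in an algebra. -/
def RAlg (A : Type u) [Ring A] [Algebra ℂ A] (N : ℕ) (q : ℂ) :
    Matrix (Fin N × Fin N) (Fin N × Fin N) A :=
  Matrix.of fun x y => algebraMap ℂ A (RMat q x.1 x.2 y.1 y.2)

theorem RAlg_mul (M : Matrix (Fin N × Fin N) (Fin N × Fin N) A) (x y : Fin N × Fin N) :
    (RAlg A N q * M) x y = ∑ m, ∑ n, RMat q x.1 x.2 m n • M (m, n) y := by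
  simp only [RAlg, Matrix.mul_apply, Matrix.of_apply, Fintype.sum_prod_type, Algebra.smul_def]

theorem mul_RAlg (M : Matrix (Fin N × Fin N) (Fin N × Fin N) A) (x y : Fin N × Fin N) :
    (M * RAlg A N q) x y = ∑ m, ∑ n, RMat q m n y.1 y.2 • M x (m, n) := by
  simp only [RAlg, Matrix.mul_apply, Matrix.of_apply, Fintype.sum_prod_type, Algebra.smul_def]
  exact Finset.sum_congr rfl fun m _ => Finset.sum_congr rfl fun n _ =>
    (Algebra.commutes _ _).symm

theorem frt_iff (q : ℂ) (T : Matrix (Fin N) (Fin N) A) :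
    FRT q T ↔ RAlg A N q * pairL T = pairR T * RAlg A N q := by
  rw [← Matrix.ext_iff]
  simp only [RAlg_mul, mul_RAlg, Prod.forall]
  rfl

theorem IsQuantumSL.mul {T T' : Matrix (Fin N) (Fin N) A} (hT : IsQuantumSL q T)
    (hT' : IsQuantumSL q T') (hq : q ≠ 0) (h : ∀ i j k l, Commute (T i j) (T' k l)) :
    IsQuantumSL q (T * T') := by
  have row : ∀ {T T' : Matrix (Fin N) (Fin N) A}, IsQuantumSL q T → IsQuantumSL q T' →
      (∀ i j k l, Commute (T i j) (T' k l)) → qdet q (T * T') = 1 := by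
    intro T T' hT hT' h
    rw [qdet_eq_sum]
    simp only [word_mul h, Finset.smul_sum, ← mul_smul_comm]
    rw [Finset.sum_comm]
    simp only [← Finset.mul_sum, hT'.word_eps hq]
    simp only [mul_smul_comm, mul_one]
    rw [hT.word_eps hq, eps_id, one_smul]
  refine ⟨?_, row hT hT' h, ?_⟩
  · rw [frt_iff]
    have h1 := (frt_iff _ _).1 hT.frt
    have h2 := (frt_iff _ _).1 hT'.frt
    have e1 : pairL (T * T') = pairL T * pairL T' := by
      ext ⟨i, j⟩ ⟨k, l⟩
      simp only [pairL, Matrix.mul_apply, Matrix.of_apply, Fintype.sum_prod_type]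
      rw [Finset.sum_mul_sum]
      exact Finset.sum_congr rfl fun a _ => Finset.sum_congr rfl fun b _ =>
        (h _ _ _ _).symm.mul_mul_mul_comm _ _
    have e2 : pairR (T * T') = pairR T * pairR T' := by
      ext ⟨i, j⟩ ⟨k, l⟩
      simp only [pairR, Matrix.mul_apply, Matrix.of_apply, Fintype.sum_prod_type]
      rw [Finset.sum_mul_sum, Finset.sum_comm]
      exact Finset.sum_congr rfl fun a _ => Finset.sum_congr rfl fun b _ =>
        (h _ _ _ _).symm.mul_mul_mul_comm _ _
    rw [e1, e2, ← mul_assoc, h1, mul_assoc, h2, mul_assoc]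
  · have e : (T * T').transpose = T'.transpose * T.transpose := by
      ext i j
      simp only [Matrix.transpose_apply, Matrix.mul_apply]
      exact Finset.sum_congr rfl fun a _ => (h _ _ _ _).eq
    rw [e]
    exact row hT'.transpose hT.transpose fun i j k l => (h _ _ _ _).symm

theorem word_one {n : ℕ} (I J : Fin n → Fin N) :
    word (1 : Matrix (Fin N) (Fin N) A) I J = if I = J then 1 else 0 := by
  split_ifs with h
  · subst h; simp [word]
  · obtain ⟨t, ht⟩ := Function.ne_iff.1 h
    exact List.prod_eq_zero (List.mem_ofFn.2 ⟨t, Matrix.one_apply_ne ht⟩)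

theorem qdet_lower {T : Matrix (Fin N) (Fin N) A} (h : ∀ i j, i < j → T i j = 0) :
    qdet q T = word T id id := by
  rw [qdet, Finset.sum_eq_single 1]
  · have := eps_id (N := N) (q := q)
    rw [eps, if_pos Function.injective_id] at this
    rw [Equiv.Perm.coe_one, this, one_smul]
  · intro σ _ hσ
    have : ∃ t, t < σ t := by
      by_contra! hc
      apply hσ
      have : ∀ n : ℕ, ∀ t : Fin N, t.val = n → σ t = t := by
        intro n
        induction n using Nat.strong_induction_on with
        | _ n ih =>
          intro t ht
          refine le_antisymm (hc t) (not_lt.1 fun hlt => ?_)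
          have := ih (σ t).val (by rw [← ht]; exact hlt) (σ t) rfl
          exact hlt.ne (σ.injective this)
      ext t
      rw [this t.val t rfl]; rfl
    obtain ⟨t, ht⟩ := this
    rw [word, List.prod_eq_zero, smul_zero]
    exact List.mem_ofFn.2 ⟨t, h _ _ ht⟩
  · simp

theorem qdet_upper {T : Matrix (Fin N) (Fin N) A} (h : ∀ i j, j < i → T i j = 0) :
    qdet q T = word T id id := by
  rw [qdet, Finset.sum_eq_single 1]
  · have := eps_id (N := N) (q := q)
    rw [eps, if_pos Function.injective_id] at this
    rw [Equiv.Perm.coe_one, this, one_smul]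
  · intro σ _ hσ
    have : ∃ t, σ t < t := by
      by_contra! hc
      apply hσ
      have : ∀ n : ℕ, ∀ t : Fin N, N - t.val = n → σ t = t := by
        intro n
        induction n using Nat.strong_induction_on with
        | _ n ih =>
          intro t ht
          refine le_antisymm (not_lt.1 fun hlt => ?_) (hc t)
          have := ih (N - (σ t).val) (by rw [Fin.lt_def] at hlt; omega) (σ t) rfl
          exact hlt.ne' (σ.injective this)
      ext t
      rw [this _ t rfl]; rfl
    obtain ⟨t, ht⟩ := this
    rw [word, List.prod_eq_zero, smul_zero]
    exact List.mem_ofFn.2 ⟨t, h _ _ ht⟩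
  · simp

theorem isQuantumSL_one : IsQuantumSL q (1 : Matrix (Fin N) (Fin N) A) := by
  refine ⟨?_, ?_, ?_⟩
  · rw [frt_iff]
    have e1 : pairL (1 : Matrix (Fin N) (Fin N) A) = 1 := by
      ext ⟨i, j⟩ ⟨k, l⟩
      simp [pairL, Matrix.one_apply, ← ite_and, and_comm]
    have e2 : pairR (1 : Matrix (Fin N) (Fin N) A) = 1 := by
      ext ⟨i, j⟩ ⟨k, l⟩
      simp [pairR, Matrix.one_apply, ← ite_and]
    rw [e1, e2, one_mul, mul_one]
  · rw [qdet_lower fun i j h => Matrix.one_apply_ne h.ne, word_one, if_pos rfl]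
  · rw [Matrix.transpose_one, qdet_lower fun i j h => Matrix.one_apply_ne h.ne, word_one, if_pos rfl]

/-! Invertibility. -/

theorem eps_ne_zero (hq : q ≠ 0) {I : Fin N → Fin N} (h : Function.Injective I) : eps q I ≠ 0 := by
  rw [eps, if_pos h]
  exact pow_ne_zero _ (neg_ne_zero.2 hq)

theorem IsQuantumSL.isUnit {T : Matrix (Fin N) (Fin N) A} (h : IsQuantumSL q T) (hq : q ≠ 0) :
    IsUnit T := by
  rcases N with _ | n
  · exact isUnit_of_subsingleton T
  have injc : ∀ j : Fin (n + 1), Function.Injective (Fin.cons j j.succAbove : Fin (n + 1) → Fin (n + 1)) := by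
    intro j
    rw [Fin.cons_injective_iff]
    exact ⟨by rintro ⟨x, hx⟩; exact Fin.succAbove_ne _ _ hx, Fin.succAbove_right_injective⟩
  have injs : ∀ j : Fin (n + 1), Function.Injective
      (Fin.snoc (α := fun _ => Fin (n + 1)) j.succAbove j : Fin (n + 1) → Fin (n + 1)) := by
    intro j
    rw [Fin.snoc_injective_iff]
    exact ⟨Fin.succAbove_right_injective, by rintro ⟨x, hx⟩; exact Fin.succAbove_ne _ _ hx⟩
  let Y : Matrix (Fin (n + 1)) (Fin (n + 1)) A := Matrix.of fun k j =>
    (eps q (Fin.cons j j.succAbove : Fin (n + 1) → Fin (n + 1)))⁻¹ •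
      ∑ J, eps q (Fin.cons k J : Fin (n + 1) → Fin (n + 1)) • word T j.succAbove J
  let Z : Matrix (Fin (n + 1)) (Fin (n + 1)) A := Matrix.of fun i k =>
    (eps q (Fin.snoc (α := fun _ => Fin (n + 1)) i.succAbove i : Fin (n + 1) → Fin (n + 1)))⁻¹ •
      ∑ I, eps q (Fin.snoc (α := fun _ => Fin (n + 1)) I k : Fin (n + 1) → Fin (n + 1)) •
        word T I i.succAbove
  have h1 : T * Y = 1 := by
    ext i j
    have e := h.word_eps hq (Fin.cons i j.succAbove)
    simp only [sum_cons, word_cons] at e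
    simp only [Matrix.mul_apply, Y, Matrix.of_apply, mul_smul_comm, ← Finset.smul_sum,
      Finset.mul_sum]
    rw [e, smul_smul]
    by_cases hij : i = j
    · subst hij
      rw [inv_mul_cancel₀ (eps_ne_zero hq (injc i)), one_smul, Matrix.one_apply_eq]
    · rw [Matrix.one_apply_ne hij]
      have : eps q (Fin.cons i j.succAbove : Fin (n + 1) → Fin (n + 1)) = 0 := by
        rw [eps, if_neg]
        rw [Fin.cons_injective_iff]
        rintro ⟨h, -⟩
        exact h (Fin.exists_succAbove_eq hij)
      rw [this, mul_zero, zero_smul]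
  have h2 : Z * T = 1 := by
    ext i j
    have e := h.transpose.word_eps hq (Fin.snoc (α := fun _ => Fin (n + 1)) i.succAbove j)
    simp only [sum_snoc, word_transpose, word_snoc] at e
    simp only [Matrix.mul_apply, Z, Matrix.of_apply, smul_mul_assoc, ← Finset.smul_sum,
      Finset.sum_mul]
    rw [e, smul_smul]
    by_cases hij : i = j
    · subst hij
      rw [inv_mul_cancel₀ (eps_ne_zero hq (injs i)), one_smul, Matrix.one_apply_eq]
    · rw [Matrix.one_apply_ne hij]
      have : eps q (Fin.snoc (α := fun _ => Fin (n + 1)) i.succAbove j : Fin (n + 1) → Fin (n + 1)) = 0 := by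
        rw [eps, if_neg]
        rw [Fin.snoc_injective_iff]
        rintro ⟨-, h⟩
        exact h (Fin.exists_succAbove_eq (Ne.symm hij))
      rw [this, mul_zero, zero_smul]
  exact ⟨⟨T, Y, h1, by rw [← left_inv_eq_right_inv h2 h1, h2]⟩, rfl⟩

/-- The matrix `M` with entries in the opposite algebra. -/
def opMat (M : Matrix (Fin N) (Fin N) A) : Matrix (Fin N) (Fin N) Aᵐᵒᵖ := M.map MulOpposite.op

theorem word_opMat_cons {n : ℕ} (M : Matrix (Fin N) (Fin N) A) (i j : Fin N) (I J : Fin n → Fin N) :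
    (word (opMat M) (Fin.cons i I : Fin (n + 1) → Fin N) (Fin.cons j J)).unop =
      (word (opMat M) I J).unop * M i j := by
  rw [word_cons]; rfl

theorem word_inv {T V : Matrix (Fin N) (Fin N) A} (h : T * V = 1) : ∀ {n : ℕ} (I J : Fin n → Fin N),
    ∑ K, word T I K * (word (opMat V) K J).unop = if I = J then 1 else 0 := by
  intro n
  induction n with
  | zero => intro I J; simp [word, Subsingleton.elim I J]
  | succ n ih =>
    intro I J
    obtain ⟨i, I, rfl⟩ : ∃ i I', I = Fin.cons i I' := ⟨I 0, Fin.tail I, (Fin.cons_self_tail I).symm⟩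
    obtain ⟨j, J, rfl⟩ : ∃ i I', J = Fin.cons i I' := ⟨J 0, Fin.tail J, (Fin.cons_self_tail J).symm⟩
    have e : ∀ k, ∑ K, word T (Fin.cons i I : Fin (n + 1) → Fin N) (Fin.cons k K) *
        (word (opMat V) (Fin.cons k K : Fin (n + 1) → Fin N) (Fin.cons j J)).unop =
        T i k * (if I = J then 1 else 0) * V k j := fun k => by
      rw [← ih I J, Finset.mul_sum, Finset.sum_mul]
      refine Finset.sum_congr rfl fun K _ => ?_
      rw [word_cons, word_opMat_cons]
      simp only [mul_assoc]
    rw [sum_cons]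
    simp only [e]
    have h' := congrFun (congrFun h i) j
    rw [Matrix.mul_apply] at h'
    by_cases hIJ : I = J
    · subst hIJ
      simp only [if_true, mul_one, h', Matrix.one_apply, Fin.cons_inj, and_true]
    · simp [hIJ, Fin.cons_inj]

theorem word_inv' {T V : Matrix (Fin N) (Fin N) A} (h : V * T = 1) {n : ℕ} (I J : Fin n → Fin N) :
    ∑ K, (word (opMat V) I K).unop * word T K J = if I = J then 1 else 0 := by
  induction n with
  | zero => simp [word, Subsingleton.elim I J]
  | succ n ih =>
    obtain ⟨i, I, rfl⟩ : ∃ i I', I = Fin.cons i I' := ⟨I 0, Fin.tail I, (Fin.cons_self_tail I).symm⟩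
    obtain ⟨j, J, rfl⟩ : ∃ i I', J = Fin.cons i I' := ⟨J 0, Fin.tail J, (Fin.cons_self_tail J).symm⟩
    rw [sum_cons, Finset.sum_comm]
    have h' := congrFun (congrFun h i) j
    rw [Matrix.mul_apply] at h'
    have e : ∀ K, ∑ k, (word (opMat V) (Fin.cons i I : Fin (n + 1) → Fin N) (Fin.cons k K)).unop *
        word T (Fin.cons k K : Fin (n + 1) → Fin N) (Fin.cons j J) =
        (word (opMat V) I K).unop * (1 : Matrix (Fin N) (Fin N) A) i j * word T K J := fun K => by
      rw [← h', Finset.mul_sum, Finset.sum_mul]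
      refine Finset.sum_congr rfl fun k _ => ?_
      rw [word_opMat_cons, word_cons]
      simp only [mul_assoc]
    simp only [e]
    by_cases hij : i = j
    · subst hij
      simp only [Matrix.one_apply_eq, mul_one, ih, Fin.cons_inj, true_and]
    · simp [hij, Fin.cons_inj, Matrix.one_apply_ne]

theorem IsQuantumSL.inv_op {T V : Matrix (Fin N) (Fin N) A} (hT : IsQuantumSL q T) (hq : q ≠ 0)
    (h1 : T * V = 1) (h2 : V * T = 1) : IsQuantumSL q (opMat V) := by
  refine ⟨?_, ?_, ?_⟩
  · have h := (frt_iff _ _).1 hT.frt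
    have hl : pairL T * (pairL (opMat V)).map MulOpposite.unop = 1 := by
      ext ⟨i, j⟩ ⟨k, l⟩
      simp only [pairL, opMat, Matrix.mul_apply, Matrix.of_apply, Matrix.map_apply,
        Fintype.sum_prod_type, MulOpposite.unop_mul, MulOpposite.unop_op]
      have e1 := fun i k => congrFun (congrFun h1 i) k
      simp only [Matrix.mul_apply] at e1
      have : ∀ a, ∑ b, T i a * T j b * (V b l * V a k) = T i a * (1 : Matrix (Fin N) (Fin N) A) j l * V a k := by
        intro a
        rw [← e1, Finset.mul_sum, Finset.sum_mul]
        exact Finset.sum_congr rfl fun b _ => by simp only [mul_assoc]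
      simp only [this]
      by_cases hjl : j = l
      · subst hjl; simp [e1, Matrix.one_apply]
      · simp [Matrix.one_apply, hjl]
    have hr : (pairR (opMat V)).map MulOpposite.unop * pairR T = 1 := by
      ext ⟨i, j⟩ ⟨k, l⟩
      simp only [pairR, opMat, Matrix.mul_apply, Matrix.of_apply, Matrix.map_apply,
        Fintype.sum_prod_type, MulOpposite.unop_mul, MulOpposite.unop_op]
      have e1 := fun i k => congrFun (congrFun h2 i) k
      simp only [Matrix.mul_apply] at e1
      have : ∀ a, ∑ b, V i a * V j b * (T b l * T a k) = V i a * (1 : Matrix (Fin N) (Fin N) A) j l * T a k := by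
        intro a
        rw [← e1, Finset.mul_sum, Finset.sum_mul]
        exact Finset.sum_congr rfl fun b _ => by simp only [mul_assoc]
      simp only [this]
      by_cases hjl : j = l
      · subst hjl; simp [e1, Matrix.one_apply]
      · simp [Matrix.one_apply, hjl]
    have key : (pairR (opMat V)).map MulOpposite.unop * RAlg A N q =
        RAlg A N q * (pairL (opMat V)).map MulOpposite.unop := by
      calc _ = (pairR (opMat V)).map MulOpposite.unop * (RAlg A N q * pairL T) *
            (pairL (opMat V)).map MulOpposite.unop := by
              rw [mul_assoc, mul_assoc, hl, mul_one]
        _ = _ := by rw [h, ← mul_assoc, hr, one_mul]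
    intro i j k l
    have key' := congrArg MulOpposite.op (congrFun (congrFun key (i, j)) (k, l))
    rw [RAlg_mul, mul_RAlg] at key'
    apply MulOpposite.unop_injective
    simpa [pairL, pairR, Fintype.sum_prod_type] using (congrArg MulOpposite.unop key').symm
  · rw [qdet_eq_sum]
    apply MulOpposite.unop_injective
    rw [MulOpposite.unop_one]
    have : ∀ I : Fin N → Fin N, ∑ J, eps q J • (word (opMat V) I J).unop = eps q I • (1 : A) := by
      intro I
      calc _ = ∑ J, (word (opMat V) I J).unop * (eps q J • (1 : A)) := by simp
        _ = ∑ J, ∑ K, eps q K • ((word (opMat V) I J).unop * word T J K) := by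
          simp only [← hT.word_eps hq, Finset.mul_sum, mul_smul_comm]
        _ = _ := by
          rw [Finset.sum_comm]
          simp only [← Finset.smul_sum, word_inv' h2]
          simp
    simpa [eps_id] using this id
  · rw [qdet_eq_sum]
    apply MulOpposite.unop_injective
    rw [MulOpposite.unop_one]
    have : ∀ J : Fin N → Fin N, ∑ I, eps q I • (word (opMat V) I J).unop = eps q J • (1 : A) := by
      intro J
      calc _ = ∑ I, (eps q I • (1 : A)) * (word (opMat V) I J).unop := by simp
        _ = ∑ I, ∑ K, eps q K • (word T K I * (word (opMat V) I J).unop) := by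
          simp only [← hT.transpose.word_eps hq, Finset.sum_mul, smul_mul_assoc, word_transpose]
        _ = _ := by
          rw [Finset.sum_comm]
          simp only [← Finset.smul_sum, word_inv h1]
          simp
    simpa [eps_id, word_transpose] using this id

end QM2

section QuantumSL

theorem map_word {A B : Type*} [Ring A] [Ring B] {N n : ℕ}
    (f : A →+* B) (T : Matrix (Fin N) (Fin N) A) (I J : Fin n → Fin N) :
    f (word T I J) = word (T.map f) I J := by
  simp [word, map_list_prod, List.map_ofFn, Function.comp_def]

theorem map_qdet {A B : Type*} [Ring A] [Algebra ℂ A] [Ring B] [Algebra ℂ B] {N : ℕ} {q : ℂ}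
    (f : A →ₐ[ℂ] B) (T : Matrix (Fin N) (Fin N) A) : f (qdet q T) = qdet q (T.map f) := by
  simp only [qdet, map_sum, map_smul]
  exact Finset.sum_congr rfl fun σ _ => congrArg _ (map_word (f : A →+* B) T id σ)

/-- The free generators. -/
def freeGen (N : ℕ) : Matrix (Fin N) (Fin N) (FreeAlgebra ℂ (Fin N × Fin N)) :=
  Matrix.of fun i j => FreeAlgebra.ι ℂ (i, j)

/-- The defining relations of `O(SL_q(N))`: `R u₁ u₂ = u₂ u₁ R` and `det_q(u) = 1`, the quantum
determinant being expanded along rows and along columns (both expansions agree modulo the first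
relations). -/
inductive OSLRel (N : ℕ) (q : ℂ) :
    FreeAlgebra ℂ (Fin N × Fin N) → FreeAlgebra ℂ (Fin N × Fin N) → Prop
  | frt (i j k l : Fin N) : OSLRel N q
      (∑ m, ∑ n, RMat q i j m n • (freeGen N m k * freeGen N n l))
      (∑ m, ∑ n, RMat q m n k l • (freeGen N j n * freeGen N i m))
  | row : OSLRel N q (qdet q (freeGen N)) 1
  | col : OSLRel N q (qdet q (freeGen N).transpose) 1

/-- The algebra `O(SL_q(N))`. -/
def OSL (N : ℕ) (q : ℂˣ) : Type := RingQuot (OSLRel N (q : ℂ))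

namespace OSL
variable {N : ℕ} {q : ℂˣ}

instance : Ring (OSL N q) := inferInstanceAs (Ring (RingQuot (OSLRel N (q : ℂ))))
instance : Algebra ℂ (OSL N q) := inferInstanceAs (Algebra ℂ (RingQuot (OSLRel N (q : ℂ))))

variable (N q) in
/-- The canonical projection. -/
def mk : FreeAlgebra ℂ (Fin N × Fin N) →ₐ[ℂ] OSL N q := RingQuot.mkAlgHom ℂ (OSLRel N (q : ℂ))

variable (N q) in
/-- The canonical generators `u^i_j`. -/
def gen : Matrix (Fin N) (Fin N) (OSL N q) := (freeGen N).map (mk N q)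

theorem isQuantumSL_gen : IsQuantumSL (q : ℂ) (gen N q) := by
  have h : ∀ {x y}, OSLRel N (q : ℂ) x y → mk N q x = mk N q y :=
    fun h => RingQuot.mkAlgHom_rel ℂ h
  refine ⟨fun i j k l => ?_, ?_, ?_⟩
  · have := h (OSLRel.frt i j k l)
    simp only [map_sum, map_smul, map_mul] at this
    exact this
  · have := h OSLRel.row
    rwa [map_qdet, map_one] at this
  · have := h OSLRel.col
    rwa [map_qdet, map_one] at this

/-- The universal property. -/
def lift {A : Type*} [Ring A] [Algebra ℂ A] {T : Matrix (Fin N) (Fin N) A}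
    (hT : IsQuantumSL (q : ℂ) T) : OSL N q →ₐ[ℂ] A :=
  RingQuot.liftAlgHom ℂ ⟨FreeAlgebra.lift ℂ fun p => T p.1 p.2, by
    have hm : (freeGen N).map (FreeAlgebra.lift ℂ fun p : Fin N × Fin N => T p.1 p.2) = T := by
      ext i j; simp [freeGen]
    have hm' : ∀ i j, (FreeAlgebra.lift ℂ fun p : Fin N × Fin N => T p.1 p.2) (freeGen N i j) = T i j := by
      intro i j; simp [freeGen]
    rintro x y (⟨i, j, k, l⟩ | _ | _)
    · simp only [map_sum, map_smul, map_mul, hm']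
      exact hT.frt i j k l
    · rw [map_qdet, hm, map_one, hT.row]
    · rw [map_qdet, map_one, ← hT.col]
      congr 1
      ext i j
      exact hm' j i⟩

theorem lift_gen {A : Type*} [Ring A] [Algebra ℂ A] {T : Matrix (Fin N) (Fin N) A}
    (hT : IsQuantumSL (q : ℂ) T) (i j : Fin N) : lift hT (gen N q i j) = T i j := by
  refine (RingQuot.liftAlgHom_mkAlgHom_apply ..).trans ?_
  simp [freeGen]

theorem induction {P : OSL N q → Prop} (h0 : ∀ c : ℂ, P (algebraMap ℂ _ c))
    (h1 : ∀ i j, P (gen N q i j)) (h2 : ∀ a b, P a → P b → P (a + b))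
    (h3 : ∀ a b, P a → P b → P (a * b)) (a : OSL N q) : P a := by
  obtain ⟨x, rfl⟩ := RingQuot.mkAlgHom_surjective ℂ (OSLRel N (q : ℂ)) a
  change P (mk N q x)
  induction x using FreeAlgebra.induction with
  | grade0 c => rw [AlgHom.commutes]; exact h0 c
  | grade1 p => exact h1 p.1 p.2
  | mul a b ha hb => rw [map_mul]; exact h3 _ _ ha hb
  | add a b ha hb => rw [map_add]; exact h2 _ _ ha hb

theorem algHom_ext {A : Type*} [Ring A] [Algebra ℂ A] {f g : OSL N q →ₐ[ℂ] A}
    (h : ∀ i j, f (gen N q i j) = g (gen N q i j)) : f = g := by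
  ext a
  induction a using OSL.induction with
  | h0 c => rw [AlgHom.commutes, AlgHom.commutes]
  | h1 i j => exact h i j
  | h2 a b ha hb => rw [map_add, map_add, ha, hb]
  | h3 a b ha hb => rw [map_mul, map_mul, ha, hb]

/-- Images of generating matrices. -/
theorem _root_.QSpace.IsQuantumSL.map {A B : Type*} [Ring A] [Algebra ℂ A] [Ring B] [Algebra ℂ B]
    {q : ℂ} {T : Matrix (Fin N) (Fin N) A} (hT : IsQuantumSL q T) (f : A →ₐ[ℂ] B) :
    IsQuantumSL q (T.map f) := by
  refine ⟨fun i j k l => ?_, ?_, ?_⟩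
  · have := congrArg f (hT.frt i j k l)
    simp only [map_sum, map_smul, map_mul] at this
    exact this
  · rw [← map_qdet, hT.row, map_one]
  · rw [← Matrix.transpose_map, ← map_qdet, hT.col, map_one]

theorem isQuantumSL_comul : IsQuantumSL (q : ℂ)
    ((gen N q).map (Algebra.TensorProduct.includeLeft : OSL N q →ₐ[ℂ] OSL N q ⊗[ℂ] OSL N q) *
      (gen N q).map (Algebra.TensorProduct.includeRight : OSL N q →ₐ[ℂ] OSL N q ⊗[ℂ] OSL N q)) :=
  (isQuantumSL_gen.map _).mul (isQuantumSL_gen.map _) q.ne_zero fun i j k l => by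
    simp [Commute, SemiconjBy]

/-- The comultiplication. -/
def comulHom : OSL N q →ₐ[ℂ] OSL N q ⊗[ℂ] OSL N q := lift isQuantumSL_comul

theorem comulHom_gen (i j : Fin N) :
    comulHom (gen N q i j) = ∑ k, gen N q i k ⊗ₜ[ℂ] gen N q k j := by
  rw [comulHom, lift_gen, Matrix.mul_apply]
  simp

/-- The counit. -/
def counitHom : OSL N q →ₐ[ℂ] ℂ := lift (isQuantumSL_one (A := ℂ))

theorem counitHom_gen (i j : Fin N) :
    counitHom (gen N q i j) = if i = j then 1 else 0 := by
  rw [counitHom, lift_gen, Matrix.one_apply]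

instance : Bialgebra ℂ (OSL N q) := Bialgebra.ofAlgHom comulHom counitHom
  (by
    apply algHom_ext
    intro i j
    simp only [AlgHom.comp_apply, comulHom_gen, map_sum, Algebra.TensorProduct.map_tmul,
      AlgHom.id_apply, TensorProduct.sum_tmul, TensorProduct.tmul_sum]
    exact Finset.sum_comm)
  (by
    apply algHom_ext
    intro i j
    simp [comulHom_gen, counitHom_gen, TensorProduct.ite_tmul])
  (by
    apply algHom_ext
    intro i j
    simp [comulHom_gen, counitHom_gen, TensorProduct.tmul_ite])

theorem comul_gen (i j : Fin N) :
    comul (R := ℂ) (gen N q i j) = ∑ k, gen N q i k ⊗ₜ[ℂ] gen N q k j := comulHom_gen i j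

theorem counit_gen (i j : Fin N) :
    counit (R := ℂ) (gen N q i j) = if i = j then 1 else 0 := counitHom_gen i j

variable (N q) in
/-- The inverse of the matrix of generators. -/
def genInv : Matrix (Fin N) (Fin N) (OSL N q) :=
  (((isQuantumSL_gen (N := N) (q := q)).isUnit q.ne_zero).unit⁻¹ :
    (Matrix (Fin N) (Fin N) (OSL N q))ˣ)

theorem gen_mul_genInv : gen N q * genInv N q = 1 :=
  ((isQuantumSL_gen (N := N) (q := q)).isUnit q.ne_zero).mul_val_inv

theorem genInv_mul_gen : genInv N q * gen N q = 1 :=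
  ((isQuantumSL_gen (N := N) (q := q)).isUnit q.ne_zero).val_inv_mul

/-- The antipode, as a homomorphism to the opposite algebra. -/
def antipodeHom : OSL N q →ₐ[ℂ] (OSL N q)ᵐᵒᵖ :=
  lift (isQuantumSL_gen.inv_op q.ne_zero gen_mul_genInv genInv_mul_gen)

/-- The antipode. -/
def antipodeLin : OSL N q →ₗ[ℂ] OSL N q :=
  (MulOpposite.opLinearEquiv ℂ).symm.toLinearMap ∘ₗ antipodeHom.toLinearMap

theorem antipodeLin_mul (a b : OSL N q) :
    antipodeLin (a * b) = antipodeLin b * antipodeLin a := by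
  simp [antipodeLin]

theorem antipodeLin_gen (i j : Fin N) : antipodeLin (gen N q i j) = genInv N q i j := by
  simp [antipodeLin, antipodeHom, lift_gen, opMat]

theorem antipode_left (a : OSL N q) :
    LinearMap.mul' ℂ _ (antipodeLin.rTensor _ (comul (R := ℂ) a)) = algebraMap ℂ _ (counit (R := ℂ) a) := by
  induction a using OSL.induction with
  | h0 c => simp [Algebra.algebraMap_eq_smul_one, Algebra.TensorProduct.one_def, antipodeLin]
  | h1 i j =>
    have := congrFun (congrFun (genInv_mul_gen (N := N) (q := q)) i) j
    rw [Matrix.mul_apply] at this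
    simp [comul_gen, counit_gen, antipodeLin_gen, this, Matrix.one_apply]
  | h2 a b ha hb => simp [ha, hb]
  | h3 a b ha hb =>
    rw [← (ℛ ℂ a).eq] at ha
    rw [← (ℛ ℂ b).eq] at hb
    rw [Bialgebra.comul_mul, ← (ℛ ℂ a).eq, ← (ℛ ℂ b).eq]
    simp only [map_sum, LinearMap.rTensor_tmul, LinearMap.mul'_apply, Finset.sum_mul_sum,
      Algebra.TensorProduct.tmul_mul_tmul, antipodeLin_mul] at ha hb ⊢
    rw [Finset.sum_comm]
    have e : ∀ j ∈ (ℛ ℂ b).index, ∑ i ∈ (ℛ ℂ a).index,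
        antipodeLin ((ℛ ℂ b).left j) * antipodeLin ((ℛ ℂ a).left i) *
          ((ℛ ℂ a).right i * (ℛ ℂ b).right j) =
        counit (R := ℂ) a • (antipodeLin ((ℛ ℂ b).left j) * (ℛ ℂ b).right j) := fun j _ => by
      rw [Algebra.smul_def, ← mul_assoc, Algebra.commutes, ← ha, Finset.mul_sum, Finset.sum_mul]
      exact Finset.sum_congr rfl fun i _ => by simp only [mul_assoc]
    rw [Finset.sum_congr rfl e, ← Finset.smul_sum, hb, Bialgebra.counit_mul, map_mul,
      Algebra.smul_def]

theorem antipode_right (a : OSL N q) :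
    LinearMap.mul' ℂ _ (antipodeLin.lTensor _ (comul (R := ℂ) a)) = algebraMap ℂ _ (counit (R := ℂ) a) := by
  induction a using OSL.induction with
  | h0 c => simp [Algebra.algebraMap_eq_smul_one, Algebra.TensorProduct.one_def, antipodeLin]
  | h1 i j =>
    have := congrFun (congrFun (gen_mul_genInv (N := N) (q := q)) i) j
    rw [Matrix.mul_apply] at this
    simp [comul_gen, counit_gen, antipodeLin_gen, this, Matrix.one_apply]
  | h2 a b ha hb => simp [ha, hb]
  | h3 a b ha hb =>
    rw [← (ℛ ℂ a).eq] at ha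
    rw [← (ℛ ℂ b).eq] at hb
    rw [Bialgebra.comul_mul, ← (ℛ ℂ a).eq, ← (ℛ ℂ b).eq]
    simp only [map_sum, LinearMap.lTensor_tmul, LinearMap.mul'_apply, Finset.sum_mul_sum,
      Algebra.TensorProduct.tmul_mul_tmul, antipodeLin_mul] at ha hb ⊢
    have e : ∀ i ∈ (ℛ ℂ a).index, ∑ j ∈ (ℛ ℂ b).index,
        (ℛ ℂ a).left i * (ℛ ℂ b).left j * (antipodeLin ((ℛ ℂ b).right j) *
          antipodeLin ((ℛ ℂ a).right i)) =
        counit (R := ℂ) b • ((ℛ ℂ a).left i * antipodeLin ((ℛ ℂ a).right i)) := fun i _ => by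
      rw [Algebra.smul_def, ← mul_assoc, Algebra.commutes, ← hb, Finset.mul_sum, Finset.sum_mul]
      exact Finset.sum_congr rfl fun i _ => by simp only [mul_assoc]
    rw [Finset.sum_congr rfl e, ← Finset.smul_sum, ha, Bialgebra.counit_mul, mul_comm, map_mul,
      Algebra.smul_def]

instance : HopfAlgebra ℂ (OSL N q) where
  antipode := antipodeLin
  mul_antipode_rTensor_comul := LinearMap.ext antipode_left
  mul_antipode_lTensor_comul := LinearMap.ext antipode_right

end OSL
end QuantumSL

section RForm

theorem frt_of_manin {A : Type u} [Ring A] [Algebra ℂ A] {N : ℕ} {q : ℂ} (hq : q ≠ 0)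
    {T : Matrix (Fin N) (Fin N) A}
    (h1 : ∀ i k l, k < l → T i k * T i l = q • (T i l * T i k))
    (h2 : ∀ i j k, i < j → T i k * T j k = q • (T j k * T i k))
    (h3 : ∀ i j k l, i < j → k < l → T i l * T j k = T j k * T i l)
    (h4 : ∀ i j k l, i < j → k < l →
      T i k * T j l = T j l * T i k + (q - q⁻¹) • (T j k * T i l)) : FRT q T := by
  have hqq : q⁻¹ * q = 1 := inv_mul_cancel₀ hq
  intro i j k l
  rw [sum_RMat_left (G := fun m n => T m k * T n l), sum_RMat_right (G := fun m n => T j n * T i m)]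
  rcases lt_trichotomy i j with hij | rfl | hij
  · rcases lt_trichotomy k l with hkl | rfl | hkl
    · simp [hij.ne, hij.not_gt, hkl.ne, hkl, h4 i j k l hij hkl]
    · simp [hij.ne, hij.not_gt, h2 i j k hij]
    · simp [hij.ne, hij.not_gt, hkl.ne', hkl.not_gt, h3 i j l k hij hkl]
  · rcases lt_trichotomy k l with hkl | rfl | hkl
    · simp only [if_true, lt_irrefl, if_false, zero_smul, add_zero, hkl.ne, hkl, one_smul]
      rw [h1 i k l hkl, smul_smul, smul_smul, sub_mul, hqq, sub_smul, one_smul]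
      abel
    · simp
    · simp [hkl.ne', hkl.not_gt, h1 i l k hkl]
  · rcases lt_trichotomy k l with hkl | rfl | hkl
    · simp [hij.ne', hij, hkl.ne, hkl, h3 j i k l hij hkl]
    · simp only [hij.ne', hij, if_true, lt_irrefl, if_false, zero_smul, add_zero, one_smul]
      rw [h2 j i k hij, smul_smul, smul_smul, sub_mul, hqq, sub_smul, one_smul]
      abel
    · simp [hij.ne', hij, hkl.ne', hkl.not_gt, h4 j i l k hij hkl, h3 j i l k hij hkl]

/-- The matrices of `R`: the entry `(j, l)` of `vecRep i k` is `s⁻¹ R^{ij}_{kl}`. -/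
def vecRep (N : ℕ) (q s : ℂ) : Matrix (Fin N) (Fin N) (Matrix (Fin N) (Fin N) ℂ) :=
  Matrix.of fun i k => Matrix.of fun j l => s⁻¹ * RMat q i j k l

theorem vecRep_self {N : ℕ} {q s : ℂ} (i : Fin N) :
    vecRep N q s i i = Matrix.diagonal fun j => s⁻¹ * if i = j then q else 1 := by
  ext j l
  by_cases h : j = l
  · subst h
    by_cases h' : i = j
    · subst h'; simp [vecRep, RMat]
    · simp [vecRep, RMat, h']
  · rw [Matrix.diagonal_apply_ne _ h]
    simp only [vecRep, Matrix.of_apply, RMat]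
    rw [if_neg fun h' => h h'.2, if_neg fun h' => h'.2.2.ne h'.2.1]
    simp

theorem vecRep_lt {N : ℕ} {q s : ℂ} {i k : Fin N} (h : k < i) :
    vecRep N q s i k = Matrix.single k i (s⁻¹ * (q - q⁻¹)) := by
  ext j l
  simp only [vecRep, Matrix.of_apply, RMat]
  rw [if_neg fun h' => h.ne' h'.1, zero_add, Matrix.single_apply]
  by_cases h1 : k = j ∧ i = l
  · obtain ⟨rfl, rfl⟩ := h1; simp [h]
  · rw [if_neg h1, if_neg fun h' => h1 ⟨h'.2.1.symm, h'.1⟩, mul_zero]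

theorem vecRep_gt {N : ℕ} {q s : ℂ} {i k : Fin N} (h : i < k) : vecRep N q s i k = 0 := by
  ext j l
  simp only [vecRep, Matrix.of_apply, RMat]
  rw [if_neg fun h' => h.ne h'.1, if_neg, add_zero, mul_zero, Matrix.zero_apply]
  rintro ⟨h1, h2, h3⟩
  rw [h2] at h3
  exact h3.not_gt h

theorem single_mul_diagonal' {N : ℕ} (k i : Fin N) (c : ℂ) (d : Fin N → ℂ) :
    Matrix.single k i c * Matrix.diagonal d = Matrix.single k i (c * d i) := by
  ext a b
  rw [Matrix.mul_diagonal, Matrix.single_apply, Matrix.single_apply]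
  split_ifs with h
  · rw [h.2]
  · rw [zero_mul]

theorem diagonal_mul_single' {N : ℕ} (k i : Fin N) (c : ℂ) (d : Fin N → ℂ) :
    Matrix.diagonal d * Matrix.single k i c = Matrix.single k i (d k * c) := by
  ext a b
  rw [Matrix.diagonal_mul, Matrix.single_apply, Matrix.single_apply]
  split_ifs with h
  · rw [h.1]
  · rw [mul_zero]

theorem vecRep_frt {N : ℕ} {q s : ℂ} (hq : q ≠ 0) : FRT q (vecRep N q s) := by
  apply frt_of_manin hq
  · intro i k l hkl
    rcases lt_trichotomy l i with h | rfl | h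
    · simp [vecRep_lt h, vecRep_lt (hkl.trans h), h.ne', (hkl.trans h).ne']
    · rw [vecRep_lt hkl, vecRep_self, single_mul_diagonal', diagonal_mul_single',
        Matrix.smul_single, if_pos rfl, if_neg hkl.ne']
      congr 1
      simp only [smul_eq_mul]
      ring
    · simp [vecRep_gt h]
  · intro i j k hij
    rcases lt_trichotomy k i with h | rfl | h
    · simp [vecRep_lt h, vecRep_lt (h.trans hij), h.ne', (h.trans hij).ne']
    · rw [vecRep_lt hij, vecRep_self, single_mul_diagonal', diagonal_mul_single',
        Matrix.smul_single, if_pos rfl, if_neg hij.ne]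
      congr 1
      simp only [smul_eq_mul]
      ring
    · simp [vecRep_gt h]
  · intro i j k l hij hkl
    rcases lt_trichotomy l i with h | rfl | h
    · rw [vecRep_lt h, vecRep_lt ((hkl.trans h).trans hij),
        Matrix.single_mul_single_of_ne _ _ _ _ (hkl.trans h).ne',
        Matrix.single_mul_single_of_ne _ _ _ _ (h.trans hij).ne']
    · rw [vecRep_lt (hkl.trans hij), vecRep_self, single_mul_diagonal', diagonal_mul_single',
        if_neg hkl.ne', if_neg hij.ne, mul_comm]
    · simp [vecRep_gt h]
  · intro i j k l hij hkl
    rcases lt_trichotomy k i with h | rfl | h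
    · rcases lt_trichotomy l j with h' | rfl | h'
      · rw [vecRep_lt h, vecRep_lt h', vecRep_lt (h.trans hij),
          Matrix.single_mul_single_of_ne (i := l) (h := (h.trans hij).ne'), zero_add]
        rcases lt_trichotomy l i with h'' | rfl | h''
        · rw [vecRep_lt h'', Matrix.single_mul_single_of_ne _ _ _ _ h''.ne',
            Matrix.single_mul_single_of_ne _ _ _ _ h'.ne', smul_zero]
        · rw [vecRep_self, Matrix.single_mul_single_same, single_mul_diagonal',
            if_neg hij.ne, Matrix.smul_single]
          congr 1
          simp only [smul_eq_mul]
          ring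
        · rw [vecRep_gt h'', Matrix.single_mul_single_of_ne _ _ _ _ h''.ne, mul_zero, smul_zero]
      · rw [vecRep_lt h, vecRep_self, vecRep_gt hij, single_mul_diagonal', diagonal_mul_single',
          if_neg hij.ne', if_neg hkl.ne', mul_zero, smul_zero, add_zero, mul_comm]
      · rw [vecRep_gt h', vecRep_gt (hij.trans h')]
        simp
    · rw [vecRep_gt hkl, mul_zero, smul_zero, add_zero, vecRep_self]
      rcases lt_trichotomy l j with h' | rfl | h'
      · rw [vecRep_lt h', single_mul_diagonal', diagonal_mul_single', if_neg hkl.ne, if_neg hij.ne,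
          mul_comm]
      · rw [vecRep_self, Matrix.diagonal_mul_diagonal, Matrix.diagonal_mul_diagonal]
        congr 1
        ext a
        ring
      · simp [vecRep_gt h']
    · rw [vecRep_gt h, vecRep_gt (h.trans hkl)]
      simp

theorem prod_diagonal {N n : ℕ} (f : Fin n → Fin N → ℂ) :
    (List.ofFn fun t => Matrix.diagonal (f t)).prod = Matrix.diagonal fun j => ∏ t, f t j := by
  have h := map_list_prod (Matrix.diagonalRingHom (Fin N) ℂ) (List.ofFn f)
  rw [List.map_ofFn, List.prod_ofFn] at h
  refine h.symm.trans ?_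
  rw [Matrix.diagonalRingHom_apply]
  congr 1
  ext j
  rw [Finset.prod_apply]

theorem isQuantumSL_vecRep {N : ℕ} {q s : ℂ} (hq : q ≠ 0) (hs : s ^ N = q) :
    IsQuantumSL q (vecRep N q s) := by
  have hw : word (vecRep N q s) id id = 1 := by
    simp only [word, id, vecRep_self, prod_diagonal, Finset.prod_mul_distrib,
      Finset.prod_const, Finset.card_univ, Fintype.card_fin, inv_pow, hs, Finset.prod_ite_eq',
      Finset.mem_univ, if_true, inv_mul_cancel₀ hq]
    exact Matrix.diagonal_one
  refine ⟨vecRep_frt hq, ?_, ?_⟩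
  · rw [qdet_lower fun i j h => vecRep_gt h, hw]
  · rw [qdet_upper (T := (vecRep N q s).transpose) fun i j h => vecRep_gt h, word_transpose, hw]

/-- The entry `(i, k)` of `vecRep' j l` is `s⁻¹ R^{ij}_{kl}`. -/
def vecRep' (N : ℕ) (q s : ℂ) : Matrix (Fin N) (Fin N) (Matrix (Fin N) (Fin N) ℂ) :=
  Matrix.of fun j l => Matrix.of fun i k => s⁻¹ * RMat q i j k l

theorem RMat_symm {N : ℕ} (q : ℂ) (i j k l : Fin N) : RMat q i j k l = RMat q l k j i := by
  simp only [RMat]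
  congr 1
  · by_cases h : i = k ∧ j = l
    · obtain ⟨rfl, rfl⟩ := h; simp [eq_comm]
    · rw [if_neg h, if_neg fun h' => h ⟨h'.2.symm, h'.1.symm⟩]
  · by_cases h : i = l ∧ j = k ∧ j < i
    · obtain ⟨rfl, rfl, h⟩ := h; simp [h]
    · rw [if_neg h, if_neg]
      rintro ⟨rfl, rfl, h'⟩
      exact h ⟨rfl, rfl, h'⟩

theorem isQuantumSL_vecRep' {N : ℕ} {q s : ℂ} (hq : q ≠ 0) (hs : s ^ N = q) :
    IsQuantumSL q (opMat (vecRep' N q s)) := by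
  have h := (isQuantumSL_vecRep hq hs).transpose.map
    (Matrix.transposeAlgEquiv (Fin N) ℂ ℂ).toAlgHom
  convert h using 1
  ext j l
  simp only [opMat, Matrix.map_apply, vecRep', Matrix.of_apply]
  apply MulOpposite.unop_injective
  ext i k
  exact congrArg (s⁻¹ * ·) (RMat_symm q i j k l)

/-! Multiplicative families of functionals. -/

variable {N : ℕ} {q : ℂˣ}

/-- Matrices of functionals that form a representation. -/
structure IsMult {κ : Type} [Fintype κ] [DecidableEq κ]
    (M : κ → κ → OSL N q →ₗ[ℂ] ℂ) : Prop where
  mul : ∀ x y a b, M x y (a * b) = ∑ z, M x z a * M z y b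
  one : ∀ x y, M x y 1 = if x = y then 1 else 0

theorem IsMult.intertwine {κ κ' : Type} [Fintype κ] [DecidableEq κ] [Fintype κ'] [DecidableEq κ']
    {M : κ → κ → OSL N q →ₗ[ℂ] ℂ} {M' : κ' → κ' → OSL N q →ₗ[ℂ] ℂ} (h : IsMult M) (h' : IsMult M')
    (t : κ → κ' → ℂ)
    (hg : ∀ i k x y, ∑ z, M x z (OSL.gen N q i k) * t z y = ∑ z, t x z * M' z y (OSL.gen N q i k))
    (a : OSL N q) (x : κ) (y : κ') : ∑ z, M x z a * t z y = ∑ z, t x z * M' z y a := by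
  induction a using OSL.induction generalizing x y with
  | h0 c => simp [Algebra.algebraMap_eq_smul_one, h.one, h'.one, mul_comm]
  | h1 i j => exact hg i j x y
  | h2 a b ha hb => simp only [map_add, add_mul, mul_add, Finset.sum_add_distrib, ha, hb]
  | h3 a b ha hb =>
    simp only [h.mul, h'.mul, Finset.sum_mul, Finset.mul_sum]
    rw [Finset.sum_comm]
    have e1 : ∀ z, ∑ w, M x z a * M z w b * t w y = M x z a * ∑ w, t z w * M' w y b := by
      intro z
      rw [← hb, Finset.mul_sum]
      exact Finset.sum_congr rfl fun w _ => mul_assoc _ _ _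
    simp only [e1, Finset.mul_sum]
    rw [Finset.sum_comm]
    have e2 : ∀ w, ∑ z, M x z a * (t z w * M' w y b) = (∑ z, t x z * M' z w a) * M' w y b := by
      intro w
      rw [← ha, Finset.sum_mul]
      exact Finset.sum_congr rfl fun z _ => (mul_assoc _ _ _).symm
    simp only [e2, Finset.sum_mul]
    rw [Finset.sum_comm]
    exact Finset.sum_congr rfl fun z _ => Finset.sum_congr rfl fun w _ => mul_assoc _ _ _

theorem IsMult.conv {κ κ' : Type} [Fintype κ] [DecidableEq κ] [Fintype κ'] [DecidableEq κ']
    {M : κ → κ → OSL N q →ₗ[ℂ] ℂ} {M' : κ' → κ' → OSL N q →ₗ[ℂ] ℂ} (h : IsMult M) (h' : IsMult M') :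
    IsMult fun (x y : κ × κ') => conv (M x.1 y.1) (M' x.2 y.2) where
  mul x y a b := by
    rw [Fintype.sum_prod_type]
    exact conv_mul_aux _ _ (fun m => M x.1 m) (fun m => M m y.1) (fun m => M' x.2 m)
      (fun m => M' m y.2) (h.mul _ _) (h'.mul _ _) a b
  one x y := by
    simp [QSpace.conv, Algebra.TensorProduct.one_def, h.one, h'.one, Prod.ext_iff, ite_and]
    split_ifs <;> rfl

theorem isMult_counit : IsMult fun (_ _ : Unit) => (counit : OSL N q →ₗ[ℂ] ℂ) where
  mul x y a b := by simp
  one x y := by simp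

theorem IsMult.reindex {κ κ' : Type} [Fintype κ] [DecidableEq κ] [Fintype κ'] [DecidableEq κ']
    {M : κ → κ → OSL N q →ₗ[ℂ] ℂ} (h : IsMult M) (e : κ' ≃ κ) :
    IsMult fun x y => M (e x) (e y) where
  mul x y a b := by
    rw [h.mul]
    exact (Fintype.sum_equiv e _ _ fun _ => rfl).symm
  one x y := by simp [h.one]

section
variable {s : ℂ} (hs : s ^ N = q)

/-- The representation `a ↦ (r(a ⊗ u^j_l))_{jl}`. -/
def rho : OSL N q →ₐ[ℂ] Matrix (Fin N) (Fin N) ℂ := OSL.lift (isQuantumSL_vecRep q.ne_zero hs)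

/-- The functionals `r(· ⊗ u^j_l)`. -/
def rhoFun (j l : Fin N) : OSL N q →ₗ[ℂ] ℂ := Matrix.entryLinearMap ℂ ℂ j l ∘ₗ (rho hs).toLinearMap

theorem isMult_rhoFun : IsMult (rhoFun hs) where
  mul x y a b := by simp [rhoFun, Matrix.mul_apply]
  one x y := by simp [rhoFun, Matrix.one_apply]

theorem rhoFun_gen (i j k l : Fin N) :
    rhoFun hs j l (OSL.gen N q i k) = s⁻¹ * RMat q i j k l := by
  simp [rhoFun, rho, OSL.lift_gen, vecRep]
end

end RForm

section RForm2
variable {N : ℕ} {q : ℂˣ} {s : ℂ} (hs : s ^ N = q)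

/-- The functionals `r(· ⊗ u^j_l)` as elements of the convolution algebra. -/
def rhoConv : Matrix (Fin N) (Fin N) (WithConv (OSL N q →ₗ[ℂ] ℂ)) :=
  Matrix.of fun j l => WithConv.toConv (rhoFun hs j l)

/-- Functionals `r(· ⊗ u^{j_1}_{l_1} ⋯ u^{j_n}_{l_n})`. -/
def wordFun {n : ℕ} (I J : Fin n → Fin N) : OSL N q →ₗ[ℂ] ℂ :=
  (word (opMat (rhoConv hs)) I J).unop.ofConv

theorem wordFun_zero (I J : Fin 0 → Fin N) : wordFun hs I J = counit := by
  simp only [wordFun, word, List.ofFn_zero, List.prod_nil, MulOpposite.unop_one]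
  ext a
  rfl

theorem wordFun_cons {n : ℕ} (i j : Fin N) (I J : Fin n → Fin N) :
    wordFun hs (Fin.cons i I : Fin (n + 1) → Fin N) (Fin.cons j J) =
      conv (wordFun hs I J) (rhoFun hs i j) := by
  simp only [wordFun, word_opMat_cons]
  rfl

theorem isMult_wordFun : ∀ n : ℕ, IsMult fun I J : Fin n → Fin N => wordFun hs I J := by
  intro n
  induction n with
  | zero =>
    simp only [wordFun_zero]
    exact isMult_counit.reindex (Equiv.ofUnique (Fin 0 → Fin N) Unit)
  | succ n ih =>
    have h := (ih.conv (isMult_rhoFun hs)).reindex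
      ((Fin.consEquiv fun _ : Fin (n + 1) => Fin N).symm.trans (Equiv.prodComm _ _))
    convert h using 3 with I J
    obtain ⟨i, I, rfl⟩ : ∃ i I', I = Fin.cons i I' := ⟨I 0, Fin.tail I, (Fin.cons_self_tail I).symm⟩
    obtain ⟨j, J, rfl⟩ : ∃ i I', J = Fin.cons i I' := ⟨J 0, Fin.tail J, (Fin.cons_self_tail J).symm⟩
    rw [wordFun_cons]
    rfl

theorem wordFun_gen : ∀ {n : ℕ} (I J : Fin n → Fin N) (i k : Fin N),
    wordFun hs I J (OSL.gen N q i k) = (word (opMat (vecRep' N q s)) I J).unop i k := by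
  intro n
  induction n with
  | zero =>
    intro I J i k
    rw [wordFun_zero, OSL.counit_gen]
    simp [word, Matrix.one_apply]
  | succ n ih =>
    intro I J i k
    obtain ⟨a, I, rfl⟩ : ∃ i I', I = Fin.cons i I' := ⟨I 0, Fin.tail I, (Fin.cons_self_tail I).symm⟩
    obtain ⟨b, J, rfl⟩ : ∃ i I', J = Fin.cons i I' := ⟨J 0, Fin.tail J, (Fin.cons_self_tail J).symm⟩
    rw [wordFun_cons, word_opMat_cons, Matrix.mul_apply]
    simp only [conv, LinearMap.comp_apply, OSL.comul_gen, map_sum, TensorProduct.map_tmul,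
      LinearMap.mul'_apply, ih, rhoFun_gen]
    rfl

theorem wordFun_eps (I : Fin N → Fin N) (a : OSL N q) :
    ∑ J, eps (q : ℂ) J * wordFun hs I J a = eps (q : ℂ) I * counit (R := ℂ) a := by
  have h := (isMult_wordFun hs N).intertwine isMult_counit (fun I _ => eps (q : ℂ) I) (by
    intro i k I _
    have e := congrArg MulOpposite.unop ((isQuantumSL_vecRep' q.ne_zero hs).word_eps q.ne_zero I)
    have e' := congrFun (congrFun e i) k
    simp only [Finset.unop_sum, MulOpposite.unop_smul, Matrix.sum_apply, Matrix.smul_apply,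
      MulOpposite.unop_one, Matrix.one_apply, smul_eq_mul] at e'
    simp only [wordFun_gen, OSL.counit_gen, Finset.univ_unique, Finset.sum_singleton]
    rw [← e']
    exact Finset.sum_congr rfl fun _ _ => mul_comm _ _) a I ()
  simp only [Finset.univ_unique, Finset.sum_singleton] at h
  rw [← h]
  exact Finset.sum_congr rfl fun _ _ => mul_comm _ _

theorem wordFun_eps' (J : Fin N → Fin N) (a : OSL N q) :
    ∑ I, eps (q : ℂ) I * wordFun hs I J a = eps (q : ℂ) J * counit (R := ℂ) a := by
  have h := isMult_counit.intertwine (isMult_wordFun hs N) (fun _ I => eps (q : ℂ) I) (by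
    intro i k _ J
    have e := congrArg MulOpposite.unop
      ((isQuantumSL_vecRep' q.ne_zero hs).transpose.word_eps q.ne_zero J)
    have e' := congrFun (congrFun e i) k
    simp only [Finset.unop_sum, MulOpposite.unop_smul, Matrix.sum_apply, Matrix.smul_apply,
      MulOpposite.unop_one, Matrix.one_apply, smul_eq_mul, word_transpose] at e'
    simp only [wordFun_gen, OSL.counit_gen, Finset.univ_unique, Finset.sum_singleton]
    rw [e', mul_comm]) a () J
  simp only [Finset.univ_unique, Finset.sum_singleton] at h
  rw [← h, mul_comm]

theorem isQuantumSL_rhoConv : IsQuantumSL (q : ℂ) (opMat (rhoConv hs)) := by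
  refine ⟨?_, ?_, ?_⟩
  · intro i j k l
    apply MulOpposite.unop_injective
    apply WithConv.ofConv_injective
    ext a
    have h1 : IsMult fun (x y : Fin N × Fin N) => conv (rhoFun hs x.2 y.2) (rhoFun hs x.1 y.1) :=
      ((isMult_rhoFun hs).conv (isMult_rhoFun hs)).reindex (Equiv.prodComm _ _)
    have h2 := (isMult_rhoFun hs).conv (isMult_rhoFun hs)
    have h := h2.intertwine h1 (fun x y => RMat (q : ℂ) x.1 x.2 y.1 y.2) (by
      rintro a b ⟨i, j⟩ ⟨k, l⟩
      have e := congrArg MulOpposite.unop ((isQuantumSL_vecRep' q.ne_zero hs).frt i j k l)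
      have e' := congrFun (congrFun e a) b
      simp only [Finset.unop_sum, MulOpposite.unop_smul, Matrix.sum_apply, Matrix.smul_apply,
        smul_eq_mul, opMat, Matrix.map_apply, MulOpposite.unop_mul, MulOpposite.unop_op,
        Matrix.mul_apply] at e'
      simp only [Fintype.sum_prod_type, conv, LinearMap.comp_apply, OSL.comul_gen, map_sum,
        TensorProduct.map_tmul, LinearMap.mul'_apply, rhoFun_gen]
      refine Eq.trans ?_ e'.symm
      exact Finset.sum_congr rfl fun _ _ => Finset.sum_congr rfl fun _ _ => mul_comm _ _) a (i, j) (k, l)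
    simp only [Fintype.sum_prod_type] at h
    have h' : ∑ m, ∑ n, RMat (q : ℂ) i j m n * conv (rhoFun hs n l) (rhoFun hs m k) a =
        ∑ m, ∑ n, RMat (q : ℂ) m n k l * conv (rhoFun hs i m) (rhoFun hs j n) a := by
      rw [← h]
      exact Finset.sum_congr rfl fun _ _ => Finset.sum_congr rfl fun _ _ => mul_comm _ _
    simpa [opMat, rhoConv, conv] using h'
  · rw [qdet_eq_sum]
    apply MulOpposite.unop_injective
    apply WithConv.ofConv_injective
    ext a
    have h := wordFun_eps hs id a
    rw [eps_id, one_mul] at h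
    simpa [wordFun] using h
  · rw [qdet_eq_sum]
    apply MulOpposite.unop_injective
    apply WithConv.ofConv_injective
    ext a
    have h := wordFun_eps' hs id a
    rw [eps_id, one_mul] at h
    simpa [wordFun, word_transpose] using h

/-- The homomorphism `b ↦ r(· ⊗ b)` to the opposite convolution algebra. -/
def rHom : OSL N q →ₐ[ℂ] (WithConv (OSL N q →ₗ[ℂ] ℂ))ᵐᵒᵖ := OSL.lift (isQuantumSL_rhoConv hs)

/-- The universal `r`-form of `O(SL_q(N))` with `r(u^i_k ⊗ u^j_l) = s⁻¹ R^{ij}_{kl}`,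
where `s` is an `N`-th root of `q`. -/
def OSL.rForm : OSL N q →ₗ[ℂ] OSL N q →ₗ[ℂ] ℂ :=
  LinearMap.flip
    { toFun := fun b => (rHom hs b).unop.ofConv
      map_add' := fun a b => by rw [map_add]; rfl
      map_smul' := fun c a => by rw [map_smul]; rfl }

theorem rForm_flip_gen (j l : Fin N) : (OSL.rForm hs).flip (OSL.gen N q j l) = rhoFun hs j l := by
  ext a
  simp [OSL.rForm, rHom, OSL.lift_gen, opMat, rhoConv]

theorem OSL.rForm_gen (i j k l : Fin N) :
    OSL.rForm hs (OSL.gen N q i k) (OSL.gen N q j l) = s⁻¹ * RMat (q : ℂ) i j k l := by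
  rw [← LinearMap.flip_apply, rForm_flip_gen, rhoFun_gen]

theorem rForm_flip_one : (OSL.rForm hs).flip 1 = counit := by
  ext a
  simp only [OSL.rForm, LinearMap.flip_flip]
  simp [LinearMap.convOne_def]

theorem rForm_flip_mul (b c : OSL N q) : (OSL.rForm hs).flip (b * c) =
    conv ((OSL.rForm hs).flip c) ((OSL.rForm hs).flip b) := by
  ext a
  simp only [OSL.rForm, LinearMap.flip_flip, LinearMap.coe_mk, AddHom.coe_mk, map_mul,
    MulOpposite.unop_mul]
  rfl

end RForm2

section RForm3

section Hits
variable {H : Type u} [Ring H] [HopfAlgebra ℂ H]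

/-- The operator `a ↦ f(a₍₁₎) a₍₂₎`. -/
def lhit (f : H →ₗ[ℂ] ℂ) : H →ₗ[ℂ] H :=
  (TensorProduct.lid ℂ H).toLinearMap ∘ₗ f.rTensor H ∘ₗ comul

theorem lhit_repr (f : H →ₗ[ℂ] ℂ) (a : H) :
    lhit f a = ∑ i ∈ (ℛ ℂ a).index, f ((ℛ ℂ a).left i) • (ℛ ℂ a).right i := by
  simp only [lhit, LinearMap.comp_apply]
  conv_lhs => rw [← (ℛ ℂ a).eq]
  simp

theorem hit_conv (f g : H →ₗ[ℂ] ℂ) (a : H) : hit (conv f g) a = hit f (hit g a) := by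
  let Θ : (H ⊗[ℂ] H) ⊗[ℂ] H →ₗ[ℂ] H := (TensorProduct.rid ℂ H).toLinearMap ∘ₗ
    TensorProduct.map ((TensorProduct.rid ℂ H).toLinearMap ∘ₗ f.lTensor H) g
  have e1 : Θ (comul.rTensor H (comul a)) = hit f (hit g a) := by
    rw [hit_repr g]
    conv_lhs => rw [← (ℛ ℂ a).eq]
    simp [Θ, hit]
  have e2 : Θ ((TensorProduct.assoc ℂ H H H).symm (comul.lTensor H (comul a))) =
      hit (conv f g) a := by
    have : Θ ∘ₗ (TensorProduct.assoc ℂ H H H).symm.toLinearMap = (TensorProduct.rid ℂ H).toLinearMap ∘ₗ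
        (LinearMap.mul' ℂ ℂ ∘ₗ TensorProduct.map f g).lTensor H := by
      ext x y z
      simp [Θ, smul_smul, mul_comm]
    have := LinearMap.congr_fun this (comul.lTensor H (comul a))
    refine this.trans ?_
    rw [hit, conv]
    conv_lhs => rw [← (ℛ ℂ a).eq]
    conv_rhs => rw [LinearMap.comp_apply, LinearMap.comp_apply, ← (ℛ ℂ a).eq]
    simp
  rw [← e1, ← e2, Coalgebra.coassoc_symm_apply]

theorem lhit_conv (f g : H →ₗ[ℂ] ℂ) (a : H) : lhit (conv f g) a = lhit g (lhit f a) := by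
  let Θ : H ⊗[ℂ] (H ⊗[ℂ] H) →ₗ[ℂ] H := (TensorProduct.lid ℂ H).toLinearMap ∘ₗ
    TensorProduct.map f ((TensorProduct.lid ℂ H).toLinearMap ∘ₗ g.rTensor H)
  have e1 : Θ (comul.lTensor H (comul a)) = lhit g (lhit f a) := by
    rw [lhit_repr f]
    conv_lhs => rw [← (ℛ ℂ a).eq]
    simp [Θ, lhit]
  have e2 : Θ ((TensorProduct.assoc ℂ H H H) (comul.rTensor H (comul a))) =
      lhit (conv f g) a := by
    have : Θ ∘ₗ (TensorProduct.assoc ℂ H H H).toLinearMap = (TensorProduct.lid ℂ H).toLinearMap ∘ₗ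
        (LinearMap.mul' ℂ ℂ ∘ₗ TensorProduct.map f g).rTensor H := by
      ext x y z
      simp [Θ, smul_smul, mul_comm]
    have := LinearMap.congr_fun this (comul.rTensor H (comul a))
    refine this.trans ?_
    rw [lhit, conv]
    conv_lhs => rw [← (ℛ ℂ a).eq]
    conv_rhs => rw [LinearMap.comp_apply, LinearMap.comp_apply, ← (ℛ ℂ a).eq]
    simp
  rw [← e1, ← e2, Coalgebra.coassoc_apply]

theorem lhit_hit (f g : H →ₗ[ℂ] ℂ) (a : H) : lhit f (hit g a) = hit g (lhit f a) := by
  let Θ : H ⊗[ℂ] (H ⊗[ℂ] H) →ₗ[ℂ] H := (TensorProduct.lid ℂ H).toLinearMap ∘ₗ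
    TensorProduct.map f ((TensorProduct.rid ℂ H).toLinearMap ∘ₗ g.lTensor H)
  have e1 : Θ (comul.lTensor H (comul a)) = hit g (lhit f a) := by
    rw [lhit_repr f]
    conv_lhs => rw [← (ℛ ℂ a).eq]
    simp [Θ, hit]
  have e2 : Θ ((TensorProduct.assoc ℂ H H H) (comul.rTensor H (comul a))) =
      lhit f (hit g a) := by
    have : Θ ∘ₗ (TensorProduct.assoc ℂ H H H).toLinearMap = (TensorProduct.rid ℂ H).toLinearMap ∘ₗ
        TensorProduct.map ((TensorProduct.lid ℂ H).toLinearMap ∘ₗ f.rTensor H) g := by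
      ext x y z
      simp [Θ, smul_smul, mul_comm]
    have := LinearMap.congr_fun this (comul.rTensor H (comul a))
    refine this.trans ?_
    rw [hit_repr g]
    conv_lhs => rw [← (ℛ ℂ a).eq]
    simp [lhit]
  rw [← e1, ← e2, Coalgebra.coassoc_apply]

theorem lhit_mul_aux {ι : Type} [Fintype ι] (f : H →ₗ[ℂ] ℂ) (g h : ι → H →ₗ[ℂ] ℂ)
    (hf : ∀ x y, f (x * y) = ∑ m, g m x * h m y) (a b : H) :
    lhit f (a * b) = ∑ m, lhit (g m) a * lhit (h m) b := by
  simp only [lhit, LinearMap.comp_apply, Bialgebra.comul_mul]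
  conv_lhs => rw [← (ℛ ℂ a).eq, ← (ℛ ℂ b).eq]
  conv_rhs => rw [← (ℛ ℂ a).eq, ← (ℛ ℂ b).eq]
  simp only [Finset.sum_mul_sum, Algebra.TensorProduct.tmul_mul_tmul, map_sum,
    LinearMap.rTensor_tmul, LinearEquiv.coe_coe, TensorProduct.lid_tmul, hf, Finset.sum_smul]
  rw [Finset.sum_congr rfl fun i _ => Finset.sum_comm, Finset.sum_comm]
  refine Finset.sum_congr rfl fun m _ => Finset.sum_congr rfl fun i _ =>
    Finset.sum_congr rfl fun j _ => ?_
  rw [smul_mul_smul_comm]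

theorem lhit_one (f : H →ₗ[ℂ] ℂ) : lhit f 1 = f 1 • 1 := by
  simp [lhit, Algebra.TensorProduct.one_def]

/-- The two sides of the exchange relation of a universal `r`-form. -/
def exL (r : H →ₗ[ℂ] H →ₗ[ℂ] ℂ) (a : H) (t : H ⊗[ℂ] H) : H :=
  TensorProduct.lid ℂ H (TensorProduct.map₂ r (LinearMap.mul ℂ H) (comul a) t)

/-- The right-hand side. -/
def exR (r : H →ₗ[ℂ] H →ₗ[ℂ] ℂ) (a : H) (t : H ⊗[ℂ] H) : H :=
  TensorProduct.rid ℂ H (TensorProduct.map₂ (LinearMap.mul ℂ H).flip r (comul a) t)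

theorem exL_tmul (r : H →ₗ[ℂ] H →ₗ[ℂ] ℂ) (a x y : H) :
    exL r a (x ⊗ₜ y) = lhit (r.flip x) a * y := by
  rw [exL, lhit_repr]
  conv_lhs => rw [← (ℛ ℂ a).eq]
  simp [Finset.sum_mul]

theorem exR_tmul (r : H →ₗ[ℂ] H →ₗ[ℂ] ℂ) (a x y : H) :
    exR r a (x ⊗ₜ y) = x * hit (r.flip y) a := by
  rw [exR, hit_repr]
  conv_lhs => rw [← (ℛ ℂ a).eq]
  simp [Finset.mul_sum]

theorem exL_sum {ι : Type*} (r : H →ₗ[ℂ] H →ₗ[ℂ] ℂ) (a : H) (S : Finset ι) (t : ι → H ⊗[ℂ] H) :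
    exL r a (∑ i ∈ S, t i) = ∑ i ∈ S, exL r a (t i) := by
  simp only [exL, map_sum]

theorem exR_sum {ι : Type*} (r : H →ₗ[ℂ] H →ₗ[ℂ] ℂ) (a : H) (S : Finset ι) (t : ι → H ⊗[ℂ] H) :
    exR r a (∑ i ∈ S, t i) = ∑ i ∈ S, exR r a (t i) := by
  simp only [exR, map_sum]

/-- If the exchange relation holds for `b` and for `c`, it holds for `b c`. -/
theorem exchange_mul {r : H →ₗ[ℂ] H →ₗ[ℂ] ℂ}
    (hr : ∀ b c, r.flip (b * c) = conv (r.flip c) (r.flip b)) {b c : H}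
    (hb : ∀ a, exL r a (comul b) = exR r a (comul b))
    (hc : ∀ a, exL r a (comul c) = exR r a (comul c)) (a : H) :
    exL r a (comul (b * c)) = exR r a (comul (b * c)) := by
  have hb' : ∀ a, ∑ i ∈ (ℛ ℂ b).index, lhit (r.flip ((ℛ ℂ b).left i)) a * (ℛ ℂ b).right i =
      ∑ i ∈ (ℛ ℂ b).index, (ℛ ℂ b).left i * hit (r.flip ((ℛ ℂ b).right i)) a := by
    intro a
    have := hb a
    rw [← (ℛ ℂ b).eq, exL_sum, exR_sum] at this
    simpa only [exL_tmul, exR_tmul] using this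
  have hc' : ∀ a, ∑ i ∈ (ℛ ℂ c).index, lhit (r.flip ((ℛ ℂ c).left i)) a * (ℛ ℂ c).right i =
      ∑ i ∈ (ℛ ℂ c).index, (ℛ ℂ c).left i * hit (r.flip ((ℛ ℂ c).right i)) a := by
    intro a
    have := hc a
    rw [← (ℛ ℂ c).eq, exL_sum, exR_sum] at this
    simpa only [exL_tmul, exR_tmul] using this
  rw [Bialgebra.comul_mul, ← (ℛ ℂ b).eq, ← (ℛ ℂ c).eq]
  simp only [Finset.sum_mul_sum, Algebra.TensorProduct.tmul_mul_tmul, exL_sum, exR_sum, exL_tmul,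
    exR_tmul, hr, lhit_conv, hit_conv]
  rw [Finset.sum_comm]
  have e1 : ∀ j ∈ (ℛ ℂ c).index, ∑ i ∈ (ℛ ℂ b).index,
      lhit (r.flip ((ℛ ℂ b).left i)) (lhit (r.flip ((ℛ ℂ c).left j)) a) *
        ((ℛ ℂ b).right i * (ℛ ℂ c).right j) =
      ∑ i ∈ (ℛ ℂ b).index, (ℛ ℂ b).left i *
        (lhit (r.flip ((ℛ ℂ c).left j)) (hit (r.flip ((ℛ ℂ b).right i)) a) * (ℛ ℂ c).right j) := by
    intro j _
    simp only [← mul_assoc, ← Finset.sum_mul, hb', lhit_hit]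
  rw [Finset.sum_congr rfl e1, Finset.sum_comm]
  refine Finset.sum_congr rfl fun i _ => ?_
  rw [← Finset.mul_sum, hc', Finset.mul_sum]
  exact Finset.sum_congr rfl fun j _ => (mul_assoc _ _ _).symm

end Hits

variable {N : ℕ} {q : ℂˣ} {s : ℂ} (hs : s ^ N = q)

theorem exchange_gen (j l : Fin N) (a : OSL N q) :
    exL (OSL.rForm hs) a (comul (OSL.gen N q j l)) = exR (OSL.rForm hs) a (comul (OSL.gen N q j l)) := by
  simp only [OSL.comul_gen, exL_sum, exR_sum, exL_tmul, exR_tmul, rForm_flip_gen]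
  induction a using OSL.induction generalizing j l with
  | h0 c =>
    simp [Algebra.algebraMap_eq_smul_one, lhit_one, hit_one, (isMult_rhoFun hs).one]
  | h1 i k =>
    have h := (OSL.isQuantumSL_gen (N := N) (q := q)).frt i j k l
    simp only [lhit, hit, LinearMap.comp_apply, OSL.comul_gen, map_sum, LinearMap.rTensor_tmul,
      LinearMap.lTensor_tmul, LinearEquiv.coe_coe, TensorProduct.lid_tmul, TensorProduct.rid_tmul,
      rhoFun_gen, Finset.sum_mul, Finset.mul_sum, smul_mul_assoc, mul_smul_comm, mul_smul,
      ← Finset.smul_sum]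
    rw [Finset.sum_comm, h, Finset.sum_comm]
  | h2 a b ha hb => simp only [map_add, add_mul, mul_add, Finset.sum_add_distrib, ha, hb]
  | h3 a b ha hb =>
    have h := isMult_rhoFun hs
    have e1 : ∀ j m, lhit (rhoFun hs j m) (a * b) =
        ∑ n, lhit (rhoFun hs j n) a * lhit (rhoFun hs n m) b := fun j m =>
      lhit_mul_aux _ _ _ (h.mul j m) a b
    have e2 : ∀ j m, hit (rhoFun hs j m) (a * b) =
        ∑ n, hit (rhoFun hs j n) a * hit (rhoFun hs n m) b := fun j m =>
      hit_mul_aux _ _ _ (h.mul j m) a b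
    simp only [e1, e2, Finset.sum_mul, Finset.mul_sum]
    rw [Finset.sum_comm]
    simp only [mul_assoc, ← Finset.mul_sum, hb]
    simp only [Finset.mul_sum, ← mul_assoc]
    rw [Finset.sum_comm]
    simp only [← Finset.sum_mul, ha]
    rw [Finset.sum_comm]
    simp only [Finset.sum_mul]

theorem rForm_mul_left (a b c : OSL N q) :
    OSL.rForm hs (a * b) c = conv (OSL.rForm hs a) (OSL.rForm hs b) c := by
  have flip_app : ∀ x y, OSL.rForm hs x y = (OSL.rForm hs).flip y x := fun _ _ => rfl
  induction c using OSL.induction generalizing a b with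
  | h0 c =>
    have h1 : ∀ x, OSL.rForm hs x 1 = counit (R := ℂ) x := fun x => by
      rw [flip_app, rForm_flip_one]
    simp [Algebra.algebraMap_eq_smul_one, conv, Algebra.TensorProduct.one_def, h1]
  | h1 i j =>
    rw [flip_app, rForm_flip_gen, (isMult_rhoFun hs).mul]
    simp only [conv, LinearMap.comp_apply, OSL.comul_gen, map_sum, TensorProduct.map_tmul,
      LinearMap.mul'_apply, flip_app, rForm_flip_gen]
  | h2 c d hc hd => rw [map_add, map_add, hc, hd]
  | h3 c d hc hd =>
    rw [flip_app, rForm_flip_mul]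
    rw [conv_mul_aux (ι := (ℛ ℂ d).index) (κ := (ℛ ℂ c).index) _ _
      (fun m => (OSL.rForm hs).flip ((ℛ ℂ d).left m)) (fun m => (OSL.rForm hs).flip ((ℛ ℂ d).right m))
      (fun m => (OSL.rForm hs).flip ((ℛ ℂ c).left m)) (fun m => (OSL.rForm hs).flip ((ℛ ℂ c).right m))]
    · simp only [← rForm_flip_mul, conv_repr_mul, LinearMap.flip_apply]
      rw [Finset.sum_comm]
      rw [← Finset.sum_coe_sort (ℛ ℂ c).index]
      refine Finset.sum_congr rfl fun i _ => ?_
      rw [← Finset.sum_coe_sort (ℛ ℂ d).index]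
    · intro x y
      rw [← flip_app, hd, conv_repr, ← Finset.sum_coe_sort]
      rfl
    · intro x y
      rw [← flip_app, hc, conv_repr, ← Finset.sum_coe_sort]
      rfl

/-- `O(SL_q(N))` is coquasitriangular. -/
theorem OSL.isUniversalRForm : IsUniversalRForm (OSL.rForm (q := q) hs) where
  comm a b := by
    change exL _ a (comul b) = exR _ a (comul b)
    induction b using OSL.induction generalizing a with
    | h0 c =>
      have h1 : ∀ x, exL (OSL.rForm hs) x (comul 1) = exR (OSL.rForm hs) x (comul 1) := fun x => by
        rw [Bialgebra.comul_one, Algebra.TensorProduct.one_def, exL_tmul, exR_tmul, rForm_flip_one,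
          mul_one, one_mul]
        simp [hit, lhit]
      rw [Algebra.algebraMap_eq_smul_one, map_smul]
      have := h1 a
      simp only [exL, exR, map_smul] at this ⊢
      rw [this]
    | h1 i j => exact exchange_gen hs i j a
    | h2 b c hb hc =>
      have hb := hb a
      have hc := hc a
      simp only [exL, exR, map_add] at hb hc ⊢
      rw [hb, hc]
    | h3 b c hb hc => exact exchange_mul (rForm_flip_mul hs) hb hc a
  mul_left := rForm_mul_left hs
  one_left c := by
    induction c using OSL.induction with
    | h0 c =>
      have h1 : OSL.rForm hs 1 1 = 1 := by
        have := LinearMap.congr_fun (rForm_flip_one hs) 1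
        simpa using this
      simp [Algebra.algebraMap_eq_smul_one, h1]
    | h1 i j =>
      rw [← LinearMap.flip_apply, rForm_flip_gen, (isMult_rhoFun hs).one, OSL.counit_gen]
    | h2 a b ha hb => rw [map_add, map_add, ha, hb]
    | h3 a b ha hb =>
      rw [← LinearMap.flip_apply, rForm_flip_mul]
      simp [conv, Algebra.TensorProduct.one_def, ha, hb, mul_comm]
  mul_right a b c := by
    rw [← LinearMap.flip_apply, rForm_flip_mul]
  one_right a := by
    rw [← LinearMap.flip_apply, rForm_flip_one]

end RForm3

section Calculi

/-- First order differential calculi `(Γ, d)` on an algebra `A`: `Γ` is an `A`-bimodule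
(the right action is written as an action of `Aᵐᵒᵖ`), `d` is a derivation, and
`Γ` is the linear span of the elements `a d b`. -/
structure FODC (A : Type u) [Ring A] [Algebra ℂ A] where
  /-- the bimodule of one-forms -/
  Form : Type w
  [addCommGroup : AddCommGroup Form]
  [module : Module ℂ Form]
  [leftModule : Module A Form]
  [rightModule : Module Aᵐᵒᵖ Form]
  [bimodule : SMulCommClass A Aᵐᵒᵖ Form]
  [leftTower : IsScalarTower ℂ A Form]
  [rightTower : IsScalarTower ℂ Aᵐᵒᵖ Form]
  /-- the differential -/
  d : A →ₗ[ℂ] Form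
  leibniz : ∀ a b : A, d (a * b) = op b • d a + a • d b
  span_eq_top : Submodule.span ℂ {γ : Form | ∃ a b : A, γ = a • d b} = ⊤

attribute [instance] FODC.addCommGroup FODC.module FODC.leftModule FODC.rightModule
  FODC.bimodule FODC.leftTower FODC.rightTower

variable {H : Type u} [Ring H] [HopfAlgebra ℂ H]

/-- Left covariance of a calculus on a subalgebra `X` of `H` with `Δ(X) ⊆ H ⊗ X`: the linear map
`a d b ↦ a₍₁₎ b₍₁₎ ⊗ a₍₂₎ d b₍₂₎` is well defined. Here `A`, `B` are `Δ(a)`, `Δ(b)`, viewed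
as elements of `H ⊗ X`. -/
def FODC.IsCovariant {X : Subalgebra ℂ H} (Γ : FODC.{u, w} X) : Prop :=
  ∃ Δ : Γ.Form →ₗ[ℂ] H ⊗[ℂ] Γ.Form, ∀ (a b : X) (A B : H ⊗[ℂ] X),
    X.val.toLinearMap.lTensor H A = comul (a : H) →
    X.val.toLinearMap.lTensor H B = comul (b : H) →
    Δ (a • Γ.d b) = TensorProduct.map₂ (LinearMap.mul ℂ H)
      (Algebra.lsmul ℂ ℂ Γ.Form : X →ₐ[ℂ] Module.End ℂ Γ.Form).toLinearMap
      A (Γ.d.lTensor H B)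

/-- Bicovariance of a calculus on `H`: the linear map
`a d b ↦ a₍₁₎ b₍₁₎ ⊗ a₍₂₎ d b₍₂₎ ⊗ a₍₃₎ b₍₃₎` is well defined. -/
def FODC.IsBicovariant (Ω : FODC.{u, w} H) : Prop :=
  ∃ Δ : Ω.Form →ₗ[ℂ] H ⊗[ℂ] (Ω.Form ⊗[ℂ] H), ∀ a b : H,
    Δ (a • Ω.d b) = TensorProduct.map₂ (LinearMap.mul ℂ H)
      (TensorProduct.map₂
        (Algebra.lsmul ℂ ℂ Ω.Form : H →ₐ[ℂ] Module.End ℂ Ω.Form).toLinearMap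
        (LinearMap.mul ℂ H))
      (comul.lTensor H (comul a)) ((Ω.d.rTensor H).lTensor H (comul.lTensor H (comul b)))

/-- The calculus `Γ` on `X` is, up to isomorphism, the subcalculus
`span {a d b | a, b ∈ X}` of the calculus `Ω` on `H`. -/
def FODC.IsSubcalculus {X : Subalgebra ℂ H} (Γ : FODC.{u, w} X) (Ω : FODC.{u, w} H) : Prop :=
  ∃ ι : Γ.Form →ₗ[ℂ] Ω.Form, Function.Injective ι ∧
    (∀ (a : X) (γ : Γ.Form), ι (a • γ) = (a : H) • ι γ) ∧
    (∀ (a : X) (γ : Γ.Form), ι (op a • γ) = op (a : H) • ι γ) ∧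
    (∀ a : X, ι (Γ.d a) = Ω.d (a : H)) ∧
    LinearMap.range ι = Submodule.span ℂ {ω : Ω.Form | ∃ a b : X, ω = (a : H) • Ω.d (b : H)}

end Calculi

section Construction

variable {H : Type u} [Ring H] [HopfAlgebra ℂ H] {N M : ℕ}

/-- `w^{ij} = u^i_k J^{kl} v^j_l`. -/
def wElem (U V : Matrix (Fin N) (Fin N) H) (J : Matrix (Fin N) (Fin N) ℂ) (i j : Fin N) : H :=
  ∑ k, ∑ l, J k l • (U i k * V j l)

/-- The linear span of the `w^{ij}`. -/
def wSpan (U V : Matrix (Fin N) (Fin N) H) (J : Matrix (Fin N) (Fin N) ℂ) : Submodule ℂ H :=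
  Submodule.span ℂ (Set.range fun p : Fin N × Fin N => wElem U V J p.1 p.2)

/-- The property of the Haar functional that is needed to split off the unit:
`h(1) = 1`, and `a₍₁₎ h(a₍₂₎) = h(a) 1` for `a ∈ W`. -/
def IsHaarOn (W : Submodule ℂ H) (h : H →ₗ[ℂ] ℂ) : Prop :=
  h 1 = 1 ∧ ∀ a ∈ W, hit h a = h a • (1 : H)

/-- `(id - 1 h)(W)`. -/
def splitOff (h : H →ₗ[ℂ] ℂ) (W : Submodule ℂ H) : Submodule ℂ H :=
  W.map (LinearMap.id - Algebra.linearMap ℂ H ∘ₗ h)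

/-- `e` is a basis of the subspace `P`. -/
def IsBasisOf (e : Fin M → H) (P : Submodule ℂ H) : Prop :=
  LinearIndependent ℂ e ∧ Submodule.span ℂ (Set.range e) = P

/-- `χ^i(a) = r(e^i ⊗ a) - ε(e^i) ε(a)`. -/
def chi (r : H →ₗ[ℂ] H →ₗ[ℂ] ℂ) (e : Fin M → H) (i : Fin M) : H →ₗ[ℂ] ℂ :=
  r (e i) - counit (R := ℂ) (e i) • counit

/-- `χ^{ij} = χ^i(e^j)`. -/
def chiMatrix (r : H →ₗ[ℂ] H →ₗ[ℂ] ℂ) (e : Fin M → H) : Matrix (Fin M) (Fin M) ℂ :=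
  Matrix.of fun i j => chi r e i (e j)

/-- `∂_i(a) = a₍₁₎ χ^k(a₍₂₎) (χ⁻¹)_{jk} S(π^j_i)`. -/
def partialX (r : H →ₗ[ℂ] H →ₗ[ℂ] ℂ) (e : Fin M → H) (π : Matrix (Fin M) (Fin M) H)
    (i : Fin M) (a : H) : H :=
  ∑ j, ∑ k, (chiMatrix r e)⁻¹ j k • (hit (chi r e k) a * antipode ℂ (π j i))

/-- `φ^{mn}(a) = r(u^m_l ⊗ a₍₁₎) r(a₍₂₎ ⊗ u^l_n) - δ_{mn} ε(a)`. -/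
def phi (r : H →ₗ[ℂ] H →ₗ[ℂ] ℂ) (U : Matrix (Fin N) (Fin N) H) (m n : Fin N) : H →ₗ[ℂ] ℂ :=
  ∑ l, conv (r (U m l)) (r.flip (U l n)) - (if m = n then (1 : ℂ) else 0) • counit

/-- `φ^{mn,ij} = φ^{mn}(u^i_j)`. -/
def phiMatrix (r : H →ₗ[ℂ] H →ₗ[ℂ] ℂ) (U : Matrix (Fin N) (Fin N) H) :
    Matrix (Fin N × Fin N) (Fin N × Fin N) ℂ :=
  Matrix.of fun p s => phi r U p.1 p.2 (U s.1 s.2)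

/-- `η_{kj} = φ^{mn} (φ⁻¹)_{kj,mn}`. -/
def eta (r : H →ₗ[ℂ] H →ₗ[ℂ] ℂ) (U : Matrix (Fin N) (Fin N) H) (k j : Fin N) : H →ₗ[ℂ] ℂ :=
  ∑ p : Fin N × Fin N, (phiMatrix r U)⁻¹ (k, j) p • phi r U p.1 p.2

/-- `∂_{ij}(a) = a₍₁₎ η_{kj}(a₍₂₎) S(u^k_i)`. -/
def partialH (r : H →ₗ[ℂ] H →ₗ[ℂ] ℂ) (U : Matrix (Fin N) (Fin N) H) (i j : Fin N) (a : H) : H :=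
  ∑ k, hit (eta r U k j) a * antipode ℂ (U k i)

/-- The matrix `c^{mn,ij} = φ^{mn}(u^i_k J^{kl} v^j_l)`. -/
def cMatrix (r : H →ₗ[ℂ] H →ₗ[ℂ] ℂ) (U V : Matrix (Fin N) (Fin N) H)
    (J : Matrix (Fin N) (Fin N) ℂ) : Matrix (Fin N × Fin N) (Fin N × Fin N) ℂ :=
  Matrix.of fun p s => phi r U p.1 p.2 (wElem U V J s.1 s.2)

/-- `Γ` is the covariant calculus on `X` in which `d a = a_i d e^i` with unique coefficients
`a_i ∈ X`, these being `a_i = ∂_i(a)`. -/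
def IsConstructedCalculus {X : Subalgebra ℂ H} (r : H →ₗ[ℂ] H →ₗ[ℂ] ℂ) (e : Fin M → X)
    (π : Matrix (Fin M) (Fin M) H) (Γ : FODC.{u, w} X) : Prop :=
  Γ.IsCovariant ∧
  (∀ a : X, ∃! c : Fin M → X, Γ.d a = ∑ i, c i • Γ.d (e i)) ∧
  ∀ a : X, ∃ D : Fin M → X, (∀ i, (D i : H) = partialX r (fun k => (e k : H)) π i a) ∧
    Γ.d a = ∑ i, D i • Γ.d (e i)

/-- `Ω` is the standard bicovariant calculus on `H`: `d a = a_{ij} d u^i_j` with unique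
coefficients `a_{ij} ∈ H`, these being `a_{ij} = ∂_{ij}(a)`. -/
def IsStandardCalculus (r : H →ₗ[ℂ] H →ₗ[ℂ] ℂ) (U : Matrix (Fin N) (Fin N) H)
    (Ω : FODC.{u, w} H) : Prop :=
  Ω.IsBicovariant ∧
  (∀ a : H, ∃! c : Fin N × Fin N → H, Ω.d a = ∑ p, c p • Ω.d (U p.1 p.2)) ∧
  ∀ a : H, Ω.d a = ∑ p : Fin N × Fin N, partialH r U p.1 p.2 a • Ω.d (U p.1 p.2)

end Construction

/-- `J = ∑_k a_k (E_{2k-1,2k} - q E_{2k,2k-1})`, the solution for `SU(2n)/Sp(2n)`. -/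
def spJ (n : ℕ) (q : ℂˣ) (a : Fin n → ℂ) : Matrix (Fin (2 * n)) (Fin (2 * n)) ℂ :=
  Matrix.of fun i j =>
    if i.1 / 2 = j.1 / 2 then
      if i < j then a ⟨i.1 / 2, by omega⟩
      else if j < i then -q * a ⟨i.1 / 2, by omega⟩ else 0
    else 0

end QSpace

end

noncomputable section

namespace QSpace

open Coalgebra HopfAlgebra MulOpposite

/-! ### Functionals acting on a Hopf algebra by convolution -/

section Convolution
variable {H : Type u} [Ring H] [HopfAlgebra ℂ H]

/-! First claim. A functional f acts on H by a ↦ a₍₁₎ f(a₍₂₎) (`hit`), and convolution becomes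
composition. The matrix of functionals r(· ⊗ u^i_m) has the convolution inverse r(S(·) ⊗ u^m_k), so
the equations that define the quantum space can be solved for one factor: on that space J^{il}
r(v^j_l ⊗ ·) and r(· ⊗ u^i_m) J^{mj} act in the same way (`sum_hit_eq_of_mem`). Inserted into
r(w^{mn} ⊗ ·) = J^{kl} r(u^m_k ⊗ ·) ∗ r(v^n_l ⊗ ·), this gives (φ^{mp} + δ_{mp} ε) J^{pn}
(`hit_wElem`). Hence on the quantum space the functionals defining χ and φ differ only by the
invertible matrix J.

The reflection equation puts the w^{ij} into the quantum space (`KFun_wElem`). The form r(a ⊗ b) -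
ε(a) ε(b) vanishes when an argument is 1, so its Gram matrix on the generators w - h(w) 1 of P is (1
⊗ Jᵀ) c; this has the rank of χ, whence the rank criterion. For the chain rule, each φ^{mp} is on
the quantum space a combination of the χ^k, with coefficients found by evaluating at the e^j
(`hit_phi_expand`); the matrices S(π) and π then cancel. The forms d e^k of the standard calculus
are independent over H (`eq_zero_of_sum_mul_partialH`), so both calculi have d e^1, …, d e^M as
independent generators and, by the chain rule, the same coefficients. Matching coefficients is the
embedding.

Second and third claims. Invertibility of χ is nondegeneracy of a bilinear form on P, so any basis
may be used. The commutation relations show that the w^{ij} with i ≤ j (symmetric case),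
respectively i < j (symplectic case), suffice. They are eigenvectors of torus characters with
distinct weights, and a two-dimensional representation of the algebra lowers their indices until a w
with nonzero counit is reached; hence none is a scalar, and w - h(w) 1 give a basis
(`linearIndependent_splitElem`).

Since J is monomial and R satisfies the Hecke relation, φ^{mn}(w^{ij}) is explicit (`phi_wElem`).
The Gram matrix is block triangular: one block is monomial, and the other, belonging to the nonzero
entries of J, is diag(a) (α 1 1ᵀ + β L) diag(a) with L unipotent lower triangular and 1 - t below
the diagonal. The vector y = (t^k) solves L y = 1, so the inner determinant is β^{n-1} (β + α Σ t^k)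
(`isUnit_det_const_add_lower`). The two criteria are the cases α = s⁻⁴ - 1 with β = s⁻⁴ (q⁴ - 1), t
= q⁻², and with β = s⁻⁴ (q² - 1), t = q⁻⁴. -/

theorem hit_of_comul {ι : Type*} {S : Finset ι} {x y : ι → H} {a : H}
    (h : comul (R := ℂ) a = ∑ i ∈ S, x i ⊗ₜ[ℂ] y i) (f : H →ₗ[ℂ] ℂ) :
    hit f a = ∑ i ∈ S, f (y i) • x i := by
  simp [hit, h]

theorem lhit_of_comul {ι : Type*} {S : Finset ι} {x y : ι → H} {a : H}
    (h : comul (R := ℂ) a = ∑ i ∈ S, x i ⊗ₜ[ℂ] y i) (f : H →ₗ[ℂ] ℂ) :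
    lhit f a = ∑ i ∈ S, f (x i) • y i := by
  simp [lhit, h]

theorem conv_of_comul {ι : Type*} {S : Finset ι} {x y : ι → H} {a : H}
    (h : comul (R := ℂ) a = ∑ i ∈ S, x i ⊗ₜ[ℂ] y i) (f g : H →ₗ[ℂ] ℂ) :
    conv f g a = ∑ i ∈ S, f (x i) * g (y i) := by
  simp [conv, h]

/-- Operator identities become identities between functionals by applying the counit; the scalar
statements below are obtained in this way. -/
theorem counit_hit (f : H →ₗ[ℂ] ℂ) (a : H) : counit (R := ℂ) (hit f a) = f a := by
  have h := congrArg f (Coalgebra.sum_counit_smul (ℛ ℂ a))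
  rw [hit_repr, ← h]
  simp [mul_comm]

theorem hit_counit (a : H) : hit counit a = a := by
  simp [hit]

/-- The counit of the composition law `hit_conv`. -/
theorem apply_hit (f g : H →ₗ[ℂ] ℂ) (a : H) : f (hit g a) = conv f g a := by
  rw [← counit_hit f, ← hit_conv, counit_hit]

theorem hit_sum {ι : Type*} (S : Finset ι) (f : ι → H →ₗ[ℂ] ℂ) (a : H) :
    hit (∑ i ∈ S, f i) a = ∑ i ∈ S, hit (f i) a := by
  simp only [hit_repr, LinearMap.sum_apply, Finset.sum_smul]
  exact Finset.sum_comm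

theorem hit_smul (c : ℂ) (f : H →ₗ[ℂ] ℂ) (a : H) : hit (c • f) a = c • hit f a := by
  simp [hit_repr, Finset.smul_sum, smul_smul]

theorem hit_sub (f g : H →ₗ[ℂ] ℂ) (a : H) : hit (f - g) a = hit f a - hit g a := by
  simp [hit_repr, sub_smul]

end Convolution

/-- Index bookkeeping: contraction with A undoes contraction with B, two indices at a time.
`KFun_wElem` uses it twice to cancel an antipode. -/
theorem sum_mul_sum_of_delta {κ κ' : Type*} [Fintype κ] [Fintype κ'] [DecidableEq κ]
    [DecidableEq κ'] {a : κ} {m : κ'} (A : κ → κ' → ℂ) (B : κ → κ' → κ → κ' → ℂ) (G : κ → κ' → ℂ)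
    (h : ∀ x y, ∑ c, ∑ p, A c p * B c p x y =
      (if a = x then 1 else 0) * if m = y then 1 else 0) :
    ∑ c, ∑ p, A c p * ∑ x, ∑ y, B c p x y * G x y = G a m := by
  have e : ∑ c, ∑ p, A c p * ∑ x, ∑ y, B c p x y * G x y =
      ∑ x, ∑ y, (∑ c, ∑ p, A c p * B c p x y) * G x y := by
    simp only [Finset.mul_sum, Finset.sum_mul, ← Fintype.sum_prod_type']
    exact Fintype.sum_equiv
      { toFun := fun ⟨c, p, x, y⟩ => (x, y, c, p)
        invFun := fun ⟨x, y, c, p⟩ => (c, p, x, y)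
        left_inv := fun _ => rfl
        right_inv := fun _ => rfl } _ _ fun ⟨c, p, x, y⟩ => by
          simp only [Equiv.coe_fn_mk]; ring
  rw [e]
  simp [h]

/-! ### The reflection equation and functionals on the quantum space -/

section Reflection
variable {H : Type u} [Ring H] [HopfAlgebra ℂ H] {r : H →ₗ[ℂ] H →ₗ[ℂ] ℂ} {N : ℕ}
  {U V : Matrix (Fin N) (Fin N) H} {J : Matrix (Fin N) (Fin N) ℂ}

theorem IsCorep.sum_antipode_mul (hU : IsCorep U) (i j : Fin N) :
    ∑ k, antipode ℂ (U i k) * U k j = if i = j then 1 else 0 := by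
  have h := HopfAlgebra.mul_antipode_rTensor_comul_apply (R := ℂ) (U i j)
  rw [hU.comul_apply, hU.counit_apply] at h
  simpa [apply_ite] using h

theorem IsCorep.sum_mul_antipode (hU : IsCorep U) (i j : Fin N) :
    ∑ k, U i k * antipode ℂ (U k j) = if i = j then 1 else 0 := by
  have h := HopfAlgebra.mul_antipode_lTensor_comul_apply (R := ℂ) (U i j)
  rw [hU.comul_apply, hU.counit_apply] at h
  simpa [apply_ite] using h

/-- `r(S(v^a_c) ⊗ u^m_p) r(v^c_b ⊗ u^p_n) = δ_{ab} δ_{mn}`. -/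
theorem IsUniversalRForm.sum_antipode_mul (hr : IsUniversalRForm r) (hU : IsCorep U)
    (hV : IsCorep V) (a b m n : Fin N) :
    ∑ c, ∑ p, r (antipode ℂ (V a c)) (U m p) * r (V c b) (U p n) =
      (if a = b then 1 else 0) * if m = n then 1 else 0 := by
  -- Pairing S(v) v = 1 with u^m_n and splitting the product by multiplicativity of r in its first
  -- argument.
  have h : r (∑ c, antipode ℂ (V a c) * V c b) (U m n) = _ :=
    congrArg (fun x => r x (U m n)) (hV.sum_antipode_mul a b)
  simp only [map_sum, LinearMap.sum_apply, hr.mul_left, conv_corep_right hU] at h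
  rw [h]
  split_ifs with h1 <;> simp [hr.one_left, hU.counit_apply, *]

/-- `r(a₍₁₎ ⊗ u^i_m) r(S(a₍₂₎) ⊗ u^m_k) = δ_{ik} ε(a)`. -/
theorem IsUniversalRForm.sum_conv_antipode (hr : IsUniversalRForm r) (hU : IsCorep U)
    (i k : Fin N) :
    ∑ m, conv (r.flip (U i m)) (r.flip (U m k) ∘ₗ antipode ℂ) =
      (if i = k then (1 : ℂ) else 0) • counit := by
  ext a
  have h := HopfAlgebra.sum_mul_antipode_eq_algebraMap_counit (R := ℂ) (ℛ ℂ a)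
  have h' := congrArg (fun x => r x (U i k)) h
  simp only [map_sum, LinearMap.sum_apply, hr.mul_left, conv_corep_right hU] at h'
  simp only [LinearMap.sum_apply, conv_repr, LinearMap.flip_apply, LinearMap.comp_apply]
  rw [Finset.sum_comm, h', Algebra.algebraMap_eq_smul_one]
  split_ifs with h1 <;> simp [hr.one_left, hU.counit_apply, h1]

theorem KFun_one (hr : IsUniversalRForm r) (hU : IsCorep U) (hV : IsCorep V) (i j : Fin N) :
    KFun r U V J i j 1 = J i j := by
  simp [KFun, conv, Algebra.TensorProduct.one_def, hr.one_left, hr.one_right, hU.counit_apply,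
    hV.counit_apply]

/-- The w^{ij} span a left coideal and transform like the tensor product of u and v: J stays
entirely in the right factor. -/
theorem comul_wElem (hU : IsCorep U) (hV : IsCorep V) (i j : Fin N) :
    comul (R := ℂ) (wElem U V J i j) = ∑ p : Fin N × Fin N, (U i p.1 * V j p.2) ⊗ₜ[ℂ] wElem U V J p.1 p.2 := by
  simp only [wElem, map_sum, map_smul, Bialgebra.comul_mul, hU.comul_apply, hV.comul_apply,
    Finset.sum_mul_sum, Algebra.TensorProduct.tmul_mul_tmul, Fintype.sum_prod_type,
    TensorProduct.tmul_sum, TensorProduct.tmul_smul, Finset.smul_sum]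
  calc _ = ∑ k, ∑ a, ∑ l, ∑ b, J k l • (U i a * V j b) ⊗ₜ[ℂ] (U a k * V b l) :=
        Finset.sum_congr rfl fun k _ => Finset.sum_comm
    _ = ∑ a, ∑ k, ∑ l, ∑ b, J k l • (U i a * V j b) ⊗ₜ[ℂ] (U a k * V b l) := Finset.sum_comm
    _ = _ := by
      refine Finset.sum_congr rfl fun a _ => ?_
      rw [Finset.sum_congr rfl fun k _ => Finset.sum_comm, Finset.sum_comm]

theorem counit_wElem (hU : IsCorep U) (hV : IsCorep V) (i j : Fin N) :
    counit (R := ℂ) (wElem U V J i j) = J i j := by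
  simp [wElem, hU.counit_apply, hV.counit_apply]

/-- The reflection equation enters here. Multiplicativity expands K^{ij}(u^a_k v^b_l) into factors
r(S(·) ⊗ ·) standing in front of one side of the reflection equation; on its other side the
r-factors are those which these antipodes cancel, and only two entries of J remain. -/
theorem KFun_wElem (hr : IsUniversalRForm r) (hU : IsCorep U) (hV : IsCorep V)
    (hJ : ReflectionEquation r U V J) (i j a b : Fin N) :
    KFun r U V J i j (wElem U V J a b) = J i j * J a b := by
  have e1 : KFun r U V J i j (wElem U V J a b) = ∑ m, ∑ e, r (antipode ℂ (V b e)) (U i m) *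
      ∑ c, ∑ p, r (antipode ℂ (U a c)) (U m p) *
        ∑ q, ∑ k, ∑ n, ∑ l, J p q * r (V n q) (U c k) * J k l * r (V j n) (V e l) := by
    simp only [wElem, map_sum, map_smul, KFun_mul hr hU hV, smul_eq_mul, conv_corep_right hV,
      LinearMap.comp_apply, LinearMap.flip_apply, Fintype.sum_prod_type]
    simp only [KFun, LinearMap.sum_apply, LinearMap.smul_apply, conv_corep_right hU,
      LinearMap.comp_apply, LinearMap.flip_apply, smul_eq_mul, Finset.mul_sum, Finset.sum_mul,
      ← Fintype.sum_prod_type']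
    exact Fintype.sum_equiv
      { toFun := fun ⟨k, l, m, n, e, ⟨p, q⟩, c⟩ => (m, e, c, p, q, k, n, l)
        invFun := fun ⟨m, e, c, p, q, k, n, l⟩ => (k, l, m, n, e, ⟨p, q⟩, c)
        left_inv := fun _ => rfl
        right_inv := fun _ => rfl } _ _ fun ⟨k, l, m, n, e, ⟨p, q⟩, c⟩ => by
          simp only [Equiv.coe_fn_mk]; ring
  -- The reflection equation with free indices (p, c, e, j), read from right to left.
  have e2 : ∀ p c e, ∑ q, ∑ k, ∑ n, ∑ l, J p q * r (V n q) (U c k) * J k l * r (V j n) (V e l) =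
      ∑ x, ∑ y, r (U c x) (U p y) * ∑ z, ∑ t, r (V e z) (U y t) * (J x z * J t j) := by
    intro p c e
    rw [← hJ p c e j]
    simp only [Finset.mul_sum]
    exact Finset.sum_congr rfl fun x _ => Finset.sum_congr rfl fun y _ =>
      Finset.sum_congr rfl fun z _ => Finset.sum_congr rfl fun t _ => by ring
  rw [e1]
  simp only [e2]
  have e3 : ∀ m e, ∑ c, ∑ p, r (antipode ℂ (U a c)) (U m p) *
      ∑ x, ∑ y, r (U c x) (U p y) * ∑ z, ∑ t, r (V e z) (U y t) * (J x z * J t j) =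
      ∑ z, ∑ t, r (V e z) (U m t) * (J a z * J t j) := fun m e =>
    sum_mul_sum_of_delta _ _ _ (hr.sum_antipode_mul hU hU a · m ·)
  simp only [e3]
  rw [Finset.sum_comm]
  exact (sum_mul_sum_of_delta _ _ (fun z t => J a z * J t j) (hr.sum_antipode_mul hU hV b · i ·)).trans
    (mul_comm _ _)

/-- As K^{mn} takes the value J^{mn} J^{ab} on w^{ab}, the sum left by the coproduct, u^i_a v^j_b
J^{ab}, is w^{ij} again. -/
theorem wElem_mem (hr : IsUniversalRForm r) (hU : IsCorep U) (hV : IsCorep V)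
    (hJ : ReflectionEquation r U V J) (i j : Fin N) :
    wElem U V J i j ∈ quantumSpace hr hU hV J := by
  intro m n
  rw [hit_of_comul (comul_wElem hU hV i j), KFun_one hr hU hV]
  simp only [KFun_wElem hr hU hV hJ, mul_smul, ← Finset.smul_sum, Fintype.sum_prod_type]
  rfl

theorem splitOff_le (hr : IsUniversalRForm r) (hU : IsCorep U) (hV : IsCorep V)
    (hJ : ReflectionEquation r U V J) (h : H →ₗ[ℂ] ℂ) :
    splitOff h (wSpan U V J) ≤ Subalgebra.toSubmodule (quantumSpace hr hU hV J) := by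
  rw [splitOff, Submodule.map_le_iff_le_comap, wSpan, Submodule.span_le]
  rintro _ ⟨p, rfl⟩
  exact Subalgebra.sub_mem _ (wElem_mem hr hU hV hJ p.1 p.2) (Subalgebra.algebraMap_mem _ _)

/-- On the quantum space, `J^{il} r(v^j_l ⊗ ·) = r(· ⊗ u^i_m) J^{mj}`. -/
theorem sum_hit_eq_of_mem (hr : IsUniversalRForm r) (hU : IsCorep U) (hV : IsCorep V) {a : H}
    (ha : a ∈ quantumSpace hr hU hV J) (i j : Fin N) :
    ∑ l, J i l • hit (r (V j l)) a = ∑ m, J m j • hit (r.flip (U i m)) a := by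
  have e1 : ∀ m, hit (r.flip (U i m)) (hit (KFun r U V J m j) a) =
      J m j • hit (r.flip (U i m)) a := by
    intro m
    rw [show hit (KFun r U V J m j) a = _ from ha m j, KFun_one hr hU hV, map_smul]
  -- Acting with r(· ⊗ u^i_m) removes the antipode factor of K^{mj}; only k = i survives.
  have e2 : ∀ k l, ∑ m, hit (r.flip (U i m))
      (hit (conv (r.flip (U m k) ∘ₗ antipode ℂ) (r (V j l))) a) =
      if i = k then hit (r (V j l)) a else 0 := by
    intro k l
    simp only [hit_conv _ (r (V j l)), ← hit_conv (r.flip _), ← hit_sum,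
      hr.sum_conv_antipode hU, hit_smul, hit_counit]
    split_ifs <;> simp
  simp only [← e1, KFun, hit_sum, hit_smul, map_sum, map_smul]
  rw [Finset.sum_comm, Finset.sum_congr rfl fun k _ => Finset.sum_comm]
  simp only [← Finset.smul_sum, e2]
  rw [Finset.sum_comm]
  simp

/-- On the quantum space, `r(w^{mn} ⊗ ·) - ε(w^{mn}) ε = φ^{mp} J^{pn}`. -/
theorem hit_wElem (hr : IsUniversalRForm r) (hU : IsCorep U) (hV : IsCorep V) {a : H}
    (ha : a ∈ quantumSpace hr hU hV J) (m n : Fin N) :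
    hit (r (wElem U V J m n) - J m n • counit) a = ∑ p, J p n • hit (phi r U m p) a := by
  have e1 : r (wElem U V J m n) = ∑ k, ∑ l, J k l • conv (r (U m k)) (r (V n l)) := by
    ext x
    simp [wElem, hr.mul_left]
  have e2 : ∀ k, ∑ l, J k l • hit (r (U m k)) (hit (r (V n l)) a) =
      ∑ p, J p n • hit (r (U m k)) (hit (r.flip (U k p)) a) := by
    intro k
    simpa only [map_sum, map_smul] using
      congrArg (hit (r (U m k))) (sum_hit_eq_of_mem hr hU hV ha k n)
  simp only [phi, hit_sub, hit_smul, hit_sum, e1, hit_conv, hit_counit, e2, smul_sub,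
    Finset.sum_sub_distrib, Finset.smul_sum]
  rw [Finset.sum_comm]
  simp

theorem form_wElem (hr : IsUniversalRForm r) (hU : IsCorep U) (hV : IsCorep V) {a : H}
    (ha : a ∈ quantumSpace hr hU hV J) (m n : Fin N) :
    r (wElem U V J m n) a - J m n * counit (R := ℂ) a = ∑ p, J p n * phi r U m p a := by
  simpa [counit_hit] using congrArg (counit (R := ℂ)) (hit_wElem hr hU hV ha m n)

end Reflection

/-! ### Comparing calculi through their coefficients -/

section Embedding

variable {H : Type u} [Ring H] [HopfAlgebra ℂ H] {X : Subalgebra ℂ H} {M : ℕ}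

/-- A calculus on `X` is a subcalculus of a calculus on `H` if both are free on the same forms
`d e^i`, with the same coefficients. -/
theorem FODC.isSubcalculus_of_coefficients (Γ : FODC.{u, w} X) (Ω : FODC.{u, w} H) (e : Fin M → X)
    (D : X → Fin M → X) (h1 : ∀ a, Γ.d a = ∑ i, D a i • Γ.d (e i))
    (h2 : ∀ c : Fin M → X, ∑ i, c i • Γ.d (e i) = 0 → c = 0)
    (h3 : ∀ a : X, Ω.d (a : H) = ∑ i, (D a i : H) • Ω.d (e i : H))
    (h4 : ∀ c : Fin M → X, ∑ i, (c i : H) • Ω.d (e i : H) = 0 → c = 0) :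
    Γ.IsSubcalculus Ω := by
  -- Both g and g' describe one-forms by their coefficients in X; the embedding is g' after the
  -- inverse of g.
  let g : (Fin M → X) →ₗ[ℂ] Γ.Form :=
    { toFun := fun c => ∑ i, c i • Γ.d (e i)
      map_add' := fun c c' => by simp [add_smul, Finset.sum_add_distrib]
      map_smul' := fun t c => by simp [Finset.smul_sum] }
  let g' : (Fin M → X) →ₗ[ℂ] Ω.Form :=
    { toFun := fun c => ∑ i, (c i : H) • Ω.d (e i : H)
      map_add' := fun c c' => by simp [add_smul, Finset.sum_add_distrib]
      map_smul' := fun t c => by simp [Finset.smul_sum] }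
  have hg : Function.Injective g := (injective_iff_map_eq_zero g).2 h2
  have hg' : Function.Injective g' := (injective_iff_map_eq_zero g').2 h4
  have hgl : ∀ (a : X) (c : Fin M → X), g (fun i => a * c i) = a • g c := fun a c => by
    simp [g, mul_smul, Finset.smul_sum]
  have hgl' : ∀ (a : X) (c : Fin M → X), g' (fun i => a * c i) = (a : H) • g' c := fun a c => by
    simp [g', mul_smul, Finset.smul_sum]
  -- Γ is spanned by the a d b, and a d b has the coefficients a D(b)_i.
  have hs : Function.Surjective g := by
    rw [← LinearMap.range_eq_top, eq_top_iff, ← Γ.span_eq_top, Submodule.span_le]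
    rintro _ ⟨a, b, rfl⟩
    exact ⟨fun i => a * D b i, by rw [hgl, h1 b]; rfl⟩
  let E := LinearEquiv.ofBijective g ⟨hg, hs⟩
  let ι : Γ.Form →ₗ[ℂ] Ω.Form := g' ∘ₗ E.symm.toLinearMap
  have hι : ∀ c, ι (g c) = g' c := fun c => congrArg g' (E.symm_apply_apply c)
  have hleft : ∀ (a : X) (γ : Γ.Form), ι (a • γ) = (a : H) • ι γ := by
    intro a γ
    obtain ⟨c, rfl⟩ := hs γ
    rw [← hgl, hι, hι, hgl']
  have hd : ∀ a : X, ι (Γ.d a) = Ω.d (a : H) := by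
    intro a
    rw [h1, h3]
    exact hι _
  refine ⟨ι, hg'.comp E.symm.injective, hleft, ?_, hd, ?_⟩
  · intro c γ
    have hγ : γ ∈ Submodule.span ℂ {γ : Γ.Form | ∃ a b : X, γ = a • Γ.d b} :=
      Γ.span_eq_top ▸ Submodule.mem_top
    induction hγ using Submodule.span_induction with
    | mem x hx =>
      obtain ⟨a, b, rfl⟩ := hx
      -- The Leibniz rule expresses the right action on d b by d and the left action, which ι
      -- already respects.
      have e1 : op c • Γ.d b = Γ.d (b * c) - b • Γ.d c := by rw [Γ.leibniz]; abel
      have e2 : op (c : H) • Ω.d (b : H) = Ω.d (b * c : H) - (b : H) • Ω.d (c : H) := by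
        rw [Ω.leibniz]; abel
      rw [← smul_comm a (op c), e1, hleft, map_sub, hd, hleft, hd, hleft, hd,
        ← smul_comm (a : H) (op (c : H)), e2]
      rfl
    | zero => simp
    | add x y _ _ hx hy => rw [smul_add, map_add, hx, hy, map_add, smul_add]
    | smul t x _ hx => rw [← smul_comm t (op c), map_smul, hx, map_smul, smul_comm]
  · rw [LinearMap.range_eq_map, ← Γ.span_eq_top, Submodule.map_span]
    congr 1
    ext ω
    constructor
    · rintro ⟨_, ⟨a, b, rfl⟩, rfl⟩
      exact ⟨a, b, by rw [hleft, hd]⟩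
    · rintro ⟨a, b, rfl⟩
      exact ⟨_, ⟨a, b, rfl⟩, by rw [hleft, hd]⟩

end Embedding

/-! ### The Gram matrix of P and the rank criterion -/

section Form

variable {H : Type u} [Ring H] [HopfAlgebra ℂ H] {r : H →ₗ[ℂ] H →ₗ[ℂ] ℂ} {N M : ℕ}
  {U V : Matrix (Fin N) (Fin N) H} {J : Matrix (Fin N) (Fin N) ℂ} {h : H →ₗ[ℂ] ℂ} {e : Fin M → H}

variable (r) in
/-- The bilinear form `r(a ⊗ b) - ε(a) ε(b)`. -/
def reducedForm : H →ₗ[ℂ] H →ₗ[ℂ] ℂ :=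
  r - (LinearMap.mul ℂ ℂ).compl₁₂ counit counit

theorem reducedForm_apply (a b : H) :
    reducedForm r a b = r a b - counit (R := ℂ) a * counit (R := ℂ) b := rfl

theorem chi_eq_reducedForm (e : Fin M → H) (i : Fin M) : chi r e i = reducedForm r (e i) := rfl

theorem reducedForm_one_left (hr : IsUniversalRForm r) (a : H) : reducedForm r 1 a = 0 := by
  simp [reducedForm_apply, hr.one_left]

theorem reducedForm_one_right (hr : IsUniversalRForm r) (a : H) : reducedForm r a 1 = 0 := by
  simp [reducedForm_apply, hr.one_right]

/-- The generators `w^{ij} - h(w^{ij}) 1` of `P`. -/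
def splitElem (U V : Matrix (Fin N) (Fin N) H) (J : Matrix (Fin N) (Fin N) ℂ) (h : H →ₗ[ℂ] ℂ)
    (p : Fin N × Fin N) : H :=
  wElem U V J p.1 p.2 - h (wElem U V J p.1 p.2) • 1

theorem span_splitElem :
    Submodule.span ℂ (Set.range (splitElem U V J h)) = splitOff h (wSpan U V J) := by
  rw [splitOff, wSpan, Submodule.map_span, ← Set.range_comp]
  congr 2
  ext p
  simp [splitElem, Algebra.algebraMap_eq_smul_one]

/-- Since 1 lies in both radicals of the form, the choice of h does not affect the Gram matrix. -/
theorem reducedForm_splitElem (hr : IsUniversalRForm r) (p s : Fin N × Fin N) :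
    reducedForm r (splitElem U V J h p) (splitElem U V J h s) =
      reducedForm r (wElem U V J p.1 p.2) (wElem U V J s.1 s.2) := by
  simp [splitElem, reducedForm_one_left hr, reducedForm_one_right hr]

theorem reducedForm_wElem (hr : IsUniversalRForm r) (hU : IsCorep U) (hV : IsCorep V)
    (hJ : ReflectionEquation r U V J) (m n i j : Fin N) :
    reducedForm r (wElem U V J m n) (wElem U V J i j) =
      ∑ p, J p n * phi r U m p (wElem U V J i j) := by
  rw [reducedForm_apply, counit_wElem hU hV, form_wElem hr hU hV (wElem_mem hr hU hV hJ i j)]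

/-- The generators of P may be linearly dependent, so E and F are just two rectangular coefficient
matrices; they are enough to compare ranks. -/
theorem IsBasisOf.exists_expansion (he : IsBasisOf e (splitOff h (wSpan U V J))) :
    ∃ (E : Matrix (Fin M) (Fin N × Fin N) ℂ) (F : Matrix (Fin N × Fin N) (Fin M) ℂ),
      (∀ k, e k = ∑ p, E k p • splitElem U V J h p) ∧
      (∀ p, splitElem U V J h p = ∑ k, F p k • e k) := by
  have h1 : ∀ k, ∃ E : Fin N × Fin N → ℂ, ∑ p, E p • splitElem U V J h p = e k := fun k => by
    rw [← Submodule.mem_span_range_iff_exists_fun, span_splitElem, ← he.2]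
    exact Submodule.subset_span ⟨k, rfl⟩
  have h2 : ∀ p, ∃ F : Fin M → ℂ, ∑ k, F k • e k = splitElem U V J h p := fun p => by
    rw [← Submodule.mem_span_range_iff_exists_fun, he.2, ← span_splitElem]
    exact Submodule.subset_span ⟨p, rfl⟩
  choose E hE using h1
  choose F hF using h2
  exact ⟨E, F, fun k => (hE k).symm, fun p => (hF p).symm⟩

theorem isUnit_det_iff_rank {K : Type*} [Field K] (A : Matrix (Fin M) (Fin M) K) :
    IsUnit A.det ↔ A.rank = M := by
  rw [← Matrix.isUnit_iff_isUnit_det]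
  constructor
  · intro hA
    rw [Matrix.rank_of_isUnit A hA, Fintype.card_fin]
  · intro hA
    rw [← Matrix.mulVec_surjective_iff_isUnit]
    have : LinearMap.range A.mulVecLin = ⊤ :=
      Submodule.eq_top_of_finrank_eq (by rw [← Matrix.rank, hA, Module.finrank_fin_fun])
    exact LinearMap.range_eq_top.1 this

/-- The Gram matrix Y of the generators satisfies χ = E Y Eᵀ and Y = F χ Fᵀ, so it has the rank of
χ; and Y = (1 ⊗ Jᵀ) c, where the first factor is invertible. -/
theorem isUnit_det_chiMatrix_iff_rank (hr : IsUniversalRForm r) (hU : IsCorep U) (hV : IsCorep V)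
    (hJ : ReflectionEquation r U V J) (hJu : IsUnit J.det)
    (he : IsBasisOf e (splitOff h (wSpan U V J))) :
    IsUnit (chiMatrix r e).det ↔ (cMatrix r U V J).rank = M := by
  obtain ⟨E, F, hE, hF⟩ := he.exists_expansion
  let Y : Matrix (Fin N × Fin N) (Fin N × Fin N) ℂ :=
    Matrix.of fun p s => reducedForm r (splitElem U V J h p) (splitElem U V J h s)
  have e1 : chiMatrix r e = E * Y * E.transpose := by
    ext i j
    simp only [chiMatrix, Matrix.of_apply, chi_eq_reducedForm, Matrix.mul_apply,
      Matrix.transpose_apply, Y]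
    rw [hE i, hE j]
    simp [Finset.mul_sum, mul_comm, mul_left_comm]
  have e2 : Y = F * chiMatrix r e * F.transpose := by
    ext i j
    simp only [chiMatrix, Matrix.of_apply, chi_eq_reducedForm, Matrix.mul_apply,
      Matrix.transpose_apply, Y]
    rw [hF i, hF j]
    simp [Finset.mul_sum, mul_comm, mul_left_comm]
  have e3 : Y = Matrix.kroneckerMap (· * ·) (1 : Matrix (Fin N) (Fin N) ℂ) J.transpose *
      cMatrix r U V J := by
    ext p s
    simp only [Y, Matrix.of_apply, reducedForm_splitElem hr, reducedForm_wElem hr hU hV hJ,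
      Matrix.mul_apply, Matrix.kroneckerMap_apply, Fintype.sum_prod_type, cMatrix,
      Matrix.transpose_apply]
    simp [Matrix.one_apply]
  have hY : Y.rank = (cMatrix r U V J).rank := by
    rw [e3]
    refine Matrix.rank_mul_eq_right_of_isUnit_det _ _ ?_
    rw [Matrix.det_kronecker, Matrix.det_transpose]
    simpa using hJu.pow _
  rw [isUnit_det_iff_rank, ← hY]
  have hle : (chiMatrix r e).rank = Y.rank := by
    apply le_antisymm
    · rw [e1]
      exact (Matrix.rank_mul_le_left _ _).trans (Matrix.rank_mul_le_right _ _)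
    · rw [e2]
      exact (Matrix.rank_mul_le_left _ _).trans (Matrix.rank_mul_le_right _ _)
  rw [hle]

end Form

/-! ### The chain rule and the embedding of the constructed calculus -/

section ChainRule

variable {H : Type u} [Ring H] [HopfAlgebra ℂ H] {r : H →ₗ[ℂ] H →ₗ[ℂ] ℂ} {N M : ℕ}
  {U V : Matrix (Fin N) (Fin N) H} {J : Matrix (Fin N) (Fin N) ℂ} {h : H →ₗ[ℂ] ℂ} {e : Fin M → H}
  {π : Matrix (Fin M) (Fin M) H}

/-- The matrix of coefficients of the coaction in a basis is a corepresentation. -/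
theorem isCorep_of_linearIndependent (he : LinearIndependent ℂ e)
    (hπ : ∀ i, comul (R := ℂ) (e i) = ∑ j, π i j ⊗ₜ[ℂ] e j) : IsCorep π := by
  -- A left inverse of the coordinate map provides functionals on H dual to e. They read off π, and,
  -- applied in the third tensor factor, turn coassociativity at e^i into the coproduct of π.
  obtain ⟨g, hg⟩ := LinearMap.exists_leftInverse_of_injective (Fintype.linearCombination ℂ e)
    (LinearMap.ker_eq_bot.2 he.fintypeLinearCombination_injective)
  let l : Fin M → H →ₗ[ℂ] ℂ := fun j => LinearMap.proj j ∘ₗ g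
  have hl : ∀ j k, l j (e k) = if k = j then 1 else 0 := by
    intro j k
    have := congrFun (LinearMap.congr_fun hg (Pi.single k 1)) j
    simpa [l, Fintype.linearCombination_apply_single, Pi.single_apply, eq_comm] using this
  have h1 : ∀ i j, π i j = hit (l j) (e i) := by
    intro i j
    rw [hit_of_comul (hπ i)]
    simp [hl]
  refine ⟨fun i j => ?_, fun i j => ?_⟩
  · have h2 := Coalgebra.coassoc_apply (R := ℂ) (e i)
    let Θ : H ⊗[ℂ] (H ⊗[ℂ] H) →ₗ[ℂ] H ⊗[ℂ] H :=
      ((TensorProduct.rid ℂ H).toLinearMap ∘ₗ (l j).lTensor H).lTensor H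
    have h3 := congrArg Θ h2
    have h4 : ∀ (x : H ⊗[ℂ] H) (y : H), Θ (TensorProduct.assoc ℂ H H H (x ⊗ₜ y)) = l j y • x := by
      intro x y
      induction x using TensorProduct.induction_on with
      | zero => simp
      | tmul a b => simp [Θ]
      | add a b ha hb => rw [TensorProduct.add_tmul, map_add, map_add, ha, hb, smul_add]
    have h5 : ∀ x k, Θ (π i x ⊗ₜ (π x k ⊗ₜ e k)) = if k = j then π i x ⊗ₜ π x k else 0 := by
      intro x k
      simp only [Θ, LinearMap.lTensor_tmul, LinearMap.comp_apply, hl]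
      split_ifs <;> simp
    simp only [hπ, map_sum, LinearMap.rTensor_tmul, LinearMap.lTensor_tmul, h4, hl, h5,
      TensorProduct.tmul_sum, ite_smul, one_smul, zero_smul, Finset.sum_ite_eq', Finset.mem_univ,
      if_true] at h3
    exact h3
  · rw [h1, counit_hit, hl]

/-- `hit_wElem` solved for φ by means of J⁻¹. -/
theorem hit_phi_eq (hr : IsUniversalRForm r) (hU : IsCorep U) (hV : IsCorep V)
    (hJu : IsUnit J.det) {a : H} (ha : a ∈ quantumSpace hr hU hV J) (m p : Fin N) :
    hit (phi r U m p) a = ∑ n, J⁻¹ n p • hit (reducedForm r (wElem U V J m n)) a := by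
  have e1 : ∀ n, hit (reducedForm r (wElem U V J m n)) a = ∑ p, J p n • hit (phi r U m p) a := by
    intro n
    rw [← hit_wElem hr hU hV ha, ← counit_wElem (J := J) hU hV m n]
    rfl
  simp only [e1, Finset.smul_sum, smul_smul]
  rw [Finset.sum_comm]
  simp only [← Finset.sum_smul, mul_comm (J⁻¹ _ _), ← Matrix.mul_apply, Matrix.mul_nonsing_inv J hJu,
    Matrix.one_apply]
  simp

/-- On the quantum space, `η_{kj}` is determined by its values on `P`. -/
theorem hit_phi_expand (hr : IsUniversalRForm r) (hU : IsCorep U) (hV : IsCorep V)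
    (hJu : IsUnit J.det) (he : IsBasisOf e (splitOff h (wSpan U V J)))
    (heX : ∀ i, e i ∈ quantumSpace hr hU hV J)
    (hχ : IsUnit (chiMatrix r e).det) {a : H} (ha : a ∈ quantumSpace hr hU hV J) (m p : Fin N) :
    hit (phi r U m p) a =
      ∑ j, ∑ l, ((chiMatrix r e)⁻¹ j l * phi r U m p (e j)) • hit (chi r e l) a := by
  obtain ⟨E, F, hE, hF⟩ := he.exists_expansion
  have e0 : ∀ n, reducedForm r (wElem U V J m n) = ∑ k, F (m, n) k • chi r e k := by
    intro n
    have : wElem U V J m n = splitElem U V J h (m, n) + h (wElem U V J m n) • 1 := by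
      simp [splitElem]
    rw [this, hF]
    ext x
    simp [reducedForm_one_left hr, chi_eq_reducedForm]
  -- The coefficients c are the same for all a, so evaluation at the e^j determines them:
  -- φ^{mp}(e^j) = c_l χ^{lj}, and χ is invertible.
  obtain ⟨c, e1⟩ : ∃ c : Fin M → ℂ, ∀ a ∈ quantumSpace hr hU hV J, hit (phi r U m p) a =
      ∑ l, c l • hit (chi r e l) a := by
    refine ⟨fun l => ∑ n, J⁻¹ n p * F (m, n) l, fun a ha => ?_⟩
    rw [hit_phi_eq hr hU hV hJu ha]
    simp only [e0, hit_sum, hit_smul, Finset.smul_sum, smul_smul, Finset.sum_smul]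
    exact Finset.sum_comm
  have e2 : ∀ j, phi r U m p (e j) = ∑ l, c l * chiMatrix r e l j := by
    intro j
    simpa [counit_hit, chiMatrix] using congrArg (counit (R := ℂ)) (e1 _ (heX j))
  rw [e1 a ha, Finset.sum_comm]
  refine Finset.sum_congr rfl fun l _ => ?_
  rw [← Finset.sum_smul]
  congr 1
  have e3 : c = Matrix.vecMul (Matrix.vecMul c (chiMatrix r e)) (chiMatrix r e)⁻¹ := by
    rw [Matrix.vecMul_vecMul, Matrix.mul_nonsing_inv _ hχ, Matrix.vecMul_one]
  conv_lhs => rw [e3]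
  simp only [e2, Matrix.vecMul, dotProduct, mul_comm]

theorem partialH_of_comul (hπ : ∀ i, comul (R := ℂ) (e i) = ∑ j, π i j ⊗ₜ[ℂ] e j) (i j : Fin N)
    (k : Fin M) : partialH r U i j (e k) =
      ∑ m, ∑ p, eta r U m j (e p) • (π k p * antipode ℂ (U m i)) := by
  simp only [partialH, hit_of_comul (hπ k), Finset.sum_mul, smul_mul_assoc]

/-- The chain rule. -/
theorem partialH_eq_sum_partialX (hr : IsUniversalRForm r) (hU : IsCorep U) (hV : IsCorep V)
    (hJu : IsUnit J.det) (he : IsBasisOf e (splitOff h (wSpan U V J)))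
    (heX : ∀ i, e i ∈ quantumSpace hr hU hV J)
    (hπ : ∀ i, comul (R := ℂ) (e i) = ∑ j, π i j ⊗ₜ[ℂ] e j)
    (hχ : IsUnit (chiMatrix r e).det) {a : H} (ha : a ∈ quantumSpace hr hU hV J) (i j : Fin N) :
    partialH r U i j a = ∑ k, partialX r e π k a * partialH r U i j (e k) := by
  have hc := isCorep_of_linearIndependent he.1 hπ
  have e1 : ∀ m, hit (eta r U m j) a =
      ∑ n, ∑ l, ((chiMatrix r e)⁻¹ n l * eta r U m j (e n)) • hit (chi r e l) a := by
    intro m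
    simp only [eta, hit_sum, hit_smul, hit_phi_expand hr hU hV hJu he heX hχ ha,
      LinearMap.sum_apply, LinearMap.smul_apply, Finset.smul_sum, Finset.mul_sum, Finset.sum_smul,
      smul_smul, smul_eq_mul]
    rw [Finset.sum_comm]
    refine Finset.sum_congr rfl fun n _ => ?_
    rw [Finset.sum_comm]
    exact Finset.sum_congr rfl fun l _ => Finset.sum_congr rfl fun p _ => by congr 1; ring
  -- The S(π^n_k) in ∂_k meets the π^k_p produced by the coproduct of e^k; summing over k leaves p =
  -- n.
  have e2 : ∀ x : H, ∀ n m, ∑ k, (x * antipode ℂ (π n k)) *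
      ∑ p, eta r U m j (e p) • (π k p * antipode ℂ (U m i)) =
      eta r U m j (e n) • (x * antipode ℂ (U m i)) := by
    intro x n m
    have : ∀ k p, (x * antipode ℂ (π n k)) * eta r U m j (e p) • (π k p * antipode ℂ (U m i)) =
        eta r U m j (e p) • (x * (antipode ℂ (π n k) * π k p) * antipode ℂ (U m i)) := by
      intro k p
      rw [mul_smul_comm]
      simp only [mul_assoc]
    simp only [Finset.mul_sum, this]
    rw [Finset.sum_comm]
    simp only [← Finset.smul_sum, ← Finset.sum_mul, ← Finset.mul_sum, hc.sum_antipode_mul]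
    simp
  simp only [partialH_of_comul hπ, partialX, Finset.sum_mul, smul_mul_assoc]
  calc partialH r U i j a
      = ∑ m, ∑ n, ∑ l, (chiMatrix r e)⁻¹ n l • (eta r U m j (e n) •
          (hit (chi r e l) a * antipode ℂ (U m i))) := by
        simp only [partialH, e1, Finset.sum_mul, smul_mul_assoc, mul_smul]
    _ = ∑ m, ∑ n, ∑ l, (chiMatrix r e)⁻¹ n l • ∑ k, (hit (chi r e l) a * antipode ℂ (π n k)) *
          ∑ p, eta r U m j (e p) • (π k p * antipode ℂ (U m i)) := by simp only [e2]
    _ = ∑ m, ∑ k, ∑ n, ∑ l, (chiMatrix r e)⁻¹ n l • ((hit (chi r e l) a * antipode ℂ (π n k)) *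
          ∑ p, eta r U m j (e p) • (π k p * antipode ℂ (U m i))) := by
        refine Finset.sum_congr rfl fun m _ => ?_
        simp only [Finset.smul_sum]
        rw [Finset.sum_congr rfl fun n _ => Finset.sum_comm, Finset.sum_comm]
    _ = _ := by
        rw [Finset.sum_comm]
        refine Finset.sum_congr rfl fun k _ => ?_
        simp only [Finset.mul_sum, Finset.smul_sum]
        rw [Finset.sum_comm]
        refine Finset.sum_congr rfl fun n _ => ?_
        rw [Finset.sum_comm]

theorem phi_eq_sum_eta (hφ : IsUnit (phiMatrix r U).det) (m n : Fin N) :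
    phi r U m n = ∑ p : Fin N × Fin N, phiMatrix r U (m, n) p • eta r U p.1 p.2 := by
  simp only [eta, Finset.smul_sum, smul_smul, Prod.mk.eta]
  rw [Finset.sum_comm]
  simp only [← Finset.sum_smul, ← Matrix.mul_apply, Matrix.mul_nonsing_inv _ hφ, Matrix.one_apply,
    ite_smul, one_smul, zero_smul, Finset.sum_ite_eq, Finset.mem_univ, if_true]

/-- The forms `d e^i` of the standard calculus are independent over `H`. -/
theorem eq_zero_of_sum_mul_partialH (hr : IsUniversalRForm r) (hU : IsCorep U) (hV : IsCorep V)
    (he : IsBasisOf e (splitOff h (wSpan U V J)))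
    (heX : ∀ i, e i ∈ quantumSpace hr hU hV J)
    (hπ : ∀ i, comul (R := ℂ) (e i) = ∑ j, π i j ⊗ₜ[ℂ] e j)
    (hχ : IsUnit (chiMatrix r e).det) (hφ : IsUnit (phiMatrix r U).det) {c : Fin M → H}
    (hc0 : ∀ i j, ∑ k, c k * partialH r U i j (e k) = 0) : c = 0 := by
  have hc := isCorep_of_linearIndependent he.1 hπ
  -- The hypothesis is linear in z. The factors S(u), φ⁻¹ and J are removed in turn until χ z = 0 is
  -- reached; z = 0 then gives c = 0 by applying S(π).
  let z : Fin M → H := fun p => ∑ k, c k * π k p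
  have e1 : ∀ n j, ∑ p, eta r U n j (e p) • z p = 0 := by
    intro n j
    have f1 : ∀ i, ∑ m, (∑ p, eta r U m j (e p) • z p) * antipode ℂ (U m i) = 0 := by
      intro i
      rw [← hc0 i j]
      simp only [partialH_of_comul hπ, z, Finset.mul_sum, Finset.sum_mul, Finset.smul_sum,
        smul_mul_assoc, mul_smul_comm, mul_assoc]
      rw [Finset.sum_congr rfl fun m _ => Finset.sum_comm, Finset.sum_comm]
    -- Multiplication by u^i_n and summation over i cancels S(u^m_i) and isolates m = n.
    have f2 : ∑ i, (∑ m, (∑ p, eta r U m j (e p) • z p) * antipode ℂ (U m i)) * U i n = 0 := by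
      simp [f1]
    simp only [Finset.sum_mul (s := Finset.univ) (f := fun m => _ * antipode ℂ (U m _)), mul_assoc] at f2
    rw [Finset.sum_comm] at f2
    simp only [← Finset.mul_sum, hU.sum_antipode_mul] at f2
    simpa using f2
  have e2 : ∀ m n, ∑ p, phi r U m n (e p) • z p = 0 := by
    intro m n
    simp only [phi_eq_sum_eta hφ, LinearMap.sum_apply, LinearMap.smul_apply, Finset.sum_smul,
      smul_assoc]
    rw [Finset.sum_comm]
    simp [← Finset.smul_sum, e1]
  obtain ⟨E, F, hE, hF⟩ := he.exists_expansion
  have e3 : ∀ l, ∑ p, chiMatrix r e l p • z p = 0 := by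
    intro l
    -- χ^l expressed by the φ^{mn}; this needs the argument e^p to lie in the quantum space.
    have f : ∀ p, chiMatrix r e l p = ∑ s : Fin N × Fin N, ∑ n, E l s * J n s.2 * phi r U s.1 n (e p) := by
      intro p
      simp only [mul_assoc, ← Finset.mul_sum, ← form_wElem hr hU hV (heX p)]
      simp only [chiMatrix, Matrix.of_apply, chi_eq_reducedForm]
      conv_lhs => rw [hE l]
      simp [splitElem, reducedForm_one_left hr, reducedForm_apply (wElem _ _ _ _ _),
        counit_wElem hU hV]
    simp only [f, Finset.sum_smul, mul_smul]
    rw [Finset.sum_comm]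
    refine Finset.sum_eq_zero fun s _ => ?_
    rw [Finset.sum_comm]
    simp [← Finset.smul_sum, e2]
  have e4 : ∀ q, z q = 0 := by
    intro q
    have : ∑ l, (chiMatrix r e)⁻¹ q l • ∑ p, chiMatrix r e l p • z p = 0 := by simp [e3]
    simp only [Finset.smul_sum, smul_smul] at this
    rw [Finset.sum_comm] at this
    simpa [← Finset.sum_smul, ← Matrix.mul_apply, Matrix.nonsing_inv_mul _ hχ,
      Matrix.one_apply] using this
  ext m
  have e5 : ∑ p, z p * antipode ℂ (π p m) = 0 := by simp [e4]
  simp only [z, Finset.sum_mul, mul_assoc] at e5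
  rw [Finset.sum_comm] at e5
  simpa [← Finset.mul_sum, hc.sum_mul_antipode] using e5

/-- Uniqueness of the coefficients of d 0 = 0 makes the d e^i independent over X in Γ and the d
u^i_j independent over H in Ω. The chain rule supplies equal coefficients, and a relation between
the d e^k in Ω becomes one between the ∂_{ij}(e^k), which has only the zero solution. -/
theorem isSubcalculus_of_isConstructedCalculus (hr : IsUniversalRForm r) (hU : IsCorep U)
    (hV : IsCorep V) (hJu : IsUnit J.det) {e : Fin M → quantumSpace hr hU hV J}
    (he : IsBasisOf (fun i => (e i : H)) (splitOff h (wSpan U V J)))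
    (hπ : ∀ i, comul (R := ℂ) (e i : H) = ∑ j, π i j ⊗ₜ[ℂ] (e j : H))
    (hχ : IsUnit (chiMatrix r fun i => (e i : H)).det) (hφ : IsUnit (phiMatrix r U).det)
    (Γ : FODC.{u, w} (quantumSpace hr hU hV J)) (Ω : FODC.{u, w} H)
    (hΓ : IsConstructedCalculus r e π Γ) (hΩ : IsStandardCalculus r U Ω) : Γ.IsSubcalculus Ω := by
  obtain ⟨-, hΓu, hΓd⟩ := hΓ
  obtain ⟨-, hΩu, hΩd⟩ := hΩ
  choose D hD hΓD using hΓd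
  have hchain : ∀ (a : quantumSpace hr hU hV J) (p : Fin N × Fin N),
      partialH r U p.1 p.2 (a : H) = ∑ k, (D a k : H) * partialH r U p.1 p.2 (e k : H) := by
    intro a p
    simp only [hD]
    exact partialH_eq_sum_partialX hr hU hV hJu he (fun i => (e i).2) hπ hχ a.2 p.1 p.2
  have hcomb : ∀ c : Fin M → H, ∑ k, c k • Ω.d (e k : H) =
      ∑ p : Fin N × Fin N, (∑ k, c k * partialH r U p.1 p.2 (e k : H)) • Ω.d (U p.1 p.2) := by
    intro c
    rw [Finset.sum_congr rfl fun k _ => congrArg (c k • ·) (hΩd (e k : H))]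
    simp only [Finset.smul_sum, Finset.sum_smul, smul_smul]
    exact Finset.sum_comm
  refine Γ.isSubcalculus_of_coefficients Ω e D hΓD ?_ ?_ ?_
  · intro c hc
    refine (hΓu 0).unique ?_ ?_
    · rw [hc, map_zero]
    · simp
  · intro a
    rw [hcomb, hΩd]
    exact Finset.sum_congr rfl fun p _ => by rw [hchain]
  · intro c hc
    rw [hcomb] at hc
    have h0 := (hΩu 0).unique (y₁ := fun p : Fin N × Fin N =>
      ∑ k, (c k : H) * partialH r U p.1 p.2 (e k : H)) (y₂ := 0) (by rw [hc, map_zero]) (by simp)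
    have := eq_zero_of_sum_mul_partialH hr hU hV he (fun i => (e i).2) hπ hχ hφ
      (c := fun k => (c k : H)) fun i j => congrFun h0 (i, j)
    ext k
    exact congrFun this k

end ChainRule

/-! ### Characters and two-dimensional representations of O(SL_q(N)) -/

section Bidiagonal

variable {A : Type u} [Ring A] {N : ℕ} {q : ℂ}

/-- The matrix with diagonal `d` and the single further entry `c` in the position `(m, m')`. -/
def bidiag (m m' : Fin N) (d : Fin N → A) (c : A) : Matrix (Fin N) (Fin N) A :=
  Matrix.of fun k l => if k = l then d k else if k = m ∧ l = m' then c else 0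

theorem bidiag_self (m m' : Fin N) (d : Fin N → A) (c : A) (k : Fin N) :
    bidiag m m' d c k k = d k := by simp [bidiag]

theorem bidiag_off {m m' : Fin N} (h : m ≠ m') (d : Fin N → A) (c : A) :
    bidiag m m' d c m m' = c := by simp [bidiag, h]

theorem bidiag_eq_zero {m m' : Fin N} (d : Fin N → A) (c : A) {k l : Fin N} (h : k ≠ l)
    (h' : ¬ (k = m ∧ l = m')) : bidiag m m' d c k l = 0 := by simp [bidiag, h, h']

variable [Algebra ℂ A]

/-- The matrix is so sparse that most products in the quadratic relations vanish, and the hypotheses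
are the relations that remain. Adjacency of m' and m excludes an index strictly between them, whose
diagonal entry would otherwise meet c in the mixed relations. -/
theorem bidiag_frt (hq : q ≠ 0) {m m' : Fin N} (hm : m'.val + 1 = m.val) {d : Fin N → A} {c : A}
    (hd : ∀ k l, d k * d l = d l * d k) (h1 : c * d m = q • (d m * c))
    (h2 : d m' * c = q • (c * d m')) (h3 : ∀ k, k ≠ m → k ≠ m' → d k * c = c * d k) :
    FRT q (bidiag m m' d c) := by
  have hne : m ≠ m' := fun h => by subst h; omega
  have hlt : m' < m := by rw [Fin.lt_def]; omega
  apply frt_of_manin hq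
  · intro i k l hkl
    by_cases hi : i = m ∧ k = m' ∧ l = m
    · obtain ⟨rfl, rfl, rfl⟩ := hi
      rw [bidiag_off hne, bidiag_self, h1]
    · have : bidiag m m' d c i k = 0 ∨ bidiag m m' d c i l = 0 := by
        simp only [bidiag, Matrix.of_apply]
        simp only [Fin.ext_iff, Fin.lt_def] at *
        split_ifs <;> first | omega | simp
      rcases this with h | h <;> simp [h]
  · intro i j k hij
    by_cases hi : i = m' ∧ j = m ∧ k = m'
    · obtain ⟨rfl, rfl, rfl⟩ := hi
      rw [bidiag_off hne, bidiag_self, h2]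
    · have : bidiag m m' d c i k = 0 ∨ bidiag m m' d c j k = 0 := by
        simp only [bidiag, Matrix.of_apply]
        simp only [Fin.ext_iff, Fin.lt_def] at *
        split_ifs <;> first | omega | simp
      rcases this with h | h <;> simp [h]
  · intro i j k l hij hkl
    by_cases hi : i = l
    · subst hi
      by_cases hj : j = m ∧ k = m'
      · obtain ⟨rfl, rfl⟩ := hj
        rw [Fin.lt_def] at hij hkl
        omega
      · rw [bidiag_eq_zero (k := j) (l := k) _ _ (hkl.trans hij).ne' hj]
        simp
    · by_cases hc : i = m ∧ l = m'
      · rw [bidiag_eq_zero (k := j) (l := k) _ _ (hkl.trans (hc.2 ▸ hlt |>.trans (hc.1 ▸ hij))).ne'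
          fun h => hij.ne (hc.1.trans h.1.symm)]
        simp
      · rw [bidiag_eq_zero (k := i) (l := l) _ _ hi hc]
        simp
  · intro i j k l hij hkl
    have h0 : bidiag m m' d c j k * bidiag m m' d c i l = 0 := by
      have : bidiag m m' d c j k = 0 ∨ bidiag m m' d c i l = 0 := by
        simp only [bidiag, Matrix.of_apply]
        simp only [Fin.ext_iff, Fin.lt_def] at *
        split_ifs <;> first | omega | simp
      rcases this with h | h <;> simp [h]
    rw [h0, smul_zero, add_zero]
    by_cases hi : i = k <;> by_cases hj : j = l
    · subst hi hj
      rw [bidiag_self, bidiag_self, hd]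
    · subst hi
      by_cases hc : j = m ∧ l = m'
      · obtain ⟨rfl, rfl⟩ := hc
        rw [bidiag_self, bidiag_off hne, h3 i hij.ne hkl.ne]
      · rw [bidiag_eq_zero _ _ hj hc]; simp
    · subst hj
      by_cases hc : i = m ∧ k = m'
      · obtain ⟨rfl, rfl⟩ := hc
        rw [bidiag_self, bidiag_off hne, h3 j hij.ne' hkl.ne']
      · rw [bidiag_eq_zero _ _ hi hc]; simp
    · by_cases hc : i = m ∧ k = m'
      · rw [bidiag_eq_zero _ _ hj]
        · simp
        · rintro ⟨rfl, rfl⟩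
          exact hij.ne hc.1
      · rw [bidiag_eq_zero _ _ hi hc]; simp

/-- For a lower triangular matrix only the identity permutation contributes to the quantum
determinant, in either expansion. -/
theorem isQuantumSL_bidiag (hq : q ≠ 0) {m m' : Fin N} (hm : m'.val + 1 = m.val) {d : Fin N → A}
    {c : A} (hd : ∀ k l, d k * d l = d l * d k) (h1 : c * d m = q • (d m * c))
    (h2 : d m' * c = q • (c * d m')) (h3 : ∀ k, k ≠ m → k ≠ m' → d k * c = c * d k)
    (hp : (List.ofFn d).prod = 1) : IsQuantumSL q (bidiag m m' d c) := by
  have hlow : ∀ i j, i < j → bidiag m m' d c i j = 0 := by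
    intro i j hij
    refine bidiag_eq_zero _ _ hij.ne ?_
    rintro ⟨rfl, rfl⟩
    rw [Fin.lt_def] at hij
    omega
  have hw : word (bidiag m m' d c) id id = 1 := by
    simp only [word, id, bidiag_self, hp]
  refine ⟨bidiag_frt hq hm hd h1 h2 h3, ?_, ?_⟩
  · rw [qdet_lower hlow, hw]
  · rw [qdet_upper (T := (bidiag m m' d c).transpose) fun i j h => hlow j i h, word_transpose, hw]

/-- The diagonal of the image of the generators in the two-dimensional representation at the
adjacent rows `m'`, `m`. -/
def lowerDiag (q : ℂ) (m m' : Fin N) (k : Fin N) : Fin 2 → ℂ :=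
  ![if k = m' then q else if k = m then q⁻¹ else 1, 1]

/-- All images are upper triangular, so the corner entry is a twisted derivation on O(SL_q(N)): the
analogue of a simple root vector. It serves to lower the index m of w to m'. -/
theorem isQuantumSL_lower (hq : q ≠ 0) {m m' : Fin N} (hm : m'.val + 1 = m.val) :
    IsQuantumSL q (bidiag m m' (fun k => Matrix.diagonal (lowerDiag q m m' k))
      (Matrix.single (0 : Fin 2) 1 (1 : ℂ))) := by
  have hne : m ≠ m' := fun h => by subst h; omega
  apply isQuantumSL_bidiag hq hm
  · intro k l
    simp [Matrix.diagonal_mul_diagonal, mul_comm]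
  · ext i j
    fin_cases i <;> fin_cases j <;> simp [lowerDiag, hne, hq]
  · ext i j
    fin_cases i <;> fin_cases j <;> simp [lowerDiag]
  · intro k h1 h2
    ext i j
    fin_cases i <;> fin_cases j <;> simp [lowerDiag, h1, h2]
  · rw [prod_diagonal]
    ext i j
    have hprod : ∏ t, (if t = m' then q else if t = m then q⁻¹ else 1) = 1 := by
      have : ∀ t, (if t = m' then q else if t = m then q⁻¹ else 1) =
          (if t = m' then q else 1) * if t = m then q⁻¹ else 1 := by
        intro t
        split_ifs with h1 h2
        · exact absurd (h2.symm.trans h1) hne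
        all_goals simp
      simp only [this, Finset.prod_mul_distrib, Finset.prod_ite_eq', Finset.mem_univ, if_true]
      exact mul_inv_cancel₀ hq
    fin_cases i <;> fin_cases j <;> simp [lowerDiag, hprod]

/-- The bidiagonal case with c = 0. It requires two adjacent indices, so N < 2 is separate; there
the condition forces the identity matrix. -/
theorem isQuantumSL_diagonal (hq : q ≠ 0) {t : Fin N → ℂ} (ht : ∏ k, t k = 1) :
    IsQuantumSL q (Matrix.diagonal t) := by
  rcases Nat.lt_or_ge N 2 with hN | hN
  · have : Subsingleton (Fin N) := by
      interval_cases N <;> infer_instance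
    have : Matrix.diagonal t = 1 := by
      ext i j
      obtain rfl := Subsingleton.elim i j
      rw [Fintype.prod_subsingleton _ i] at ht
      simp [ht]
    rw [this]
    exact isQuantumSL_one
  · have h := isQuantumSL_bidiag (N := N) (d := t) (c := 0) hq (m := ⟨1, by omega⟩)
      (m' := ⟨0, by omega⟩) (by simp) (fun k l => mul_comm _ _) (by simp) (by simp) (by simp)
      (by rw [List.prod_ofFn, ht])
    convert h using 1
    ext i j
    simp [bidiag, Matrix.diagonal_apply]

end Bidiagonal

/-! ### Torus weights and lowering of the indices of w -/

section Weights

variable {N : ℕ} {q : ℂˣ} {J : Matrix (Fin N) (Fin N) ℂ}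

theorem OSL.isCorep_gen : IsCorep (OSL.gen N q) := ⟨OSL.comul_gen, OSL.counit_gen⟩

theorem lhit_wElem (f : OSL N q →ₗ[ℂ] ℂ) (i j : Fin N) :
    lhit f (wElem (OSL.gen N q) (OSL.gen N q) J i j) = ∑ p : Fin N × Fin N,
      f (OSL.gen N q i p.1 * OSL.gen N q j p.2) • wElem (OSL.gen N q) (OSL.gen N q) J p.1 p.2 :=
  lhit_of_comul (comul_wElem OSL.isCorep_gen OSL.isCorep_gen i j) f

theorem lhit_torus {t : Fin N → ℂ} (ht : ∏ k, t k = 1) (i j : Fin N) :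
    lhit (OSL.lift (isQuantumSL_diagonal q.ne_zero ht)).toLinearMap
      (wElem (OSL.gen N q) (OSL.gen N q) J i j) =
      (t i * t j) • wElem (OSL.gen N q) (OSL.gen N q) J i j := by
  rw [lhit_wElem, Finset.sum_eq_single (i, j)]
  · simp [OSL.lift_gen]
  · rintro ⟨a, b⟩ - hab
    have : Matrix.diagonal t i a * Matrix.diagonal t j b = 0 := by
      by_cases h : i = a
      · subst h
        rw [Matrix.diagonal_apply_ne t (i := j) (j := b), mul_zero]
        rintro rfl
        exact hab rfl
      · rw [Matrix.diagonal_apply_ne t h, zero_mul]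
    simp [OSL.lift_gen, this]
  · simp

/-- The functional given by the off-diagonal entry of the two-dimensional representation. -/
def lowerFun {m m' : Fin N} (hm : m'.val + 1 = m.val) : OSL N q →ₗ[ℂ] ℂ :=
  Matrix.entryLinearMap ℂ ℂ 0 1 ∘ₗ (OSL.lift (isQuantumSL_lower q.ne_zero hm)).toLinearMap

theorem lhit_lowerFun_one {m m' : Fin N} (hm : m'.val + 1 = m.val) :
    lhit (lowerFun (q := q) hm) 1 = 0 := by
  rw [lhit_one]
  simp [lowerFun]

/-- As i ≠ m, the first factor of u^i_a u^m_b has diagonal image, so the corner entry must come from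
the second factor; this forces a = i and b = m'. The first factor contributes its upper left entry.
-/
theorem lhit_lowerFun_right {m m' : Fin N} (hm : m'.val + 1 = m.val) {i : Fin N} (hi : i ≠ m) :
    lhit (lowerFun (q := q) hm) (wElem (OSL.gen N q) (OSL.gen N q) J i m) =
      lowerDiag (q : ℂ) m m' i 0 • wElem (OSL.gen N q) (OSL.gen N q) J i m' := by
  have hne : m ≠ m' := fun h => by subst h; omega
  rw [lhit_wElem, Finset.sum_eq_single (i, m')]
  · congr 1
    simp [lowerFun, OSL.lift_gen, bidiag_self, bidiag_off hne]
  · rintro ⟨a, b⟩ - hab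
    have : (OSL.lift (isQuantumSL_lower q.ne_zero hm) (OSL.gen N q i a * OSL.gen N q m b)) 0 1 = 0 := by
      rw [map_mul, OSL.lift_gen, OSL.lift_gen]
      by_cases ha : i = a
      · subst ha
        rw [bidiag_self]
        by_cases hb : m = b
        · subst hb
          rw [bidiag_self]
          simp
        · rw [bidiag_eq_zero _ _ hb]
          · simp
          · rintro ⟨-, rfl⟩; exact hab rfl
      · rw [bidiag_eq_zero _ _ ha fun h => hi h.1]
        simp
    simp only [lowerFun, LinearMap.comp_apply, AlgHom.toLinearMap_apply, Matrix.entryLinearMap_apply,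
      this, zero_smul]
  · simp

/-- Now the corner entry comes from the first factor, and the second contributes its lower right
entry, which is 1. -/
theorem lhit_lowerFun_left {m m' : Fin N} (hm : m'.val + 1 = m.val) {j : Fin N} (hj : j ≠ m) :
    lhit (lowerFun (q := q) hm) (wElem (OSL.gen N q) (OSL.gen N q) J m j) =
      wElem (OSL.gen N q) (OSL.gen N q) J m' j := by
  have hne : m ≠ m' := fun h => by subst h; omega
  rw [lhit_wElem, Finset.sum_eq_single (m', j)]
  · simp [lowerFun, OSL.lift_gen, bidiag_self, bidiag_off hne, lowerDiag]
  · rintro ⟨a, b⟩ - hab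
    have : (OSL.lift (isQuantumSL_lower q.ne_zero hm) (OSL.gen N q m a * OSL.gen N q j b)) 0 1 = 0 := by
      rw [map_mul, OSL.lift_gen, OSL.lift_gen]
      by_cases hb : j = b
      · subst hb
        rw [bidiag_self]
        by_cases ha : m = a
        · subst ha
          rw [bidiag_self]
          simp
        · rw [bidiag_eq_zero _ _ ha]
          · simp
          · rintro ⟨-, rfl⟩; exact hab rfl
      · rw [bidiag_eq_zero (k := j) _ _ hb fun h => hj h.1]
        simp
    simp only [lowerFun, LinearMap.comp_apply, AlgHom.toLinearMap_apply, Matrix.entryLinearMap_apply,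
      this, zero_smul]
  · simp

/-- The lowering operator kills scalars, but sends w^{im} to a nonzero multiple of w^{im'}. -/
theorem wElem_lower_right {m m' : Fin N} (hm : m'.val + 1 = m.val) {i : Fin N} (hi : i ≠ m) {z : ℂ}
    (h : wElem (OSL.gen N q) (OSL.gen N q) J i m = z • 1) :
    wElem (OSL.gen N q) (OSL.gen N q) J i m' = 0 := by
  have h1 := lhit_lowerFun_right (J := J) (q := q) hm hi
  rw [h, map_smul, lhit_lowerFun_one, smul_zero, eq_comm, smul_eq_zero] at h1
  refine h1.resolve_left ?_
  simp only [lowerDiag, Matrix.cons_val_zero]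
  split_ifs <;> simp

theorem wElem_lower_left {m m' : Fin N} (hm : m'.val + 1 = m.val) {j : Fin N} (hj : j ≠ m) {z : ℂ}
    (h : wElem (OSL.gen N q) (OSL.gen N q) J m j = z • 1) :
    wElem (OSL.gen N q) (OSL.gen N q) J m' j = 0 := by
  rw [← lhit_lowerFun_left hm hj, h, map_smul, lhit_lowerFun_one, smul_zero]

/-- Scalars have weight 1, so a scalar of any other weight is zero. -/
theorem wElem_eq_zero_of_torus {t : Fin N → ℂ} (ht : ∏ k, t k = 1) {i j : Fin N}
    (hij : t i * t j ≠ 1) {z : ℂ} (h : wElem (OSL.gen N q) (OSL.gen N q) J i j = z • 1) :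
    wElem (OSL.gen N q) (OSL.gen N q) J i j = 0 := by
  have h1 := lhit_torus (J := J) (q := q) ht i j
  have h2 : z • (1 : OSL N q) = (t i * t j) • (z • 1) := by
    rw [← h, ← h1, h, map_smul, lhit_one]
    simp
  rw [h]
  have h3 : (t i * t j - 1) • (z • (1 : OSL N q)) = 0 := by rw [sub_smul, one_smul, ← h2, sub_self]
  exact (smul_eq_zero.1 h3).resolve_left (sub_ne_zero.2 hij)

end Weights

/-! ### Independence of the basis of P -/

section Bases

variable {H : Type u} [Ring H] [HopfAlgebra ℂ H] {r : H →ₗ[ℂ] H →ₗ[ℂ] ℂ} {M : ℕ}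

theorem apply_lhit (f g : H →ₗ[ℂ] ℂ) (a : H) : g (lhit f a) = conv f g a := by
  simp [lhit_repr, conv_repr]

/-- The matrices of the reduced form in two bases of the same subspace. -/
theorem IsBasisOf.card_eq_and_isUnit_iff {ι : Type*} [Fintype ι] [DecidableEq ι] {P : Submodule ℂ H}
    {e : Fin M → H} (he : IsBasisOf e P) {f : ι → H} (hf : LinearIndependent ℂ f)
    (hfP : Submodule.span ℂ (Set.range f) = P) :
    M = Fintype.card ι ∧ (IsUnit (chiMatrix r e).det ↔
      IsUnit (Matrix.of fun i j => reducedForm r (f i) (f j)).det) := by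
  let b : Module.Basis (Fin M) ℂ P := (Module.Basis.span he.1).map (LinearEquiv.ofEq _ _ he.2)
  let b' : Module.Basis ι ℂ P := (Module.Basis.span hf).map (LinearEquiv.ofEq _ _ hfP)
  have hb : ∀ i, (b i : H) = e i := fun i => by simp [b, Module.Basis.span_apply]
  have hb' : ∀ i, (b' i : H) = f i := fun i => by simp [b', Module.Basis.span_apply]
  -- Both matrices represent this one form on P, and its nondegeneracy can be tested in any basis.
  let B : LinearMap.BilinForm ℂ P := (reducedForm r).compl₁₂ P.subtype P.subtype
  have e1 : chiMatrix r e = LinearMap.BilinForm.toMatrix b B := by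
    ext i j
    simp [LinearMap.BilinForm.toMatrix_apply, B, hb, chiMatrix, chi_eq_reducedForm]
  have e2 : (Matrix.of fun i j => reducedForm r (f i) (f j)) = LinearMap.BilinForm.toMatrix b' B := by
    ext i j
    simp [LinearMap.BilinForm.toMatrix_apply, B, hb']
  constructor
  · rw [← Fintype.card_fin M]
    exact Fintype.card_congr (b.indexEquiv b')
  · rw [e1, e2, isUnit_iff_ne_zero, isUnit_iff_ne_zero,
      ← LinearMap.BilinForm.nondegenerate_iff_det_ne_zero,
      ← LinearMap.BilinForm.nondegenerate_iff_det_ne_zero]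

end Bases

/-! ### Linear independence by distinct weights -/

section Independence

variable {N : ℕ} {q : ℂˣ} {J : Matrix (Fin N) (Fin N) ℂ}

/-- In base 3 one has 3^a + 3^b < 3^d whenever a ≤ b < d, so the larger exponent is determined
first. -/
theorem three_pow_add_injective {a b c d : ℕ} (hab : a ≤ b) (hcd : c ≤ d)
    (h : 3 ^ a + 3 ^ b = 3 ^ c + 3 ^ d) : a = c ∧ b = d := by
  have key : ∀ {a b d : ℕ}, a ≤ b → b < d → 3 ^ a + 3 ^ b < 3 ^ d := by
    intro a b d hab hbd
    have h1 : 3 ^ a ≤ 3 ^ b := Nat.pow_le_pow_right (by norm_num) hab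
    have h2 : 3 ^ (b + 1) ≤ 3 ^ d := Nat.pow_le_pow_right (by norm_num) hbd
    have h3 : 0 < 3 ^ b := by positivity
    rw [pow_succ] at h2
    omega
  have hbd : b = d := by
    rcases lt_trichotomy b d with h1 | h1 | h1
    · exact absurd h ((key hab h1).trans_le (Nat.le_add_left _ _)).ne
    · exact h1
    · exact absurd h ((key hcd h1).trans_le (Nat.le_add_left _ _)).ne'
  subst hbd
  exact ⟨Nat.pow_right_injective (le_refl 2 |>.trans (by norm_num)) (Nat.add_right_cancel h), rfl⟩

/-- There is a torus element whose weights on the products `u^i_k u^j_l`, `i ≤ j`, are distinct. -/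
theorem exists_regular_torus (N : ℕ) : ∃ t : Fin N → ℂ, ∏ k, t k = 1 ∧
    ∀ i j k l, i ≤ j → k ≤ l → t i * t j = t k * t l → i = k ∧ j = l := by
  let S : ℤ := ∑ k : Fin N, 3 ^ k.val
  have h2 : (2 : ℂ) ≠ 0 := two_ne_zero
  have hinj : Function.Injective fun n : ℤ => (2 : ℂ) ^ n := by
    intro a b hab
    have : (2 : ℝ) ^ a = (2 : ℝ) ^ b := by
      have hab' : (((2 : ℝ) ^ a : ℝ) : ℂ) = (((2 : ℝ) ^ b : ℝ) : ℂ) := by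
        push_cast
        exact hab
      exact Complex.ofReal_injective hab'
    exact zpow_right_injective₀ (by norm_num) (by norm_num) this
  -- The factor N makes the N exponents sum to N S - N S = 0, and the shift by S cancels when two
  -- weights of w are compared.
  refine ⟨fun b => 2 ^ ((N : ℤ) * 3 ^ b.val - S), ?_, ?_⟩
  · have : ∀ s : Finset (Fin N), ∀ x : Fin N → ℤ, ∏ k ∈ s, (2 : ℂ) ^ x k = 2 ^ ∑ k ∈ s, x k := by
      intro s x
      induction s using Finset.induction_on with
      | empty => simp
      | insert a s ha ih => rw [Finset.prod_insert ha, Finset.sum_insert ha, ih, zpow_add₀ h2]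
    rw [this, Finset.sum_sub_distrib, ← Finset.mul_sum]
    simp [S]
  · intro i j k l hij hkl h
    simp only [← zpow_add₀ h2] at h
    have h' := hinj h
    have hN : (N : ℤ) ≠ 0 := by have := i.2; omega
    have h3 : (N : ℤ) * (3 ^ i.val + 3 ^ j.val) = N * (3 ^ k.val + 3 ^ l.val) := by linarith
    have h4 := mul_left_cancel₀ hN h3
    have h5 := three_pow_add_injective (Fin.le_def.1 hij) (Fin.le_def.1 hkl) (by exact_mod_cast h4)
    exact ⟨Fin.ext h5.1, Fin.ext h5.2⟩

/-- The elements w - h(w) 1 are eigenvectors of a regular torus element with distinct eigenvalues;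
they are nonzero because w is not a scalar. -/
theorem linearIndependent_splitElem {h : OSL N q →ₗ[ℂ] ℂ}
    (hh : IsHaarOn (wSpan (OSL.gen N q) (OSL.gen N q) J) h) {Q : Fin N × Fin N → Prop}
    (hQ : ∀ p, Q p → p.1 ≤ p.2)
    (hw : ∀ p, Q p → ∀ z : ℂ, wElem (OSL.gen N q) (OSL.gen N q) J p.1 p.2 ≠ z • 1) :
    LinearIndependent ℂ fun p : {p // Q p} => splitElem (OSL.gen N q) (OSL.gen N q) J h p := by
  obtain ⟨t, ht, hinj⟩ := exists_regular_torus N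
  let τ := OSL.lift (q := q) (isQuantumSL_diagonal q.ne_zero ht)
  refine Module.End.eigenvectors_linearIndependent' (lhit τ.toLinearMap)
    (fun p : {p // Q p} => t p.1.1 * t p.1.2) ?_ _ ?_
  · rintro ⟨p, hp⟩ ⟨p', hp'⟩ hpp
    exact Subtype.ext (Prod.ext_iff.2 (hinj _ _ _ _ (hQ p hp) (hQ p' hp') hpp))
  · rintro ⟨p, hp⟩
    refine ⟨Module.End.mem_eigenspace_iff.2 ?_, fun h0 => hw p hp _ (sub_eq_zero.1 h0)⟩
    have h1 : lhit τ.toLinearMap (wElem (OSL.gen N q) (OSL.gen N q) J p.1 p.2) =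
      (t p.1 * t p.2) • wElem (OSL.gen N q) (OSL.gen N q) J p.1 p.2 := lhit_torus ht p.1 p.2
    -- Invariance of h: h(τ(w₍₁₎) w₍₂₎) = τ(w₍₁₎ h(w₍₂₎)) = h(w). Hence h(w) = t_i t_j h(w), and the
    -- subtracted scalar is compatible with the eigenvalue of w.
    have h2 := congrArg h h1
    rw [apply_lhit, ← apply_hit, hh.2 _ (Submodule.subset_span ⟨p, rfl⟩), map_smul, map_smul] at h2
    simp only [AlgHom.toLinearMap_apply, map_one, smul_eq_mul, mul_one] at h2
    simp only [splitElem, map_sub, h1, map_smul, lhit_one, smul_sub, smul_smul, ← h2]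
    simp

end Independence

/-! ### Number of index pairs -/

section Counting

theorem card_le (N : ℕ) : Fintype.card {p : Fin N × Fin N // p.1 ≤ p.2} = N * (N + 1) / 2 := by
  have h : Fintype.card {p : Fin N × Fin N // p.1 ≤ p.2} = ∑ j : Fin N, (j.val + 1) := by
    rw [Fintype.card_subtype, Finset.card_filter, Fintype.sum_prod_type_right]
    refine Finset.sum_congr rfl fun j _ => ?_
    rw [← Finset.card_filter, ← Fin.card_Iic]
    congr 1
    ext i
    simp
  have h2 := Finset.sum_range_id_mul_two (N + 1)
  rw [Finset.sum_range_succ'] at h2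
  rw [h, Fin.sum_univ_eq_sum_range (fun j => j + 1) N]
  simp only [add_zero, Nat.add_sub_cancel] at h2
  rw [mul_comm N, ← h2, Nat.mul_div_cancel _ two_pos]

theorem card_lt (N : ℕ) : Fintype.card {p : Fin N × Fin N // p.1 < p.2} = N * (N - 1) / 2 := by
  have h : Fintype.card {p : Fin N × Fin N // p.1 < p.2} = ∑ j : Fin N, j.val := by
    rw [Fintype.card_subtype, Finset.card_filter, Fintype.sum_prod_type_right]
    refine Finset.sum_congr rfl fun j _ => ?_
    rw [← Finset.card_filter, ← Fin.card_Iio]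
    congr 1
    ext i
    simp
  rw [h, Fin.sum_univ_eq_sum_range (fun j => j) N, ← Finset.sum_range_id_mul_two,
    Nat.mul_div_cancel _ two_pos]

end Counting

/-! ### Determinants of the blocks of the Gram matrix -/

section Determinants

variable {K : Type*} [Field K]

/-- The determinant of `α 1 1ᵀ + β L` with `L` unipotent lower triangular with constant entries
`1 - t` below the diagonal. -/
theorem isUnit_det_const_add_lower {n : ℕ} (hn : 2 ≤ n) (α β t : K) :
    IsUnit (Matrix.of fun k l : Fin n =>
      α + β * ((if k = l then 1 else 0) + if l < k then 1 - t else 0)).det ↔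
      β ≠ 0 ∧ β + α * ∑ i ∈ Finset.range n, t ^ i ≠ 0 := by
  set D : Matrix (Fin n) (Fin n) K := Matrix.of fun k l : Fin n =>
      α + β * ((if k = l then 1 else 0) + if l < k then 1 - t else 0) with hD
  let L : Matrix (Fin n) (Fin n) K :=
    Matrix.of fun k l => (if k = l then 1 else 0) + if l < k then 1 - t else 0
  have hL : L.det = 1 := by
    rw [Matrix.det_of_isLowerTriangular]
    · simp [L]
    · intro i j hij
      have hij' : i < j := hij
      simp [L, hij'.ne, hij'.not_gt]
  -- The solution of L y = 1, by the geometric sum. It makes α 1 1ᵀ equal to L (α y 1ᵀ), so that L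
  -- can be factored out and a rank-one perturbation of β remains.
  let y : Fin n → K := fun k => t ^ k.val
  have hgeom : ∀ m : ℕ, t ^ m + (1 - t) * ∑ i ∈ Finset.range m, t ^ i = 1 := by
    intro m
    rw [mul_comm, geom_sum_mul_neg]
    ring
  have hy : L.mulVec y = 1 := by
    ext k
    have e1 : ∑ l : Fin n, (if l < k then t ^ l.val else 0) = ∑ i ∈ Finset.range k.val, t ^ i := by
      refine (Fin.sum_univ_eq_sum_range (fun i => if i < k.val then t ^ i else 0) n).trans ?_
      rw [← Finset.sum_filter]
      congr 1
      ext i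
      simp only [Finset.mem_filter, Finset.mem_range]
      have := k.2
      omega
    simp only [Matrix.mulVec, dotProduct, L, Matrix.of_apply, y, add_mul, Finset.sum_add_distrib,
      ite_mul, one_mul, zero_mul, Finset.sum_ite_eq, Finset.mem_univ, if_true, Pi.one_apply]
    refine Eq.trans ?_ (hgeom k.val)
    rw [← e1, Finset.mul_sum]
    simp only [mul_ite, mul_zero]
  have hDL : D = L * (β • (1 : Matrix (Fin n) (Fin n) K) + α • Matrix.vecMulVec y 1) := by
    rw [Matrix.mul_add, Matrix.mul_smul, Matrix.mul_smul, Matrix.mul_one, Matrix.mul_vecMulVec, hy]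
    ext k l
    simp [hD, L, add_comm]
  have hsum : ∑ i ∈ Finset.range n, t ^ i = ∑ k, y k :=
    (Fin.sum_univ_eq_sum_range (fun i => t ^ i) n).symm
  by_cases hβ : β = 0
  · simp only [hβ, ne_eq, not_true_eq_false, false_and, iff_false]
    rw [isUnit_iff_ne_zero, not_not]
    -- For β = 0 all rows are equal, and n ≥ 2 provides two of them.
    exact Matrix.det_zero_of_row_eq (i := ⟨0, by omega⟩) (j := ⟨1, by omega⟩) (by simp)
      (by ext l; simp [hD, hβ])
  · have e : β • (1 : Matrix (Fin n) (Fin n) K) + α • Matrix.vecMulVec y 1 =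
        β • (1 + Matrix.vecMulVec ((α / β) • y) 1) := by
      rw [smul_add, Matrix.smul_vecMulVec, smul_smul, mul_div_cancel₀ _ hβ]
    have e2 : 1 + ∑ k, α / β * y k = (β + α * ∑ k, y k) / β := by
      rw [← Finset.mul_sum]
      field_simp
    rw [hDL, Matrix.det_mul, hL, one_mul, hsum, e, Matrix.det_smul, Matrix.vecMulVec_eq Unit,
      Matrix.det_one_add_replicateCol_mul_replicateRow, one_dotProduct]
    simp only [Pi.smul_apply, smul_eq_mul, e2, isUnit_iff_ne_zero, mul_ne_zero_iff, div_ne_zero_iff,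
      ne_eq, hβ, not_false_eq_true, and_true, true_and, pow_eq_zero_iff', false_and]

/-- A matrix that splits into a block `a (α 1 1ᵀ + β L) a` and an invertible block. -/
theorem isUnit_det_of_blocks {I : Type*} [Fintype I] [DecidableEq I] (X : Matrix I I K)
    (p : I → Prop) [DecidablePred p] (hX : ∀ i, ¬ p i → ∀ j, p j → X i j = 0) {n : ℕ} (hn : 2 ≤ n)
    (f : Fin n ≃ {i // p i}) {a : Fin n → K} (ha : ∀ k, a k ≠ 0) {α β t : K}
    (hD : ∀ k l, X (f k) (f l) =
      a k * (α + β * ((if k = l then 1 else 0) + if l < k then 1 - t else 0)) * a l)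
    (hY : β ≠ 0 → IsUnit (X.toSquareBlockProp fun i => ¬ p i).det) :
    IsUnit X.det ↔ β ≠ 0 ∧ β + α * ∑ i ∈ Finset.range n, t ^ i ≠ 0 := by
  have e1 : (X.toSquareBlockProp p).det =
      (Matrix.diagonal a * (Matrix.of fun k l : Fin n =>
        α + β * ((if k = l then 1 else 0) + if l < k then 1 - t else 0)) * Matrix.diagonal a).det := by
    rw [← Matrix.det_submatrix_equiv_self f]
    congr 1
    ext k l
    rw [Matrix.mul_diagonal, Matrix.diagonal_mul]
    exact hD k l
  have e2 : IsUnit (X.toSquareBlockProp p).det ↔ β ≠ 0 ∧ β + α * ∑ i ∈ Finset.range n, t ^ i ≠ 0 := by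
    have hu : IsUnit (∏ i, a i) := isUnit_iff_ne_zero.2 (Finset.prod_ne_zero_iff.2 fun i _ => ha i)
    rw [← isUnit_det_const_add_lower hn, e1, Matrix.det_mul, Matrix.det_mul, Matrix.det_diagonal,
      IsUnit.mul_iff, IsUnit.mul_iff]
    simp only [hu, true_and, and_true]
  -- The condition on the first block contains β ≠ 0, which already makes the second block
  -- invertible.
  rw [Matrix.twoBlockTriangular_det X p hX, IsUnit.mul_iff, e2]
  exact ⟨fun h => h.1, fun h => ⟨h, hY h.1⟩⟩

/-- The determinant of a monomial matrix. -/
theorem isUnit_det_monomial {I : Type*} [Fintype I] [DecidableEq I] (Y : Matrix I I K)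
    (σ : Equiv.Perm I) {d : I → K} (hd : ∀ i, d i ≠ 0)
    (hY : ∀ i j, Y i j = if σ i = j then d i else 0) : IsUnit Y.det := by
  have : Y = (Matrix.diagonal d).submatrix id σ.symm := by
    ext i j
    rw [hY, Matrix.submatrix_apply, Matrix.diagonal_apply]
    simp only [id, Equiv.eq_symm_apply]
  rw [this, Matrix.det_permute', Matrix.det_diagonal, IsUnit.mul_iff]
  refine ⟨?_, isUnit_iff_ne_zero.2 (Finset.prod_ne_zero_iff.2 fun i _ => hd i)⟩
  rcases Int.units_eq_one_or (Equiv.Perm.sign σ.symm) with h | h <;> simp [h]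

end Determinants

/-! ### The functionals φ and the reflection equation for monomial J -/

section Monomial

variable {N : ℕ} {q : ℂˣ} {s : ℂ} {τ : Fin N → Fin N} {κ : Fin N → ℂ}

theorem RMat_eq_zero {q : ℂ} {i j k l : Fin N} (h : ¬ (i = k ∧ j = l)) (h' : ¬ (i = l ∧ j = k)) :
    RMat q i j k l = 0 := by
  rw [RMat, if_neg h, if_neg fun hh => h' ⟨hh.1, hh.2.1⟩, add_zero]

theorem RMat_diag {q : ℂ} (i : Fin N) : RMat q i i i i = q := by simp [RMat]

theorem RMat_same {q : ℂ} {i j : Fin N} (h : i ≠ j) : RMat q i j i j = 1 := by simp [RMat, h]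

theorem RMat_swap {q : ℂ} {i j : Fin N} (h : i ≠ j) :
    RMat q i j j i = if j < i then q - q⁻¹ else 0 := by simp [RMat, h]

theorem mul_sum_RMat {q : ℂ} (i j : Fin N) (G : Fin N → Fin N → ℂ) :
    ∑ m, ∑ n, RMat q i j m n * G m n =
      (if i = j then q else 1) * G i j + (if j < i then q - q⁻¹ else 0) * G j i :=
  sum_RMat_left q i j G

/-- The Hecke relation. -/
theorem sum_RMat_mul_RMat {q : ℂ} (hq : q ≠ 0) (p i c y : Fin N) :
    ∑ l, ∑ a, RMat q p i l a * RMat q a l c y =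
      (if i = c ∧ p = y then 1 else 0) + (q - q⁻¹) * RMat q p i c y := by
  rw [mul_sum_RMat p i fun l a => RMat q a l c y]
  have hqq : q * q⁻¹ = 1 := mul_inv_cancel₀ hq
  -- R preserves the unordered pair of indices, so both sides vanish unless {p, i} = {c, y}.
  by_cases h1 : p = c ∧ i = y
  · obtain ⟨rfl, rfl⟩ := h1
    rcases lt_trichotomy p i with h | rfl | h
    · simp [RMat_swap h.ne', h.ne, h.ne', h, h.not_gt, RMat_same h.ne]
    · simp only [RMat_diag, if_true, lt_irrefl, if_false, and_self]
      linear_combination hqq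
    · simp [RMat_swap h.ne, h.ne, h.ne', h, h.not_gt, RMat_same h.ne']
  by_cases h2 : p = y ∧ i = c
  · obtain ⟨rfl, rfl⟩ := h2
    rcases lt_trichotomy p i with h | rfl | h
    · simp [RMat_swap h.ne, h.ne, h.not_gt, RMat_same h.ne']
    · exact absurd ⟨rfl, rfl⟩ h1
    · simp [RMat_swap h.ne', h.ne', h, RMat_same h.ne]
  · rw [RMat_eq_zero h1 h2, RMat_eq_zero (i := i) (j := p) (fun h => h2 h.symm) fun h => h1 h.symm,
      if_neg (show ¬ (i = c ∧ p = y) from fun h => h2 ⟨h.2, h.1⟩)]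
    ring

variable (hs : s ^ N = q)

/-- The definition of φ produces four R-matrices. The two middle ones are contracted with each other
and are replaced by the Hecke relation. -/
theorem phi_wElem_add (J : Matrix (Fin N) (Fin N) ℂ) (m n i j : Fin N) :
    phi (OSL.rForm hs) (OSL.gen N q) m n (wElem (OSL.gen N q) (OSL.gen N q) J i j) =
      (s⁻¹) ^ 4 * ∑ x, ∑ b, RMat (q : ℂ) m j x b * ∑ c, ∑ d, ∑ y, J c d * RMat (q : ℂ) b y d n *
        ((if i = c ∧ x = y then 1 else 0) + ((q : ℂ) - (q : ℂ)⁻¹) * RMat (q : ℂ) x i c y) -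
      (if m = n then J i j else 0) := by
  have hr := OSL.isUniversalRForm (q := q) hs
  have hU := OSL.isCorep_gen (N := N) (q := q)
  have h1 : ∀ l a b, OSL.rForm hs (OSL.gen N q m l) (OSL.gen N q i a * OSL.gen N q j b) =
      ∑ x, s⁻¹ * RMat (q : ℂ) m j x b * (s⁻¹ * RMat (q : ℂ) x i l a) := by
    intro l a b
    rw [hr.mul_right, conv_corep_right hU]
    simp only [LinearMap.flip_apply, OSL.rForm_gen]
  have h2 : ∀ a b l, OSL.rForm hs (wElem (OSL.gen N q) (OSL.gen N q) J a b) (OSL.gen N q l n) =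
      ∑ c, ∑ d, J c d * ∑ y, s⁻¹ * RMat (q : ℂ) a l c y * (s⁻¹ * RMat (q : ℂ) b y d n) := by
    intro a b l
    simp only [wElem, map_sum, map_smul, LinearMap.sum_apply, LinearMap.smul_apply, hr.mul_left,
      conv_corep_right hU, OSL.rForm_gen, smul_eq_mul]
  simp only [phi, LinearMap.sub_apply, LinearMap.sum_apply, LinearMap.smul_apply,
    conv_of_comul (comul_wElem hU hU i j), LinearMap.flip_apply, h1, h2, counit_wElem hU hU,
    smul_eq_mul, ite_mul, one_mul, zero_mul, Fintype.sum_prod_type]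
  congr 1
  simp only [← sum_RMat_mul_RMat q.ne_zero]
  simp only [Finset.mul_sum, Finset.sum_mul, ← Fintype.sum_prod_type']
  exact Fintype.sum_equiv
    { toFun := fun ⟨l, a, b, ⟨c, d, y⟩, x⟩ => (x, b, c, d, y, l, a)
      invFun := fun ⟨x, b, c, d, y, l, a⟩ => (l, a, b, ⟨c, d, y⟩, x)
      left_inv := fun _ => rfl
      right_inv := fun _ => rfl } _ _ fun ⟨l, a, b, ⟨c, d, y⟩, x⟩ => by
        simp only [Equiv.coe_fn_mk]; ring

/-- `φ^{mn}(w^{ij})` for a monomial matrix `J`. -/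
theorem phi_wElem {J : Matrix (Fin N) (Fin N) ℂ}
    (hJ : ∀ c d, J c d = if d = τ c then κ c else 0) (m n i j : Fin N) :
    phi (OSL.rForm hs) (OSL.gen N q) m n (wElem (OSL.gen N q) (OSL.gen N q) J i j) =
      (s⁻¹) ^ 4 * (κ i * ((if j = τ i ∧ m = n then 1 else 0) +
          ((q : ℂ) - (q : ℂ)⁻¹) * RMat (q : ℂ) m j (τ i) n) +
        ((q : ℂ) - (q : ℂ)⁻¹) *
          ((if m = j then (q : ℂ) else 1) *
              ((if m = i then (q : ℂ) else 1) * (κ m * RMat (q : ℂ) j i (τ m) n) +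
                (if i < m then (q : ℂ) - (q : ℂ)⁻¹ else 0) * (κ i * RMat (q : ℂ) j m (τ i) n)) +
            (if j < m then (q : ℂ) - (q : ℂ)⁻¹ else 0) *
              ((if j = i then (q : ℂ) else 1) * (κ j * RMat (q : ℂ) m i (τ j) n) +
                (if i < j then (q : ℂ) - (q : ℂ)⁻¹ else 0) * (κ i * RMat (q : ℂ) m j (τ i) n)))) -
      (if j = τ i ∧ m = n then κ i else 0) := by
  -- The identity term of the Hecke relation brings the two outer R-matrices together, where the
  -- relation applies once more. In the other term a contraction with R has at most two summands, so
  -- it can be written out.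
  have e1 : ∑ x, ∑ b, RMat (q : ℂ) m j x b * ∑ c, ∑ d, ∑ y, J c d * RMat (q : ℂ) b y d n *
        ((if i = c ∧ x = y then 1 else 0) + ((q : ℂ) - (q : ℂ)⁻¹) * RMat (q : ℂ) x i c y) =
      κ i * (∑ x, ∑ b, RMat (q : ℂ) m j x b * RMat (q : ℂ) b x (τ i) n) +
        ((q : ℂ) - (q : ℂ)⁻¹) * ∑ x, ∑ b, RMat (q : ℂ) m j x b *
          ∑ c, ∑ y, RMat (q : ℂ) x i c y * (κ c * RMat (q : ℂ) b y (τ c) n) := by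
    simp only [Finset.mul_sum (a := κ i), Finset.mul_sum (a := (q : ℂ) - (q : ℂ)⁻¹),
      ← Finset.sum_add_distrib]
    refine Finset.sum_congr rfl fun x _ => Finset.sum_congr rfl fun b _ => ?_
    have e2 : ∀ c, ∑ d, ∑ y, J c d * RMat (q : ℂ) b y d n *
        ((if i = c ∧ x = y then 1 else 0) + ((q : ℂ) - (q : ℂ)⁻¹) * RMat (q : ℂ) x i c y) =
        (if i = c then κ i * RMat (q : ℂ) b x (τ i) n else 0) +
          ((q : ℂ) - (q : ℂ)⁻¹) * ∑ y, RMat (q : ℂ) x i c y * (κ c * RMat (q : ℂ) b y (τ c) n) := by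
      intro c
      rw [Finset.sum_eq_single (τ c)]
      · simp only [hJ, if_true, mul_add, Finset.sum_add_distrib]
        congr 1
        · by_cases h : i = c
          · subst h; simp
          · simp [h]
        · rw [Finset.mul_sum]
          exact Finset.sum_congr rfl fun y _ => by ring
      · intro d _ hd
        simp [hJ, hd]
      · simp
    simp only [e2, Finset.sum_add_distrib, Finset.sum_ite_eq, Finset.mem_univ, if_true,
      ← Finset.mul_sum]
    ring
  rw [phi_wElem_add, e1, sum_RMat_mul_RMat q.ne_zero, hJ,
    mul_sum_RMat m j fun x b => ∑ c, ∑ y, RMat (q : ℂ) x i c y * (κ c * RMat (q : ℂ) b y (τ c) n),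
    mul_sum_RMat m i fun c y => κ c * RMat (q : ℂ) j y (τ c) n,
    mul_sum_RMat j i fun c y => κ c * RMat (q : ℂ) m y (τ c) n]
  congr 1
  rw [ite_and]
  split_ifs <;> rfl

/-- J has one nonzero entry in each row considered and, τ being an involution, in each column
considered; this removes two of the four sums. The others are contractions with R, of two terms
each, and the hypothesis is the equation so obtained without its factor s⁻². -/
theorem reflectionEquation_of_monomial {J : Matrix (Fin N) (Fin N) ℂ} (hτ : ∀ i, τ (τ i) = i)
    (hJ : ∀ c d, J c d = if d = τ c then κ c else 0)
    (h : ∀ i j k l,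
      (if j = i then (q : ℂ) else 1) * (κ j * κ (τ l) * RMat (q : ℂ) k i (τ j) (τ l)) +
        (if i < j then (q : ℂ) - (q : ℂ)⁻¹ else 0) * (κ i * κ (τ l) * RMat (q : ℂ) k j (τ i) (τ l)) =
      (if l = k then (q : ℂ) else 1) * (κ i * κ (τ k) * RMat (q : ℂ) l j (τ i) (τ k)) +
        (if k < l then (q : ℂ) - (q : ℂ)⁻¹ else 0) * (κ i * κ (τ l) * RMat (q : ℂ) k j (τ i) (τ l))) :
    ReflectionEquation (OSL.rForm hs) (OSL.gen N q) (OSL.gen N q) J := by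
  intro i j k l
  have hJ' : ∀ c d, J c d = if c = τ d then κ (τ d) else 0 := by
    intro c d
    rw [hJ]
    by_cases hcd : c = τ d
    · subst hcd; simp [hτ]
    · rw [if_neg hcd, if_neg]
      rintro rfl
      exact hcd (hτ c).symm
  have e1 : ∀ a b, ∑ c, ∑ d, s⁻¹ * RMat (q : ℂ) j i a b * J a c * (s⁻¹ * RMat (q : ℂ) k b c d) * J d l =
      (s⁻¹) ^ 2 * (RMat (q : ℂ) j i a b * (κ a * κ (τ l) * RMat (q : ℂ) k b (τ a) (τ l))) := by
    intro a b
    simp only [hJ a, hJ' _ l, mul_ite, ite_mul, mul_zero, zero_mul, Finset.sum_ite_eq',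
      Finset.mem_univ, if_true]
    ring
  have e2 : ∀ c d, ∑ a, ∑ b, J i a * (s⁻¹ * RMat (q : ℂ) c j a b) * J b d * (s⁻¹ * RMat (q : ℂ) l k c d) =
      (s⁻¹) ^ 2 * (RMat (q : ℂ) l k c d * (κ i * κ (τ d) * RMat (q : ℂ) c j (τ i) (τ d))) := by
    intro c d
    simp only [hJ i, hJ' _ d, mul_ite, ite_mul, mul_zero, zero_mul, Finset.sum_ite_eq',
      Finset.mem_univ, if_true]
    ring
  simp only [OSL.rForm_gen, e1]
  have e3 : ∑ a, ∑ b, ∑ c, ∑ d, J i a * (s⁻¹ * RMat (q : ℂ) c j a b) * J b d * (s⁻¹ * RMat (q : ℂ) l k c d) =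
      ∑ c, ∑ d, ∑ a, ∑ b, J i a * (s⁻¹ * RMat (q : ℂ) c j a b) * J b d * (s⁻¹ * RMat (q : ℂ) l k c d) := by
    simp only [← Fintype.sum_prod_type']
    exact Fintype.sum_equiv
      { toFun := fun ⟨a, b, c, d⟩ => (c, d, a, b)
        invFun := fun ⟨c, d, a, b⟩ => (a, b, c, d)
        left_inv := fun _ => rfl
        right_inv := fun _ => rfl } _ _ fun ⟨a, b, c, d⟩ => by
          simp only [Equiv.coe_fn_mk]
  rw [e3]
  simp only [e2, ← Finset.mul_sum]
  rw [mul_sum_RMat j i fun a b => κ a * κ (τ l) * RMat (q : ℂ) k b (τ a) (τ l),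
    mul_sum_RMat l k fun c d => κ i * κ (τ d) * RMat (q : ℂ) c j (τ i) (τ d), h]

end Monomial

/-! ### Gram matrix entries and the shape of the criterion -/

section Common

variable {N : ℕ} {q : ℂˣ} {s : ℂ} {τ : Fin N → Fin N} {κ : Fin N → ℂ}

theorem wElem_of_monomial {H : Type u} [Ring H] [HopfAlgebra ℂ H] (U V : Matrix (Fin N) (Fin N) H)
    {J : Matrix (Fin N) (Fin N) ℂ} (hJ : ∀ c d, J c d = if d = τ c then κ c else 0) (i j : Fin N) :
    wElem U V J i j = ∑ k, κ k • (U i k * V j (τ k)) := by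
  simp [wElem, hJ]

/-- In the column n of J only the row τ n can be nonzero, so the sum over φ^{mp} J^{pn} has one
term. -/
theorem reducedForm_splitElem_of_monomial (hs : s ^ N = q) {J : Matrix (Fin N) (Fin N) ℂ}
    (hτ : ∀ i, τ (τ i) = i) (hJ : ∀ c d, J c d = if d = τ c then κ c else 0)
    (hR : ReflectionEquation (OSL.rForm hs) (OSL.gen N q) (OSL.gen N q) J)
    (h : OSL N q →ₗ[ℂ] ℂ) (m n i j : Fin N) :
    reducedForm (OSL.rForm hs) (splitElem (OSL.gen N q) (OSL.gen N q) J h (m, n))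
      (splitElem (OSL.gen N q) (OSL.gen N q) J h (i, j)) =
      κ (τ n) * phi (OSL.rForm hs) (OSL.gen N q) m (τ n)
        (wElem (OSL.gen N q) (OSL.gen N q) J i j) := by
  have hr := OSL.isUniversalRForm (q := q) hs
  have hU := OSL.isCorep_gen (N := N) (q := q)
  rw [reducedForm_splitElem hr, reducedForm_wElem hr hU hU hR, Finset.sum_eq_single (τ n)]
  · simp [hJ, hτ]
  · intro p _ hp
    rw [hJ, if_neg, zero_mul]
    rintro rfl
    exact hp (hτ p).symm
  · simp

theorem RMat_cross {q : ℂ} {i j : Fin N} (h : i ≠ j) : RMat q i i j j = 0 :=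
  RMat_eq_zero (fun h' => h h'.1) fun h' => h h'.1

/-- Shifts the sum of the criterion, which starts at i = 1, to the geometric sum of the determinant,
which starts at 0. -/
theorem mul_sum_Icc_zpow {x : ℂ} (hx : x ≠ 0) (e n : ℕ) :
    x ^ e * ∑ i ∈ Finset.Icc 1 n, x ^ (-(e : ℤ) * (i : ℤ)) =
      ∑ i ∈ Finset.range n, ((x ^ e)⁻¹) ^ i := by
  induction n with
  | zero => simp
  | succ n ih =>
    rw [Finset.sum_Icc_succ_top (by omega), mul_add, ih, Finset.sum_range_succ]
    congr 1
    have h1 : -(e : ℤ) * ((n + 1 : ℕ) : ℤ) = -((e * n + e : ℕ) : ℤ) := by push_cast; ring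
    rw [h1, zpow_neg, zpow_natCast, pow_add, pow_mul, inv_pow]
    field_simp

/-- With α = s⁻⁴ - 1 and β = s⁻⁴ y, one has β + α S = s⁻⁴ (y - (s⁴ - 1) S). -/
theorem criterion_iff {s : ℂ} (hs : s ≠ 0) (y S : ℂ) :
    (s⁻¹ ^ 4 * y ≠ 0 ∧ s⁻¹ ^ 4 * y + (s⁻¹ ^ 4 - 1) * S ≠ 0) ↔ (s ^ 4 - 1) * S ≠ y ∧ y ≠ 0 := by
  have h4 : s⁻¹ ^ 4 ≠ 0 := pow_ne_zero _ (inv_ne_zero hs)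
  have h5 : s⁻¹ ^ 4 * s ^ 4 = 1 := by rw [← mul_pow, inv_mul_cancel₀ hs, one_pow]
  have e : s⁻¹ ^ 4 * y + (s⁻¹ ^ 4 - 1) * S = s⁻¹ ^ 4 * (y - (s ^ 4 - 1) * S) := by
    linear_combination S * h5
  rw [e, mul_ne_zero_iff, mul_ne_zero_iff, sub_ne_zero]
  constructor
  · rintro ⟨⟨_, h1⟩, _, h2⟩
    exact ⟨h2.symm, h1⟩
  · rintro ⟨h1, h2⟩
    exact ⟨⟨h4, h2⟩, h4, h1.symm⟩

end Common

/-! ### The case SU(N)/SO(N) -/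

section Symmetric

variable {N : ℕ} {q : ℂˣ} {s : ℂ} {a : Fin N → ℂ}

theorem diagonal_eq_monomial (a : Fin N → ℂ) (c d : Fin N) :
    Matrix.diagonal a c d = if d = id c then a c else 0 := by
  simp [Matrix.diagonal_apply, eq_comm]

/-- An R-matrix entry vanishes unless its upper and lower indices agree as unordered pairs, so all
terms vanish unless i, j, k, l match in one of three pairings. -/
theorem reflectionEquation_diagonal (hs : s ^ N = q) (a : Fin N → ℂ) :
    ReflectionEquation (OSL.rForm hs) (OSL.gen N q) (OSL.gen N q) (Matrix.diagonal a) := by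
  refine reflectionEquation_of_monomial hs (fun _ => rfl) (diagonal_eq_monomial a) fun i j k l => ?_
  simp only [id]
  by_cases h1 : k = j ∧ i = l
  · obtain ⟨rfl, rfl⟩ := h1
    rcases eq_or_ne i k with rfl | h
    · simp [RMat_diag]
    · simp [RMat_same h.symm, RMat_cross h.symm, RMat_same h, h, h.symm, mul_comm]
  by_cases h2 : k = i ∧ j = l
  · obtain ⟨rfl, rfl⟩ := h2
    rcases eq_or_ne j k with rfl | h
    · simp [RMat_diag]
    · simp [RMat_same h.symm, RMat_cross h, RMat_cross h.symm, h]
  by_cases h3 : i = j ∧ k = l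
  · obtain ⟨rfl, rfl⟩ := h3
    rcases eq_or_ne i k with rfl | h
    · simp [RMat_diag]
    · simp [RMat_swap h.symm, mul_comm, mul_assoc]
  rw [RMat_eq_zero (i := k) (j := i) (k := j) (l := l), RMat_eq_zero (i := k) (j := j) (k := i) (l := l),
    RMat_eq_zero (i := l) (j := j) (k := i) (l := k)]
  · simp
  all_goals (try simp only [Fin.ext_iff] at *); omega

/-- If w^{ij} were a scalar, lowering j step by step would give w^{ii} = 0, contradicting ε(w^{ii})
= a_i ≠ 0. If w^{ii} itself is a scalar, a torus element of weight 4 shows that it is zero. -/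
theorem wElem_diagonal_ne_smul_one (hN : 2 ≤ N) (ha : ∀ i, a i ≠ 0) :
    ∀ i j : Fin N, i ≤ j → ∀ z : ℂ,
      wElem (OSL.gen N q) (OSL.gen N q) (Matrix.diagonal a) i j ≠ z • 1 := by
  intro i j hij
  induction h : j.val - i.val using Nat.strong_induction_on generalizing j with
  | _ d ih =>
    intro z hz
    rcases hij.eq_or_lt with rfl | hlt
    · obtain ⟨k, hk⟩ : ∃ k : Fin N, k ≠ i := by
        have : Nontrivial (Fin N) := Fin.nontrivial_iff_two_le.2 hN
        exact exists_ne i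
      have ht : ∏ b, (if b = i then (2 : ℂ) else 1) * (if b = k then 2⁻¹ else 1) = 1 := by
        rw [Finset.prod_mul_distrib]
        simp
      have h0 := wElem_eq_zero_of_torus ht (by norm_num [hk.symm]) hz
      have h1 := counit_wElem (J := Matrix.diagonal a) (OSL.isCorep_gen (N := N) (q := q)) OSL.isCorep_gen i i
      rw [h0, map_zero, Matrix.diagonal_apply_eq] at h1
      exact ha i h1.symm
    · have hlt' := Fin.lt_def.1 hlt
      let m' : Fin N := ⟨j.val - 1, by have := j.2; omega⟩
      have hm : m'.val + 1 = j.val := by simp only [m']; omega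
      have h0 := wElem_lower_right hm hlt.ne hz
      exact ih _ (by omega) m' (Fin.le_def.2 (by omega)) rfl 0 (by rw [h0, zero_smul])

/-- For diagonal J both factors of each summand come from the same column, where the generators
q-commute. -/
theorem wElem_diagonal_swap {i j : Fin N} (h : i < j) :
    wElem (OSL.gen N q) (OSL.gen N q) (Matrix.diagonal a) j i =
      (q : ℂ)⁻¹ • wElem (OSL.gen N q) (OSL.gen N q) (Matrix.diagonal a) i j := by
  simp only [wElem_of_monomial _ _ (diagonal_eq_monomial a), id, Finset.smul_sum]
  refine Finset.sum_congr rfl fun k _ => ?_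
  have := (OSL.isQuantumSL_gen (N := N) (q := q)).frt.transpose.same_row q.ne_zero k h
  simp only [Matrix.transpose_apply] at this
  rw [this, smul_smul, smul_smul, mul_right_comm, inv_mul_cancel₀ q.ne_zero, one_mul]

theorem span_splitElem_diagonal (h : OSL N q →ₗ[ℂ] ℂ) :
    Submodule.span ℂ (Set.range fun p : {p : Fin N × Fin N // p.1 ≤ p.2} =>
      splitElem (OSL.gen N q) (OSL.gen N q) (Matrix.diagonal a) h p) =
      splitOff h (wSpan (OSL.gen N q) (OSL.gen N q) (Matrix.diagonal a)) := by
  rw [← span_splitElem]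
  apply le_antisymm
  · apply Submodule.span_mono
    rintro _ ⟨p, rfl⟩
    exact ⟨p, rfl⟩
  · rw [Submodule.span_le]
    rintro _ ⟨⟨i, j⟩, rfl⟩
    rcases le_or_gt i j with hij | hij
    · exact Submodule.subset_span ⟨⟨(i, j), hij⟩, rfl⟩
    · have : splitElem (OSL.gen N q) (OSL.gen N q) (Matrix.diagonal a) h (i, j) =
          (q : ℂ)⁻¹ • splitElem (OSL.gen N q) (OSL.gen N q) (Matrix.diagonal a) h (j, i) := by
        simp only [splitElem, wElem_diagonal_swap hij, map_smul, smul_sub, smul_assoc]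
      rw [SetLike.mem_coe, this]
      exact Submodule.smul_mem _ _ (Submodule.subset_span ⟨⟨(j, i), hij.le⟩, rfl⟩)

/-- Every R-matrix entry in `phi_wElem` requires {i, j} = {m, n} or m = n; the orders m < n and i ≤
j exclude the transposed match. -/
theorem phi_diagonal_eq_zero (hs : s ^ N = q) {m n i j : Fin N} (hm : m < n) (hij : i ≤ j)
    (h : ¬ (i = m ∧ j = n)) : phi (OSL.rForm hs) (OSL.gen N q) m n
      (wElem (OSL.gen N q) (OSL.gen N q) (Matrix.diagonal a) i j) = 0 := by
  rw [phi_wElem hs (diagonal_eq_monomial a)]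
  simp only [id]
  rw [RMat_eq_zero (i := m) (j := j) (k := i) (l := n), RMat_eq_zero (i := j) (j := i) (k := m) (l := n),
    RMat_eq_zero (i := j) (j := m) (k := i) (l := n), RMat_eq_zero (i := m) (j := i) (k := j) (l := n)]
  · simp [hm.ne]
  all_goals (try simp only [Fin.ext_iff, Fin.lt_def, Fin.le_def] at *); omega

theorem phi_diagonal_lt (hs : s ^ N = q) {m n : Fin N} (hm : m < n) :
    phi (OSL.rForm hs) (OSL.gen N q) m n
      (wElem (OSL.gen N q) (OSL.gen N q) (Matrix.diagonal a) m n) =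
      s⁻¹ ^ 4 * ((q : ℂ) - (q : ℂ)⁻¹) * (q : ℂ) ^ 2 * a m := by
  have hqq : (q : ℂ) * (q : ℂ)⁻¹ = 1 := mul_inv_cancel₀ q.ne_zero
  rw [phi_wElem hs (diagonal_eq_monomial a)]
  simp only [id, RMat_same hm.ne, RMat_swap hm.ne', hm, hm.ne, hm.ne', hm.not_gt, if_true, if_false,
    lt_irrefl, and_self]
  linear_combination (-s⁻¹ ^ 4 * ((q : ℂ) - (q : ℂ)⁻¹) * a m) * hqq

/-- The form α + β L with t = q⁻² that `isUnit_det_of_blocks` requires. -/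
theorem phi_diagonal_eq (hs : s ^ N = q) (m i : Fin N) :
    phi (OSL.rForm hs) (OSL.gen N q) m m
      (wElem (OSL.gen N q) (OSL.gen N q) (Matrix.diagonal a) i i) =
      (s⁻¹ ^ 4 - 1 + s⁻¹ ^ 4 * ((q : ℂ) ^ 4 - 1) * ((if m = i then 1 else 0) +
        if i < m then 1 - ((q : ℂ) ^ 2)⁻¹ else 0)) * a i := by
  rw [phi_wElem hs (diagonal_eq_monomial a)]
  simp only [id]
  have hq := q.ne_zero
  rcases lt_trichotomy m i with h | rfl | h
  · simp only [RMat_swap h.ne, RMat_eq_zero (i := i) (j := i) (k := m) (l := m) (by simp [h.ne'])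
      (by simp [h.ne']), h.ne, h.not_gt, if_true, if_false, and_self]
    ring
  · simp only [RMat_diag, lt_irrefl, if_true, if_false, and_self]
    field_simp
    ring
  · simp only [RMat_swap h.ne', RMat_same h.ne, RMat_eq_zero (i := i) (j := i) (k := m) (l := m) (by simp [h.ne])
      (by simp [h.ne]), h, h.ne', lt_irrefl, if_true, if_false, and_self]
    field_simp
    ring

/-- In the basis indexed by i ≤ j a row (m, n) with m < n has no entry outside the diagonal, so the
Gram matrix is block triangular and the pairs (i, i) decide. -/
theorem isUnit_chiMatrix_diagonal (hs : s ^ N = q) (hN : 2 ≤ N) (ha : ∀ i, a i ≠ 0)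
    {h : OSL N q →ₗ[ℂ] ℂ}
    (hh : IsHaarOn (wSpan (OSL.gen N q) (OSL.gen N q) (Matrix.diagonal a)) h) {M : ℕ}
    {e : Fin M → OSL N q}
    (he : IsBasisOf e (splitOff h (wSpan (OSL.gen N q) (OSL.gen N q) (Matrix.diagonal a)))) :
    M = N * (N + 1) / 2 ∧ (IsUnit (chiMatrix (OSL.rForm hs) e).det ↔
      (s ^ 4 - 1) * (q : ℂ) ^ 2 * ∑ i ∈ Finset.Icc 1 N, (q : ℂ) ^ (-2 * (i : ℤ)) ≠ (q : ℂ) ^ 4 - 1 ∧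
        (q : ℂ) ^ 4 - 1 ≠ 0) := by
  have hR := reflectionEquation_diagonal hs a
  have hs0 : s ≠ 0 := by
    rintro rfl
    rw [zero_pow (by omega)] at hs
    exact q.ne_zero hs.symm
  obtain ⟨hM, hu⟩ := he.card_eq_and_isUnit_iff (r := OSL.rForm hs)
    (linearIndependent_splitElem hh (Q := fun p => p.1 ≤ p.2) (fun _ h => h)
      fun p hp => wElem_diagonal_ne_smul_one hN ha p.1 p.2 hp) (span_splitElem_diagonal h)
  refine ⟨hM.trans (card_le N), hu.trans ?_⟩
  have hX : ∀ m n i j, reducedForm (OSL.rForm hs)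
      (splitElem (OSL.gen N q) (OSL.gen N q) (Matrix.diagonal a) h (m, n))
      (splitElem (OSL.gen N q) (OSL.gen N q) (Matrix.diagonal a) h (i, j)) =
      a n * phi (OSL.rForm hs) (OSL.gen N q) m n
        (wElem (OSL.gen N q) (OSL.gen N q) (Matrix.diagonal a) i j) :=
    reducedForm_splitElem_of_monomial hs (fun _ => rfl) (diagonal_eq_monomial a) hR h
  have key := isUnit_det_of_blocks (K := ℂ)
    (Matrix.of fun x y : {p : Fin N × Fin N // p.1 ≤ p.2} => reducedForm (OSL.rForm hs)
      (splitElem (OSL.gen N q) (OSL.gen N q) (Matrix.diagonal a) h x)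
      (splitElem (OSL.gen N q) (OSL.gen N q) (Matrix.diagonal a) h y))
    (fun x => x.1.1 = x.1.2) (n := N)
    (by
      rintro ⟨⟨m, n⟩, hmn⟩ hne ⟨⟨i, j⟩, hij⟩ heq
      have hlt : m < n := lt_of_le_of_ne hmn hne
      have heq' : i = j := heq
      rw [Matrix.of_apply, hX, phi_diagonal_eq_zero hs hlt hij, mul_zero]
      rintro ⟨rfl, rfl⟩
      exact hlt.ne heq')
    hN
    { toFun := fun k => ⟨⟨(k, k), le_refl k⟩, rfl⟩
      invFun := fun x => x.1.1.1
      left_inv := fun _ => rfl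
      right_inv := by rintro ⟨⟨⟨m, n⟩, h1⟩, h2⟩; obtain rfl : m = n := h2; rfl }
    ha (α := s⁻¹ ^ 4 - 1) (β := s⁻¹ ^ 4 * ((q : ℂ) ^ 4 - 1)) (t := ((q : ℂ) ^ 2)⁻¹)
    (by
      intro k l
      rw [Matrix.of_apply]
      refine (hX k k l l).trans ?_
      rw [phi_diagonal_eq]
      ring)
    (by
      intro hβ
      -- β ≠ 0 gives q⁴ ≠ 1, hence q² ≠ 1, and the diagonal entries of the second block do not
      -- vanish.
      have hqi : (q : ℂ) - (q : ℂ)⁻¹ ≠ 0 := by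
        intro h0
        apply hβ
        have h1 : (q : ℂ) ^ 2 = 1 := by
          have := congrArg (· * (q : ℂ)) h0
          simp only [sub_mul, inv_mul_cancel₀ q.ne_zero, zero_mul] at this
          linear_combination this
        rw [show (q : ℂ) ^ 4 = ((q : ℂ) ^ 2) ^ 2 by ring, h1]
        simp
      refine isUnit_det_monomial _ (Equiv.refl _)
        (d := fun x => a x.1.1.2 * (s⁻¹ ^ 4 * ((q : ℂ) - (q : ℂ)⁻¹) * (q : ℂ) ^ 2 * a x.1.1.1)) ?_ ?_
      · intro x
        exact mul_ne_zero (ha _) (mul_ne_zero (mul_ne_zero (mul_ne_zero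
          (pow_ne_zero _ (inv_ne_zero hs0)) hqi) (pow_ne_zero _ q.ne_zero)) (ha _))
      · rintro ⟨⟨⟨m, n⟩, h1⟩, h2⟩ ⟨⟨⟨i, j⟩, h3⟩, h4⟩
        have hlt : m < n := lt_of_le_of_ne h1 h2
        refine (hX m n i j).trans ?_
        split_ifs with hc
        · simp only [Equiv.refl_apply, Subtype.mk.injEq, Prod.mk.injEq] at hc
          obtain ⟨rfl, rfl⟩ := hc
          rw [phi_diagonal_lt hs hlt]
        · rw [phi_diagonal_eq_zero hs hlt h3, mul_zero]
          rintro ⟨rfl, rfl⟩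
          exact hc rfl)
  rw [key, ← mul_sum_Icc_zpow q.ne_zero 2 N, criterion_iff hs0, mul_assoc]
  rfl

end Symmetric

/-! ### The case SU(N)/Sp(N) -/

section Symplectic

variable {n : ℕ} {q : ℂˣ} {s : ℂ} {a : Fin n → ℂ}

/-- The involution that exchanges `2k` and `2k + 1`. -/
def spPair (i : Fin (2 * n)) : Fin (2 * n) := ⟨4 * (i.val / 2) + 1 - i.val, by omega⟩

/-- The nonzero entries of `spJ`. -/
def spCoef (q : ℂˣ) (a : Fin n → ℂ) (i : Fin (2 * n)) : ℂ :=
  if i.val % 2 = 0 then a ⟨i.val / 2, by omega⟩ else -q * a ⟨i.val / 2, by omega⟩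

theorem spPair_spPair (i : Fin (2 * n)) : spPair (spPair i) = i := by
  simp only [spPair, Fin.ext_iff]
  omega

theorem spPair_ne (i : Fin (2 * n)) : spPair i ≠ i := by
  simp only [spPair, ne_eq, Fin.ext_iff]
  omega

theorem spPair_eq_iff {i j : Fin (2 * n)} : spPair i = j ↔ i = spPair j :=
  ⟨fun h => by rw [← h, spPair_spPair], fun h => by rw [h, spPair_spPair]⟩

theorem spPair_inj {i j : Fin (2 * n)} : spPair i = spPair j ↔ i = j := by
  rw [spPair_eq_iff, spPair_spPair]

/-- The pairs {2k, 2k + 1} are intervals, so passing to the partner does not change the order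
relative to indices outside the pair. -/
theorem spPair_lt_iff {i j : Fin (2 * n)} (h : i ≠ j) (h' : i ≠ spPair j) : spPair i < j ↔ i < j := by
  simp only [spPair, ne_eq, Fin.ext_iff, Fin.lt_def] at *
  omega

theorem lt_spPair_iff {i j : Fin (2 * n)} (h : i ≠ j) (h' : i ≠ spPair j) : j < spPair i ↔ j < i := by
  simp only [spPair, ne_eq, Fin.ext_iff, Fin.lt_def] at *
  omega

theorem spCoef_ne_zero (ha : ∀ k, a k ≠ 0) (i : Fin (2 * n)) : spCoef q a i ≠ 0 := by
  simp only [spCoef]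
  split_ifs
  · exact ha _
  · exact mul_ne_zero (neg_ne_zero.2 q.ne_zero) (ha _)

theorem spCoef_spPair {i : Fin (2 * n)} (h : i < spPair i) :
    spCoef q a (spPair i) = -q * spCoef q a i := by
  simp only [spPair, Fin.lt_def] at h
  have h1 : i.val % 2 = 0 := by omega
  have h2 : (4 * (i.val / 2) + 1 - i.val) % 2 ≠ 0 := by omega
  have h3 : (4 * (i.val / 2) + 1 - i.val) / 2 = i.val / 2 := by omega
  simp only [spCoef, spPair, if_pos h1, if_neg h2, h3]

/-- The ratio of a coefficient to that of its partner is -q or -q⁻¹ according to the position in the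
pair; the correction term equalizes the two cases. -/
theorem spCoef_spPair_add (i : Fin (2 * n)) :
    spCoef q a (spPair i) + (if i < spPair i then (q : ℂ) - (q : ℂ)⁻¹ else 0) * spCoef q a i =
      -(q : ℂ)⁻¹ * spCoef q a i := by
  rcases lt_or_gt_of_ne (spPair_ne i) with h | h
  · have h1 := spCoef_spPair (q := q) (a := a) (i := spPair i) (by rwa [spPair_spPair])
    rw [spPair_spPair] at h1
    rw [if_neg h.not_gt, h1]
    have := inv_mul_cancel₀ q.ne_zero
    linear_combination (-spCoef q a (spPair i)) * this
  · rw [if_pos h, spCoef_spPair h]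
    ring

theorem spJ_apply (c d : Fin (2 * n)) :
    spJ n q a c d = if d = spPair c then spCoef q a c else 0 := by
  simp only [spJ, spPair, spCoef, Matrix.of_apply, Fin.ext_iff, Fin.lt_def]
  split_ifs <;> first | rfl | omega

theorem isUnit_det_spJ (ha : ∀ k, a k ≠ 0) : IsUnit (spJ n q a).det :=
  isUnit_det_monomial _ ⟨spPair, spPair, spPair_spPair, spPair_spPair⟩ (spCoef_ne_zero (q := q) ha)
    fun i j => by simp only [spJ_apply, Equiv.coe_fn_mk, eq_comm]

/-- As in the diagonal case there are three pairings of i, j, k, l outside which all terms vanish,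
now matching indices with partners. -/
theorem reflectionEquation_spJ (hs : s ^ (2 * n) = q) (a : Fin n → ℂ) :
    ReflectionEquation (OSL.rForm hs) (OSL.gen (2 * n) q) (OSL.gen (2 * n) q) (spJ n q a) := by
  refine reflectionEquation_of_monomial hs spPair_spPair spJ_apply fun i j k l => ?_
  -- Needed when all four indices lie in one pair, where different pairings overlap.
  have pair : ∀ i : Fin (2 * n),
      spCoef q a (spPair i) * spCoef q a (spPair i) *
          (if i < spPair i then (q : ℂ) - (q : ℂ)⁻¹ else 0) +
        (if i < spPair i then (q : ℂ) - (q : ℂ)⁻¹ else 0) *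
          (spCoef q a i * spCoef q a (spPair i) * q) = 0 := by
    intro i
    split_ifs with h
    · rw [spCoef_spPair h]; ring
    · simp
  by_cases h1 : k = spPair j ∧ l = spPair i
  · obtain ⟨rfl, rfl⟩ := h1
    rcases eq_or_ne i j with rfl | hij
    · simp [spPair_spPair, spPair_ne, RMat_same, mul_comm]
    rcases eq_or_ne i (spPair j) with rfl | hij'
    · simp [spPair_spPair, RMat_diag, RMat_swap (spPair_ne j), (spPair_ne _).symm, mul_comm]
    have hji : j ≠ spPair i := fun h => hij' (by rw [h, spPair_spPair])
    simp only [spPair_spPair]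
    rw [RMat_same hij'.symm, RMat_same hji.symm, RMat_eq_zero (i := spPair j) (j := j)
      (fun h => hij (spPair_inj.1 h.1).symm) fun h => hij'.symm h.1, if_neg hij.symm,
      if_neg (fun h => hij (spPair_inj.1 h))]
    ring
  by_cases h2 : k = spPair i ∧ l = spPair j
  · obtain ⟨rfl, rfl⟩ := h2
    simp only [spPair_spPair]
    rcases eq_or_ne i j with rfl | hij
    · simp
    rcases eq_or_ne i (spPair j) with rfl | hij'
    · have h1 := pair j
      have h2 := pair (spPair j)
      simp only [spPair_spPair] at h1 h2 ⊢
      rw [RMat_swap (spPair_ne j).symm, RMat_swap (spPair_ne j), if_neg hij.symm, if_neg hij,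
        RMat_diag]
      linear_combination h2 - h1
    have hji : j ≠ spPair i := fun h => hij' (by rw [h, spPair_spPair])
    have hlt : spPair i < spPair j ↔ i < j := by
      rw [spPair_lt_iff (fun h => hji (by rw [h, spPair_spPair])) (by rwa [spPair_spPair]),
        lt_spPair_iff hij.symm hji]
    rw [RMat_eq_zero (i := spPair i) (j := i) (fun h => hij (spPair_inj.1 h.1))
      fun h => hji h.1.symm, RMat_eq_zero (i := spPair j) (j := j)
      (fun h => hij (spPair_inj.1 h.1).symm) fun h => hij'.symm h.1]
    simp only [hlt]
    ring
  by_cases h3 : j = spPair i ∧ l = spPair k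
  · obtain ⟨rfl, rfl⟩ := h3
    simp only [spPair_spPair]
    rcases eq_or_ne i k with rfl | hik
    · simp [RMat_diag, RMat_swap (spPair_ne i).symm, spPair_ne, mul_comm]
    rcases eq_or_ne i (spPair k) with rfl | hik'
    · have h1 := pair k
      have h2 := pair (spPair k)
      simp only [spPair_spPair] at h1 h2 ⊢
      rw [RMat_swap (spPair_ne k).symm, RMat_swap (spPair_ne k), if_neg (spPair_ne k).symm,
        if_neg (spPair_ne k), RMat_diag]
      linear_combination h2 - h1
    have hki : k ≠ spPair i := fun h => hik' (by rw [h, spPair_spPair])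
    rw [RMat_swap hik.symm, RMat_swap hki, RMat_swap (fun h => hik (spPair_inj.1 h).symm),
      if_neg (spPair_ne i), if_neg (spPair_ne k)]
    have h1 := spCoef_spPair_add (q := q) (a := a) i
    have h2 := spCoef_spPair_add (q := q) (a := a) k
    simp only [spPair_lt_iff hik hik', spPair_lt_iff (j := spPair k) hik' (by rwa [spPair_spPair]),
      lt_spPair_iff hik.symm hki]
    rcases lt_or_gt_of_ne hik with h | h
    · simp only [if_pos h]
      linear_combination (((q : ℂ) - (q : ℂ)⁻¹) * spCoef q a k) * h1 -
        (((q : ℂ) - (q : ℂ)⁻¹) * spCoef q a i) * h2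
    · simp [h.not_gt]
  rw [RMat_eq_zero (i := k) (j := i), RMat_eq_zero (i := k) (j := j) (k := spPair i),
    RMat_eq_zero (i := l) (j := j)]
  · simp
  all_goals
    simp only [spPair, Fin.ext_iff] at h1 h2 h3 ⊢
    clear pair
    omega

/-- For even i, lowering j ends at the partner i + 1, where the counit of w is a nonzero entry of J.
For odd i the second index cannot descend to the partner, so the first index is lowered instead. -/
theorem wElem_spJ_ne_smul_one (hn : 2 ≤ n) (ha : ∀ k, a k ≠ 0) {i j : Fin (2 * n)} (hij : i < j)
    (z : ℂ) : wElem (OSL.gen (2 * n) q) (OSL.gen (2 * n) q) (spJ n q a) i j ≠ z • 1 := by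
  have even : ∀ i j : Fin (2 * n), i.val % 2 = 0 → i < j → ∀ z : ℂ,
      wElem (OSL.gen (2 * n) q) (OSL.gen (2 * n) q) (spJ n q a) i j ≠ z • 1 := by
    intro i j hi hij
    induction h : j.val - i.val using Nat.strong_induction_on generalizing j with
    | _ d ih =>
      intro z hz
      have hij' := Fin.lt_def.1 hij
      rcases eq_or_ne j (spPair i) with rfl | hj
      -- An index outside the pair, available since n ≥ 2, lets a torus element of determinant 1
      -- have weight 2 on w^{i,i+1}.
      · obtain ⟨k, hki, hkj⟩ : ∃ k : Fin (2 * n), i ≠ k ∧ spPair i ≠ k := by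
          refine ⟨⟨if i.val = 0 then 2 else 0, by split_ifs <;> omega⟩, ?_, ?_⟩ <;>
            simp only [spPair, ne_eq, Fin.ext_iff] <;> split_ifs <;> omega
        have ht : ∏ b, (if b = i then (2 : ℂ) else 1) * (if b = k then 2⁻¹ else 1) = 1 := by
          rw [Finset.prod_mul_distrib]
          simp
        have h0 := wElem_eq_zero_of_torus ht (by simp [hki, hkj, spPair_ne]) hz
        have h1 := counit_wElem (J := spJ n q a) (OSL.isCorep_gen (q := q)) OSL.isCorep_gen i
          (spPair i)
        rw [h0, map_zero, spJ_apply, if_pos rfl] at h1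
        exact spCoef_ne_zero ha i h1.symm
      · have hj' : j.val ≠ i.val + 1 := fun h => hj <| by
          simp only [spPair, Fin.ext_iff]
          omega
        let m' : Fin (2 * n) := ⟨j.val - 1, by have := j.2; omega⟩
        have hm : m'.val + 1 = j.val := by simp only [m']; omega
        have h0 := wElem_lower_right hm hij.ne hz
        exact ih _ (by omega) m' (Fin.lt_def.2 (by omega)) rfl 0 (by rw [h0, zero_smul])
  rcases Nat.mod_two_eq_zero_or_one i.val with hi | hi
  · exact even i j hi hij z
  · intro hz
    -- One lowering of the first index makes it even, and the result would have to vanish, contrary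
    -- to the even case.
    let m' : Fin (2 * n) := ⟨i.val - 1, by have := i.2; omega⟩
    have hm : m'.val + 1 = i.val := by simp only [m']; omega
    have h0 := wElem_lower_left hm hij.ne' hz
    rw [Fin.lt_def] at hij
    exact even m' j (by omega) (Fin.lt_def.2 (by omega)) 0 (by rw [h0, zero_smul])

theorem sum_eq_zero_of_spPair {B : Type*} [AddCommGroup B] (f : Fin (2 * n) → B)
    (h : ∀ k, k < spPair k → f k + f (spPair k) = 0) : ∑ k, f k = 0 := by
  refine Finset.sum_involution (fun k _ => spPair k) (fun k _ => ?_) (fun k _ _ => spPair_ne k)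
    (fun k _ => Finset.mem_univ _) fun k _ => spPair_spPair k
  rcases lt_or_gt_of_ne (spPair_ne k) with hk | hk
  · rw [add_comm]
    conv_lhs => rw [← spPair_spPair k, spPair_spPair (spPair k)]
    exact h _ (by rwa [spPair_spPair])
  · exact h k hk

/-- The two summands of a pair cancel: the generators in a row q-commute, and the coefficients have
ratio -q. -/
theorem wElem_spJ_self (i : Fin (2 * n)) :
    wElem (OSL.gen (2 * n) q) (OSL.gen (2 * n) q) (spJ n q a) i i = 0 := by
  rw [wElem_of_monomial _ _ spJ_apply]
  refine sum_eq_zero_of_spPair _ fun k hk => ?_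
  have h := (OSL.isQuantumSL_gen (N := 2 * n) (q := q)).frt.same_row q.ne_zero i hk
  rw [spPair_spPair, spCoef_spPair hk, h]
  module

/-- w^{ij} is a combination of quantum 2 × 2 minors in rows i, j, one for each pair of columns, and
each is multiplied by -q when its rows are exchanged. -/
theorem wElem_spJ_swap {i j : Fin (2 * n)} (h : i < j) :
    wElem (OSL.gen (2 * n) q) (OSL.gen (2 * n) q) (spJ n q a) j i =
      (-q : ℂ) • wElem (OSL.gen (2 * n) q) (OSL.gen (2 * n) q) (spJ n q a) i j := by
  rw [← sub_eq_zero, wElem_of_monomial _ _ spJ_apply, wElem_of_monomial _ _ spJ_apply,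
    Finset.smul_sum, ← Finset.sum_sub_distrib]
  refine sum_eq_zero_of_spPair _ fun k hk => ?_
  have hT := (OSL.isQuantumSL_gen (N := 2 * n) (q := q)).frt
  rw [spPair_spPair, spCoef_spPair hk, hT.comm h hk, hT.cross h hk]
  match_scalars
  · linear_combination (-spCoef q a k) * mul_inv_cancel₀ q.ne_zero
  · ring

theorem span_splitElem_spJ (h : OSL (2 * n) q →ₗ[ℂ] ℂ) :
    Submodule.span ℂ (Set.range fun p : {p : Fin (2 * n) × Fin (2 * n) // p.1 < p.2} =>
      splitElem (OSL.gen (2 * n) q) (OSL.gen (2 * n) q) (spJ n q a) h p) =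
      splitOff h (wSpan (OSL.gen (2 * n) q) (OSL.gen (2 * n) q) (spJ n q a)) := by
  rw [← span_splitElem]
  apply le_antisymm
  · apply Submodule.span_mono
    rintro _ ⟨p, rfl⟩
    exact ⟨p, rfl⟩
  · rw [Submodule.span_le]
    rintro _ ⟨⟨i, j⟩, rfl⟩
    rcases lt_trichotomy i j with hij | rfl | hij
    · exact Submodule.subset_span ⟨⟨(i, j), hij⟩, rfl⟩
    · simp only [splitElem, wElem_spJ_self, map_zero, zero_smul, sub_zero, SetLike.mem_coe,
        zero_mem]
    · have : splitElem (OSL.gen (2 * n) q) (OSL.gen (2 * n) q) (spJ n q a) h (i, j) =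
          (-q : ℂ) • splitElem (OSL.gen (2 * n) q) (OSL.gen (2 * n) q) (spJ n q a) h (j, i) := by
        simp only [splitElem, wElem_spJ_swap hij, map_smul, smul_sub, smul_assoc]
      rw [SetLike.mem_coe, this]
      exact Submodule.smul_mem _ _ (Submodule.subset_span ⟨⟨(j, i), hij⟩, rfl⟩)

/-- A row (m, k) of the Gram matrix whose indices are not partners has its only possible nonzero
entry in the column of the partners (m', k'). -/
theorem phi_spJ_eq_zero (hs : s ^ (2 * n) = q) {m k i j : Fin (2 * n)} (hm : m < k)
    (hk : k ≠ spPair m) (hij : i < j) (h : ¬ (i = spPair m ∧ j = spPair k)) :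
    phi (OSL.rForm hs) (OSL.gen (2 * n) q) m (spPair k)
      (wElem (OSL.gen (2 * n) q) (OSL.gen (2 * n) q) (spJ n q a) i j) = 0 := by
  have h1 : m ≠ spPair k := fun h => hk (by rw [h, spPair_spPair])
  rw [phi_wElem hs spJ_apply, RMat_eq_zero (i := m) (j := j) (k := spPair i),
    RMat_eq_zero (i := j) (j := i) (k := spPair m), RMat_eq_zero (i := j) (j := m) (k := spPair i),
    RMat_eq_zero (i := m) (j := i) (k := spPair j)]
  · simp [h1]
  all_goals
    simp only [spPair, ne_eq, Fin.ext_iff, Fin.lt_def] at hm hk hij h h1 ⊢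
    omega

theorem phi_spJ_pair (hs : s ^ (2 * n) = q) {m k : Fin (2 * n)} (hm : m < k)
    (hk : k ≠ spPair m) :
    phi (OSL.rForm hs) (OSL.gen (2 * n) q) m (spPair k)
      (wElem (OSL.gen (2 * n) q) (OSL.gen (2 * n) q) (spJ n q a) (spPair m) (spPair k)) =
      s⁻¹ ^ 4 * ((q : ℂ) - (q : ℂ)⁻¹) * ((q : ℂ)⁻¹) ^ 2 * spCoef q a (spPair m) := by
  have h1 : m ≠ spPair k := fun h => hk (by rw [h, spPair_spPair])
  have hmk : m < spPair k := (lt_spPair_iff hm.ne' hk).2 hm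
  have hlt : spPair m < spPair k := (spPair_lt_iff h1 (by rw [spPair_spPair]; exact hm.ne)).2 hmk
  have h2 := spCoef_spPair_add (q := q) (a := a) (spPair m)
  rw [spPair_spPair] at h2
  have hqq : (q : ℂ) * (q : ℂ)⁻¹ = 1 := mul_inv_cancel₀ q.ne_zero
  rw [phi_wElem hs spJ_apply]
  simp only [spPair_spPair, RMat_same h1, RMat_swap hlt.ne', RMat_swap h1.symm, h1, h1.symm, hmk,
    hmk.not_gt, hlt, (spPair_ne m).symm, if_true, if_false, and_false, zero_add, sub_zero, one_mul,
    zero_mul, add_zero]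
  linear_combination (s⁻¹ ^ 4 * ((q : ℂ) - (q : ℂ)⁻¹) ^ 2) * h2 -
    (s⁻¹ ^ 4 * ((q : ℂ) - (q : ℂ)⁻¹) * spCoef q a (spPair m)) * hqq

/-- Restricted to the first members of the pairs, this is the form α + β L with t = q⁻⁴. -/
theorem phi_spJ_eq (hs : s ^ (2 * n) = q) {m i : Fin (2 * n)} (hm : m < spPair m)
    (hi : i < spPair i) :
    phi (OSL.rForm hs) (OSL.gen (2 * n) q) m m
      (wElem (OSL.gen (2 * n) q) (OSL.gen (2 * n) q) (spJ n q a) i (spPair i)) =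
      (s⁻¹ ^ 4 - 1 + s⁻¹ ^ 4 * ((q : ℂ) ^ 2 - 1) * ((if m = i then 1 else 0) +
        if i < m then 1 - ((q : ℂ) ^ 4)⁻¹ else 0)) * spCoef q a i := by
  have hq := q.ne_zero
  rw [phi_wElem hs spJ_apply]
  rcases eq_or_ne m i with rfl | h
  · simp only [spPair_spPair, RMat_same (spPair_ne m), RMat_swap hm.ne, hm.not_gt, hm.ne, lt_irrefl,
      if_true, if_false, and_self]
    field_simp
    ring
  have h' : m ≠ spPair i := by
    simp only [spPair, ne_eq, Fin.ext_iff, Fin.lt_def] at h hm hi ⊢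
    omega
  have h2 : i ≠ spPair m := fun hh => h' (by rw [hh, spPair_spPair])
  rw [RMat_eq_zero (i := spPair i) (j := i) (k := spPair m) (fun hh => h (spPair_inj.1 hh.1).symm)
    fun hh => h'.symm hh.1, spPair_spPair, spCoef_spPair hi, RMat_swap h', RMat_same h'.symm,
    RMat_swap h]
  simp only [spPair_lt_iff h.symm h2, h, h', hi, hi.ne', if_true, if_false, and_self]
  split_ifs
  · field_simp
    ring
  · ring

/-- The Gram matrix in the basis i < j is block triangular: the n pairs of partners form the
deciding block, and the remaining rows form a monomial block. -/
theorem isUnit_chiMatrix_spJ (hs : s ^ (2 * n) = q) (hn : 2 ≤ n) (ha : ∀ k, a k ≠ 0)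
    {h : OSL (2 * n) q →ₗ[ℂ] ℂ}
    (hh : IsHaarOn (wSpan (OSL.gen (2 * n) q) (OSL.gen (2 * n) q) (spJ n q a)) h) {M : ℕ}
    {e : Fin M → OSL (2 * n) q}
    (he : IsBasisOf e (splitOff h (wSpan (OSL.gen (2 * n) q) (OSL.gen (2 * n) q) (spJ n q a)))) :
    M = 2 * n * (2 * n - 1) / 2 ∧ (IsUnit (chiMatrix (OSL.rForm hs) e).det ↔
      (s ^ 4 - 1) * (q : ℂ) ^ 4 * ∑ i ∈ Finset.Icc 1 n, (q : ℂ) ^ (-4 * (i : ℤ)) ≠ (q : ℂ) ^ 2 - 1 ∧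
        (q : ℂ) ^ 2 - 1 ≠ 0) := by
  have hR := reflectionEquation_spJ hs a
  have hs0 : s ≠ 0 := by
    rintro rfl
    rw [zero_pow (by omega)] at hs
    exact q.ne_zero hs.symm
  obtain ⟨hM, hu⟩ := he.card_eq_and_isUnit_iff (r := OSL.rForm hs)
    (linearIndependent_splitElem hh (Q := fun p => p.1 < p.2) (fun _ h => le_of_lt h)
      fun p hp => wElem_spJ_ne_smul_one hn ha hp) (span_splitElem_spJ h)
  refine ⟨hM.trans (card_lt _), hu.trans ?_⟩
  have hX : ∀ m k i j, reducedForm (OSL.rForm hs)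
      (splitElem (OSL.gen (2 * n) q) (OSL.gen (2 * n) q) (spJ n q a) h (m, k))
      (splitElem (OSL.gen (2 * n) q) (OSL.gen (2 * n) q) (spJ n q a) h (i, j)) =
      spCoef q a (spPair k) * phi (OSL.rForm hs) (OSL.gen (2 * n) q) m (spPair k)
        (wElem (OSL.gen (2 * n) q) (OSL.gen (2 * n) q) (spJ n q a) i j) :=
    reducedForm_splitElem_of_monomial hs spPair_spPair spJ_apply hR h
  have hlt : ∀ k : Fin n, (⟨2 * k.val, by omega⟩ : Fin (2 * n)) < spPair ⟨2 * k.val, by omega⟩ :=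
    fun k => by
      simp only [spPair, Fin.lt_def]
      omega
  have hswap : ∀ {m k : Fin (2 * n)}, m < k → k ≠ spPair m → spPair m < spPair k :=
    fun {m k} h1 h2 => by
      simp only [spPair, ne_eq, Fin.ext_iff, Fin.lt_def] at h1 h2 ⊢
      omega
  have hswap' : ∀ {m k : Fin (2 * n)}, k ≠ spPair m → spPair k ≠ spPair (spPair m) :=
    fun h1 h2 => h1 (spPair_inj.1 h2)
  have key := isUnit_det_of_blocks (K := ℂ)
    (Matrix.of fun x y : {p : Fin (2 * n) × Fin (2 * n) // p.1 < p.2} => reducedForm (OSL.rForm hs)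
      (splitElem (OSL.gen (2 * n) q) (OSL.gen (2 * n) q) (spJ n q a) h x)
      (splitElem (OSL.gen (2 * n) q) (OSL.gen (2 * n) q) (spJ n q a) h y))
    (fun x => x.1.2 = spPair x.1.1) (n := n)
    (by
      rintro ⟨⟨m, k⟩, hmk⟩ hne ⟨⟨i, j⟩, hij⟩ heq
      have heq' : j = spPair i := heq
      rw [Matrix.of_apply, hX, phi_spJ_eq_zero hs hmk hne hij, mul_zero]
      rintro ⟨rfl, rfl⟩
      rw [spPair_spPair] at heq'
      exact hne (spPair_eq_iff.1 heq'))
    hn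
    { toFun := fun k => ⟨⟨(⟨2 * k.val, by omega⟩, spPair ⟨2 * k.val, by omega⟩), hlt k⟩, rfl⟩
      invFun := fun x => ⟨x.1.1.1.val / 2, by omega⟩
      left_inv := fun k => by simp
      right_inv := by
        rintro ⟨⟨⟨m, k⟩, h1⟩, h2⟩
        obtain rfl : k = spPair m := h2
        have h3 : 2 * (m.val / 2) = m.val := by
          simp only [spPair, Fin.lt_def] at h1
          omega
        simp only [h3] }
    ha (α := s⁻¹ ^ 4 - 1) (β := s⁻¹ ^ 4 * ((q : ℂ) ^ 2 - 1)) (t := ((q : ℂ) ^ 4)⁻¹)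
    (by
      intro k l
      have hc : ∀ k : Fin n, spCoef q a ⟨2 * k.val, by omega⟩ = a k := fun k => by simp [spCoef]
      rw [Matrix.of_apply]
      refine (hX _ _ _ _).trans ?_
      rw [spPair_spPair, phi_spJ_eq hs (hlt k) (hlt l), hc, hc]
      simp only [Fin.ext_iff, Fin.lt_def, Nat.mul_left_cancel_iff two_pos,
        Nat.mul_lt_mul_left two_pos]
      ring)
    (by
      intro hβ
      have hqi : (q : ℂ) - (q : ℂ)⁻¹ ≠ 0 := by
        intro h0
        apply hβ
        have h1 : (q : ℂ) ^ 2 = 1 := by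
          have := congrArg (· * (q : ℂ)) h0
          simp only [sub_mul, inv_mul_cancel₀ q.ne_zero, zero_mul] at this
          linear_combination this
        simp [h1]
      -- The permutation replaces both indices by their partners; it preserves m < k because the two
      -- indices belong to different pairs.
      refine isUnit_det_monomial _
        ⟨fun x => ⟨⟨(spPair x.1.1.1, spPair x.1.1.2), hswap x.1.2 x.2⟩, hswap' x.2⟩,
          fun x => ⟨⟨(spPair x.1.1.1, spPair x.1.1.2), hswap x.1.2 x.2⟩, hswap' x.2⟩,
          fun x => by simp only [spPair_spPair], fun x => by simp only [spPair_spPair]⟩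
        (d := fun x => spCoef q a (spPair x.1.1.2) *
          (s⁻¹ ^ 4 * ((q : ℂ) - (q : ℂ)⁻¹) * ((q : ℂ)⁻¹) ^ 2 * spCoef q a (spPair x.1.1.1))) ?_ ?_
      · intro x
        exact mul_ne_zero (spCoef_ne_zero ha _) (mul_ne_zero (mul_ne_zero (mul_ne_zero
          (pow_ne_zero _ (inv_ne_zero hs0)) hqi) (pow_ne_zero _ (inv_ne_zero q.ne_zero)))
          (spCoef_ne_zero ha _))
      · rintro ⟨⟨⟨m, k⟩, h1⟩, h2⟩ ⟨⟨⟨i, j⟩, h3⟩, h4⟩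
        refine (hX m k i j).trans ?_
        split_ifs with hc
        · simp only [Equiv.coe_fn_mk, Subtype.mk.injEq, Prod.mk.injEq] at hc
          obtain ⟨rfl, rfl⟩ := hc
          rw [phi_spJ_pair hs h1 h2]
        · rw [phi_spJ_eq_zero hs h1 h2 h3, mul_zero]
          rintro ⟨rfl, rfl⟩
          exact hc rfl)
  rw [key, ← mul_sum_Icc_zpow q.ne_zero 4 n, criterion_iff hs0, mul_assoc]
  rfl

end Symplectic

end QSpace

end

/-! ### The three claims together -/

theorem mainTheorem4 :
    (∀ (H : Type u) [Ring H] [HopfAlgebra ℂ H] (r : H →ₗ[ℂ] H →ₗ[ℂ] ℂ)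
      (hr : QSpace.IsUniversalRForm r) (N : ℕ) (U V : Matrix (Fin N) (Fin N) H)
      (hU : QSpace.IsCorep U) (hV : QSpace.IsCorep V) (J : Matrix (Fin N) (Fin N) ℂ),
      IsUnit J.det → QSpace.ReflectionEquation r U V J →
      ∀ h : H →ₗ[ℂ] ℂ, QSpace.IsHaarOn (QSpace.wSpan U V J) h →
        QSpace.splitOff h (QSpace.wSpan U V J) ≤
          (QSpace.quantumSpace hr hU hV J).toSubmodule ∧
        ∀ (M : ℕ) (e : Fin M → QSpace.quantumSpace hr hU hV J) (π : Matrix (Fin M) (Fin M) H),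
          QSpace.IsBasisOf (fun i => (e i : H)) (QSpace.splitOff h (QSpace.wSpan U V J)) →
          (∀ i, Coalgebra.comul (R := ℂ) (e i : H) = ∑ j, π i j ⊗ₜ[ℂ] (e j : H)) →
          (IsUnit (QSpace.chiMatrix r fun i => (e i : H)).det ↔
            (QSpace.cMatrix r U V J).rank = M) ∧
          (IsUnit (QSpace.chiMatrix r fun i => (e i : H)).det →
            IsUnit (QSpace.phiMatrix r U).det →
            (∀ (Γ : QSpace.FODC.{u, w} (QSpace.quantumSpace hr hU hV J)) (Ω : QSpace.FODC.{u, w} H),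
              QSpace.IsConstructedCalculus r e π Γ → QSpace.IsStandardCalculus r U Ω →
              Γ.IsSubcalculus Ω) ∧
            ∀ (i j : Fin N) (a : QSpace.quantumSpace hr hU hV J),
              QSpace.partialH r U i j (a : H) =
                ∑ k, QSpace.partialX r (fun l => (e l : H)) π k (a : H) *
                  QSpace.partialH r U i j (e k : H))) ∧
    (∀ (N : ℕ) (q : ℂˣ) (s : ℂ) (hs : s ^ N = q) (a : Fin N → ℂ), 2 ≤ N → (∀ i, a i ≠ 0) →
      IsUnit (Matrix.diagonal a).det ∧
      QSpace.ReflectionEquation (QSpace.OSL.rForm hs) (QSpace.OSL.gen N q) (QSpace.OSL.gen N q)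
        (Matrix.diagonal a) ∧
      ∀ h : QSpace.OSL N q →ₗ[ℂ] ℂ,
        QSpace.IsHaarOn
          (QSpace.wSpan (QSpace.OSL.gen N q) (QSpace.OSL.gen N q) (Matrix.diagonal a)) h →
        ∀ (M : ℕ) (e : Fin M → QSpace.OSL N q),
          QSpace.IsBasisOf e (QSpace.splitOff h
            (QSpace.wSpan (QSpace.OSL.gen N q) (QSpace.OSL.gen N q) (Matrix.diagonal a))) →
          M = N * (N + 1) / 2 ∧
          (IsUnit (QSpace.chiMatrix (QSpace.OSL.rForm hs) e).det ↔
            (s ^ 4 - 1) * (q : ℂ) ^ 2 * ∑ i ∈ Finset.Icc 1 N, (q : ℂ) ^ (-2 * (i : ℤ)) ≠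
              (q : ℂ) ^ 4 - 1 ∧ (q : ℂ) ^ 4 - 1 ≠ 0)) ∧
    (∀ (n : ℕ) (q : ℂˣ) (s : ℂ) (hs : s ^ (2 * n) = q) (a : Fin n → ℂ), 2 ≤ n →
      (∀ i, a i ≠ 0) →
      IsUnit (QSpace.spJ n q a).det ∧
      QSpace.ReflectionEquation (QSpace.OSL.rForm hs) (QSpace.OSL.gen (2 * n) q)
        (QSpace.OSL.gen (2 * n) q) (QSpace.spJ n q a) ∧
      ∀ h : QSpace.OSL (2 * n) q →ₗ[ℂ] ℂ,
        QSpace.IsHaarOn (QSpace.wSpan (QSpace.OSL.gen (2 * n) q) (QSpace.OSL.gen (2 * n) q)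
          (QSpace.spJ n q a)) h →
        ∀ (M : ℕ) (e : Fin M → QSpace.OSL (2 * n) q),
          QSpace.IsBasisOf e (QSpace.splitOff h (QSpace.wSpan (QSpace.OSL.gen (2 * n) q)
            (QSpace.OSL.gen (2 * n) q) (QSpace.spJ n q a))) →
          M = 2 * n * (2 * n - 1) / 2 ∧
          (IsUnit (QSpace.chiMatrix (QSpace.OSL.rForm hs) e).det ↔
            (s ^ 4 - 1) * (q : ℂ) ^ 4 * ∑ i ∈ Finset.Icc 1 n, (q : ℂ) ^ (-4 * (i : ℤ)) ≠
              (q : ℂ) ^ 2 - 1 ∧ (q : ℂ) ^ 2 - 1 ≠ 0)) := by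
  refine ⟨fun H _ _ r hr N U V hU hV J hJu hJ h _ =>
      ⟨QSpace.splitOff_le hr hU hV hJ h, fun M e π he hπ =>
        ⟨QSpace.isUnit_det_chiMatrix_iff_rank hr hU hV hJ hJu he, fun hχ hφ =>
          ⟨QSpace.isSubcalculus_of_isConstructedCalculus hr hU hV hJu he hπ hχ hφ, fun i j a =>
            QSpace.partialH_eq_sum_partialX hr hU hV hJu he (fun i => (e i).2) hπ hχ a.2 i j⟩⟩⟩,
    fun N q s hs a hN ha => ⟨?_, QSpace.reflectionEquation_diagonal hs a, fun h hh M e he =>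
      QSpace.isUnit_chiMatrix_diagonal hs hN ha hh he⟩,
    fun n q s hs a hn ha => ⟨QSpace.isUnit_det_spJ ha, QSpace.reflectionEquation_spJ hs a,
      fun h hh M e he => QSpace.isUnit_chiMatrix_spJ hs hn ha hh he⟩⟩
  rw [Matrix.det_diagonal, isUnit_iff_ne_zero]
  exact Finset.prod_ne_zero_iff.2 fun i _ => ha i
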